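/- **Setting.** Let $\mathcal E_l,\mathcal E_f$ be disjoint finite item sets, $n=|\mathcal E_l|+|\mathcal E_f|$, $b\in\{0,\dots,n\}$, $c\colon \mathcal E_l\cup\mathcal E_f\to\mathbb R$, and $\mathcal U=\prod_{e\in\mathcal E_f}\mathcal U_e$ with nonempty finite sets $\mathcal U_e\subset\mathbb R$; let $u=\sum_{e\in\mathcal E_f}|\mathcal U_e|$. The Robust Continuous Bilevel Selection Problem is $$\min_{x\in[0,1]^{\mathcal E_l}}\ \max_{d\in\mathcal U}\ \sum_{e\in\mathcal E_l}c(e)x_e+\sum_{e\in\mathcal E_f}c(e)y_e,\qquad y\in\operatorname{argmin}_{y'}\Big\{\sum_{e\in\mathcal E_f} d(e)y'_e : y'\in[0,1]^{\mathcal E_f},\ \sum_{e\in\mathcal E_l} x_e+\sum_{e\in\mathcal E_f} y'_e=b\Big\},$$ where $x$ is feasible if the follower's problem (the inner minimization) is feasible. In the pessimistic (optimistic) setting the follower chooses, among his optimal solutions, one that maximizes (minimizes) the leader's cost. The adversary's problem for a fixed feasible $x$ is the maximization over $d\in\mathcal U$. Either the setting is pessimistic, or it is optimistic and the sets $\mathcal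 U_e$ are pairwise disjoint. Write $d^-(e)=\min\mathcal U_e$, $d^+(e)=\max\mathcal U_e$, $c(Y)=\sum_{e\in Y}c(e)$. For $e^*\in\mathcal E_f$ and $\delta^*\in\mathcal U_{e^*}$ let $\mathcal E^-=\{e\in\mathcal E_f: d^+(e)<\delta^*\}$ and $\mathcal E^0=\{e\in\mathcal E_f: d^-(e)\le\delta^*\le d^+(e)\}\setminus\{e^*\}$. For an integer $k\ge 0$, the pair $(e^*,\delta^*)$ is *admissible for $k$* if $|\mathcal E^-|\le k$ and $|\mathcal E^0|\ge k-|\mathcal E^-|$; then $Y^k_{e^*,\delta^*}$ denotes the union of $\mathcal E^-$ and some $k-|\mathcal E^-|$ elements of $\mathcal E^0$ of maximum total cost $c$. **Algorithm 4** (input: an instance and a feasible $x$). Let $b_f=b-\sum_{e\in\mathcal E_l} x_e$. If $b_f\in\{0,|\mathcal E_f|\}$, return any $d\in\mathcal U$. Otherwise let $k=\lfloor b_f\rfloor$, choose $(e^*,\delta^*)$ maximizing $c(Y^k_{e,\delta})+c(e)(b_f-k)$ among all pairs $(e,\delta)$ admissible for $k$, and return $d$ with $d(e^*)=\delta^*$,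 $d=d^-$ on $Y^k_{e^*,\delta^*}$ and $d=d^+$ on all other items. **Algorithm 5** (input: an instance). Let $b_l^-=\max\{0,b-|\mathcal E_f|\}$, $b_l^+=\min\{b,|\mathcal E_l|\}$. If $b_l^-=b_l^+$, let $b_l^*=b_l^-$. Otherwise let $g_l(t)$ be the total cost of the fractional prefix of size $t$ of $\mathcal E_l$ sorted by non-decreasing $c$; for each integer $k$ with $b-b_l^+\le k\le b-b_l^--1$, let $g_f$ on $[b-k-1,b-k]$ be the pointwise maximum, over all pairs $(e,\delta)$ admissible for $k$, of the linear pieces from $(b-k-1,\ c(Y^k_{e,\delta})+c(e))$ to $(b-k,\ c(Y^k_{e,\delta}))$; let $b_l^*$ be a minimizer of $g_l+g_f$ on $[b_l^-,b_l^+]$. Return an $x\in[0,1]^{\mathcal E_l}$ with $\sum_e x_e=b_l^*$ that minimizes $\sum_e c(e)x_e$. **Theorem.** 1. For every instance and every feasible $x$, Algorithm 4 has an output, and each of its possible outputs (however ties are broken) is an optimal solution of the adversary's problem for $x$. 2. For every instance, Algorithm 5 has an output, and each of its possible outputs is an optimal solution of the leader's problem. 3. Algorithm 4 can be implemented on a real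 random access machine to run in time $O(nu)$: there are one program and one constant $C$ such that on every instance and every feasible $x$ the program stops with a possible output of Algorithm 4, after at most $C\,nu$ steps if $nu\ge1$. 4. Algorithm 5 can be implemented on a real random access machine to run in time $O(nu\log(nu))$: there are one program and one constant $C$ such that on every instance the program stops with a possible output of Algorithm 5, after at most $C\,nu\log(nu)$ steps if $nu\ge2$. Here the machine has random access arrays of natural numbers (addition, truncated subtraction, comparison) and of real numbers (field operations, conversion of a natural number, comparison; no rounding); every assignment and every test takes one step. The input lists the numbers of items, $b$, $c$, the cardinalities and the elements of the sets $\mathcal U_e$ (in any order) and, for Algorithm 4, $x$. -/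

import Mathlib

open scoped BigOperators

namespace BilevelSelection

/-! ## The robust continuous bilevel selection problem -/

/-- An instance with leader's items `L` and follower's items `F` (two separate types, so the item
sets are disjoint) and a discrete uncorrelated uncertainty set `∏ e, U e`. -/
structure Instance (L F : Type*) [Fintype L] [Fintype F] where
  /-- the total capacity -/
  b : ℕ
  b_le : b ≤ Fintype.card L + Fintype.card F
  /-- leader's costs of the leader's items -/
  cl : L → ℝ
  /-- leader's costs of the follower's items -/
  cf : F → ℝ
  /-- the possible follower's costs of each follower's item -/
  U : F → Finset ℝ
  U_nonempty : ∀ e, (U e).Nonempty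

/-- How the follower chooses among several optimal solutions of his problem: in favour of the
leader or to the disadvantage of the leader. -/
inductive Setting where
  | optimistic
  | pessimistic

section Selection

/-- `X` is an optimal solution of the (binary) selection problem on the item set `E` with `k` items
to select and item costs `c`. -/
def IsSelection {α : Type*} (E : Finset α) (k : ℕ) (c : α → ℝ) (X : Finset α) : Prop :=
  (X ⊆ E ∧ X.card = k) ∧ ∀ X' : Finset α, X' ⊆ E → X'.card = k → ∑ e ∈ X, c e ≤ ∑ e ∈ X', c e

/-- `x` is feasible for the continuous selection problem on all of `α` with capacity `β`. -/
def IsFractional {α : Type*} [Fintype α] (β : ℝ) (x : α → ℝ) : Prop :=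
  (∀ e, 0 ≤ x e ∧ x e ≤ 1) ∧ ∑ e, x e = β

/-- `x` is an optimal solution of the continuous selection problem on all of `α` with capacity `β`
and item costs `c`. -/
def IsContSelection {α : Type*} [Fintype α] (β : ℝ) (c : α → ℝ) (x : α → ℝ) : Prop :=
  IsFractional β x ∧ ∀ x' : α → ℝ, IsFractional β x' → ∑ e, c e * x e ≤ ∑ e, c e * x' e

/-- The piecewise linear function that maps a capacity `t ∈ [0, |α|]` to the cost of the fractional
prefix of size `t`, where the items are ordered by non-decreasing costs `c`: the `i`-th item
(counted from `0`) is taken with the fraction `max 0 (min 1 (t - i))`. -/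
noncomputable def plf {α : Type*} [Fintype α] (c : α → ℝ) (t : ℝ) : ℝ :=
  ∑ i ∈ Finset.range (Fintype.card α),
    ((Finset.univ.val.map c).sort (· ≤ ·)).getD i 0 * max 0 (min 1 (t - i))

end Selection

namespace Instance

variable {L F : Type*} [Fintype L] [Fintype F]

/-- The number `n` of items. -/
def numItems (_I : Instance L F) : ℕ := Fintype.card L + Fintype.card F

/-- The number `u = ∑ e, |U e|`. -/
def numValues (I : Instance L F) : ℕ := ∑ e, (I.U e).card

/-- `d` is a scenario, i.e. an element of the uncertainty set `∏ e, U e`. -/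
def IsScenario (I : Instance L F) (d : F → ℝ) : Prop := ∀ e, d e ∈ I.U e

/-- The leader's objective function. -/
def leaderCost (I : Instance L F) (x : L → ℝ) (y : F → ℝ) : ℝ :=
  ∑ e, I.cl e * x e + ∑ e, I.cf e * y e

/-- `y` is feasible for the follower, given the leader's solution `x`. -/
def IsFollowerFeasible (I : Instance L F) (x : L → ℝ) (y : F → ℝ) : Prop :=
  (∀ e, 0 ≤ y e ∧ y e ≤ 1) ∧ ∑ e, x e + ∑ e, y e = I.b

/-- `x ∈ [0, 1]^L` is a feasible leader's solution: the follower has a feasible response. -/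
def IsLeaderFeasible (I : Instance L F) (x : L → ℝ) : Prop :=
  (∀ e, 0 ≤ x e ∧ x e ≤ 1) ∧ ∃ y, I.IsFollowerFeasible x y

/-- `y` is an optimal follower's solution, given the leader's solution `x` and the scenario `d`. -/
def IsFollowerOptimal (I : Instance L F) (x : L → ℝ) (d y : F → ℝ) : Prop :=
  I.IsFollowerFeasible x y ∧
    ∀ y', I.IsFollowerFeasible x y' → ∑ e, d e * y e ≤ ∑ e, d e * y' e

/-- `y` is a follower's response: an optimal follower's solution that, among all of them, is best
(optimistic) or worst (pessimistic) for the leader. -/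
def IsFollowerResponse (s : Setting) (I : Instance L F) (x : L → ℝ) (d y : F → ℝ) : Prop :=
  I.IsFollowerOptimal x d y ∧
    ∀ y', I.IsFollowerOptimal x d y' →
      match s with
      | .optimistic => I.leaderCost x y ≤ I.leaderCost x y'
      | .pessimistic => I.leaderCost x y' ≤ I.leaderCost x y

/-- `v` is the leader's cost of the solution `x` in the scenario `d`. -/
def IsScenarioCost (s : Setting) (I : Instance L F) (x : L → ℝ) (d : F → ℝ) (v : ℝ) : Prop :=
  ∃ y, I.IsFollowerResponse s x d y ∧ I.leaderCost x y = v

/-- `v` is the worst-case leader's cost of the solution `x`, i.e. the optimal value of the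
adversary's problem for `x`. -/
def IsRobustCost (s : Setting) (I : Instance L F) (x : L → ℝ) (v : ℝ) : Prop :=
  IsGreatest {w | ∃ d, I.IsScenario d ∧ I.IsScenarioCost s x d w} v

/-- `d` is an optimal solution of the adversary's problem for the leader's solution `x`. -/
def IsAdversaryOptimal (s : Setting) (I : Instance L F) (x : L → ℝ) (d : F → ℝ) : Prop :=
  I.IsScenario d ∧ ∃ v, I.IsScenarioCost s x d v ∧ I.IsRobustCost s x v

/-- `x` is an optimal solution of the robust leader's problem. -/
def IsLeaderOptimal (s : Setting) (I : Instance L F) (x : L → ℝ) : Prop :=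
  I.IsLeaderFeasible x ∧
    ∃ v, I.IsRobustCost s x v ∧
      ∀ x', I.IsLeaderFeasible x' → ∃ v', I.IsRobustCost s x' v' ∧ v ≤ v'

/-! ## The two algorithms

Each algorithm is given as the relation between its input and its possible outputs. The relation
leaves open what the pseudocode leaves open: which optimal solutions the subroutines return, and
which element of an argmax or argmin is selected. -/

/-- `d⁻(e) = min U_e`. -/
noncomputable def dmin (I : Instance L F) (e : F) : ℝ := (I.U e).min' (I.U_nonempty e)

/-- `d⁺(e) = max U_e`. -/
noncomputable def dmax (I : Instance L F) (e : F) : ℝ := (I.U e).max' (I.U_nonempty e)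

/-- The items that precede the reference value `δ` in every scenario. -/
noncomputable def itemsBefore (I : Instance L F) (δ : ℝ) : Finset F :=
  Finset.univ.filter fun e => I.dmax e < δ

variable [DecidableEq F]

/-- The items other than `e` whose range of costs contains the reference value `δ`. -/
noncomputable def itemsAround (I : Instance L F) (e : F) (δ : ℝ) : Finset F :=
  (Finset.univ.filter fun e' => I.dmin e' ≤ δ ∧ δ ≤ I.dmax e').erase e

/-- The guess `(e, δ)` of the fractional item and its cost is considered for the integer
follower's capacity `k`. -/
def IsGuess (I : Instance L F) (k : ℕ) (e : F) (δ : ℝ) : Prop :=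
  δ ∈ I.U e ∧ (I.itemsBefore δ).card ≤ k ∧
    k - (I.itemsBefore δ).card ≤ (I.itemsAround e δ).card

/-- `Y` is a possible choice of the `k` items that are selected completely for the guess
`(e, δ)`. -/
def IsGuessedSet (I : Instance L F) (k : ℕ) (e : F) (δ : ℝ) (Y : Finset F) : Prop :=
  ∃ Y₀, IsSelection (I.itemsAround e δ) (k - (I.itemsBefore δ).card) (fun e' => -I.cf e') Y₀ ∧
    Y = I.itemsBefore δ ∪ Y₀

/-- The scenario that is built from the guess `(e, δ)` and the set `Y`. -/
noncomputable def guessedScenario (I : Instance L F) (e : F) (δ : ℝ) (Y : Finset F) : F → ℝ :=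
  fun e' => if e' = e then δ else if e' ∈ Y then I.dmin e' else I.dmax e'

/-- The algorithm for the adversary's problem may return `d` for the leader's solution `x`. -/
def AdversaryAlg (I : Instance L F) (x : L → ℝ) (d : F → ℝ) : Prop :=
  let bf : ℝ := I.b - ∑ e, x e
  if bf = 0 ∨ bf = Fintype.card F then I.IsScenario d
  else
    let k : ℕ := ⌊bf⌋₊
    ∃ Y : F → ℝ → Finset F, (∀ e δ, I.IsGuess k e δ → I.IsGuessedSet k e δ (Y e δ)) ∧
      ∃ e δ, I.IsGuess k e δ ∧
        (∀ e' δ', I.IsGuess k e' δ' →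
          ∑ i ∈ Y e' δ', I.cf i + I.cf e' * (bf - k) ≤ ∑ i ∈ Y e δ, I.cf i + I.cf e * (bf - k)) ∧
        d = I.guessedScenario e δ (Y e δ)

/-- The smallest leader's capacity, `max {0, b - |F|}`. -/
def blMin (I : Instance L F) : ℕ := I.b - Fintype.card F

/-- The largest leader's capacity, `min {b, |L|}`. -/
def blMax (I : Instance L F) : ℕ := min I.b (Fintype.card L)

/-- `gf` is the function on `[blMin, blMax]` that is joined from the pointwise maxima, for all
integers `k` from `b - blMax` to `b - blMin - 1`, of the linear pieces from
`(b - k - 1, c(Y) + c(e))` to `(b - k, c(Y))` over all guesses `(e, δ)` for `k`, where `Y` is the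
set of items computed for the guess. -/
def IsFollowerPLF (I : Instance L F) (gf : ℝ → ℝ) : Prop :=
  ∃ Y : ℕ → F → ℝ → Finset F, ∀ k : ℕ, I.b - I.blMax ≤ k → k < I.b - I.blMin →
    (∀ e δ, I.IsGuess k e δ → I.IsGuessedSet k e δ (Y k e δ)) ∧
    ∀ t : ℝ, (I.b : ℝ) - k - 1 ≤ t → t ≤ (I.b : ℝ) - k →
      IsGreatest
        {w | ∃ e δ, I.IsGuess k e δ ∧ w = ∑ i ∈ Y k e δ, I.cf i + I.cf e * ((I.b : ℝ) - k - t)}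
        (gf t)

/-- The algorithm for the leader's problem may return `x`. -/
def LeaderAlg (I : Instance L F) (x : L → ℝ) : Prop :=
  ∃ bl : ℝ,
    (if I.blMin = I.blMax then bl = I.blMin
     else ∃ gf : ℝ → ℝ, I.IsFollowerPLF gf ∧ bl ∈ Set.Icc (I.blMin : ℝ) I.blMax ∧
       ∀ t ∈ Set.Icc (I.blMin : ℝ) I.blMax, plf I.cl bl + gf bl ≤ plf I.cl t + gf t) ∧
    IsContSelection bl I.cl x

end Instance

/-! ## The machine model

A real random access machine with finitely many arrays of natural numbers and finitely many arrays
of real numbers. It is programmed in a structured language. On natural numbers there are addition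
and truncated subtraction, on real numbers the four field operations; both can be compared. There
is no rounding and no multiplication of natural numbers. Indices may be computed, names of arrays
may not. Every assignment and every test takes one step: the expressions of a fixed program have
bounded size, so that this is the number of elementary operations up to a constant factor. -/

/-- The contents of the memory: `nat a i` and `real a i` are the `i`-th cells of the `a`-th arrays.
A scalar variable is an array of which only the cell `0` is used. -/
structure Store where
  nat : ℕ → ℕ → ℕ
  real : ℕ → ℕ → ℝ

/-- Expressions for natural numbers. -/
inductive NatExpr where
  | const (k : ℕ)
  | get (a : ℕ) (i : NatExpr)
  | add (p q : NatExpr)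
  | sub (p q : NatExpr)

/-- Expressions for real numbers. -/
inductive RealExpr where
  | ofNat (p : NatExpr)
  | get (a : ℕ) (i : NatExpr)
  | add (p q : RealExpr)
  | sub (p q : RealExpr)
  | mul (p q : RealExpr)
  | div (p q : RealExpr)

/-- Tests. -/
inductive Test where
  | natLe (p q : NatExpr)
  | realLe (p q : RealExpr)
  | not (t : Test)
  | and (t t' : Test)

/-- Programs. -/
inductive Prog where
  | skip
  | setNat (a : ℕ) (i v : NatExpr)
  | setReal (a : ℕ) (i : NatExpr) (v : RealExpr)
  | seq (P Q : Prog)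
  | branch (t : Test) (P Q : Prog)
  | loop (t : Test) (P : Prog)

/-- The value of an expression for natural numbers. -/
def NatExpr.eval (σ : Store) : NatExpr → ℕ
  | .const k => k
  | .get a i => σ.nat a (i.eval σ)
  | .add p q => p.eval σ + q.eval σ
  | .sub p q => p.eval σ - q.eval σ

/-- The value of an expression for real numbers. -/
noncomputable def RealExpr.eval (σ : Store) : RealExpr → ℝ
  | .ofNat p => (p.eval σ : ℝ)
  | .get a i => σ.real a (i.eval σ)
  | .add p q => p.eval σ + q.eval σ
  | .sub p q => p.eval σ - q.eval σ
  | .mul p q => p.eval σ * q.eval σ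
  | .div p q => p.eval σ / q.eval σ

/-- The test succeeds. -/
def Test.Holds (σ : Store) : Test → Prop
  | .natLe p q => p.eval σ ≤ q.eval σ
  | .realLe p q => p.eval σ ≤ q.eval σ
  | .not t => ¬ t.Holds σ
  | .and t t' => t.Holds σ ∧ t'.Holds σ

/-- Write `v` into the `i`-th cell of the `a`-th array of natural numbers. -/
def Store.setNat (σ : Store) (a i v : ℕ) : Store :=
  { σ with nat := Function.update σ.nat a (Function.update (σ.nat a) i v) }

/-- Write `v` into the `i`-th cell of the `a`-th array of real numbers. -/
noncomputable def Store.setReal (σ : Store) (a i : ℕ) (v : ℝ) : Store :=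
  { σ with real := Function.update σ.real a (Function.update (σ.real a) i v) }

/-- `Exec P σ k τ`: the program `P`, started with the memory `σ`, stops after exactly `k` steps with
the memory `τ`. -/
inductive Exec : Prog → Store → ℕ → Store → Prop
  | skip (σ : Store) : Exec .skip σ 1 σ
  | setNat (σ : Store) (a : ℕ) (i v : NatExpr) :
      Exec (.setNat a i v) σ 1 (σ.setNat a (i.eval σ) (v.eval σ))
  | setReal (σ : Store) (a : ℕ) (i : NatExpr) (v : RealExpr) :
      Exec (.setReal a i v) σ 1 (σ.setReal a (i.eval σ) (v.eval σ))
  | seq {P Q : Prog} {σ σ' σ'' : Store} {k k' : ℕ} :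
      Exec P σ k σ' → Exec Q σ' k' σ'' → Exec (.seq P Q) σ (k + k') σ''
  | branchTrue {t : Test} {P Q : Prog} {σ σ' : Store} {k : ℕ} :
      t.Holds σ → Exec P σ k σ' → Exec (.branch t P Q) σ (k + 1) σ'
  | branchFalse {t : Test} {P Q : Prog} {σ σ' : Store} {k : ℕ} :
      ¬ t.Holds σ → Exec Q σ k σ' → Exec (.branch t P Q) σ (k + 1) σ'
  | loopFalse {t : Test} {P : Prog} {σ : Store} :
      ¬ t.Holds σ → Exec (.loop t P) σ 1 σ
  | loopTrue {t : Test} {P : Prog} {σ σ' σ'' : Store} {k k' : ℕ} :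
      t.Holds σ → Exec P σ k σ' → Exec (.loop t P) σ' k' σ'' →
      Exec (.loop t P) σ (k + k' + 1) σ''

namespace Instance

variable {nl nf : ℕ}

/-- `V e` lists the elements of `U e` without repetition, in any order. -/
def IsListing (I : Instance (Fin nl) (Fin nf)) (V : Fin nf → List ℝ) : Prop :=
  ∀ e, (V e).Nodup ∧ ∀ r, r ∈ V e ↔ r ∈ I.U e

/-- The input of the leader's problem. Arrays of natural numbers: array `0` holds the numbers of
leader's and follower's items and the capacity, array `1` the cardinalities `|U e|`. Arrays of real
numbers: arrays `0` and `1` hold the leader's costs of the leader's and of the follower's items,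
array `2` the elements of all sets `U e`, one set after another. All other cells are zero. -/
noncomputable def leaderInput (I : Instance (Fin nl) (Fin nf)) (V : Fin nf → List ℝ) : Store where
  nat a i :=
    match a with
    | 0 => [nl, nf, I.b].getD i 0
    | 1 => (List.ofFn fun e => (V e).length).getD i 0
    | _ => 0
  real a i :=
    match a with
    | 0 => (List.ofFn I.cl).getD i 0
    | 1 => (List.ofFn I.cf).getD i 0
    | 2 => (List.ofFn V).flatten.getD i 0
    | _ => 0

/-- The input of the adversary's problem: as for the leader's problem, and the array `3` of real
numbers holds the leader's solution `x`. -/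
noncomputable def adversaryInput (I : Instance (Fin nl) (Fin nf)) (V : Fin nf → List ℝ)
    (x : Fin nl → ℝ) : Store :=
  { I.leaderInput V with
    real := Function.update (I.leaderInput V).real 3 fun i => (List.ofFn x).getD i 0 }

end Instance

/-- The output of a program: the first `m` cells of the array `4` of real numbers. -/
def Store.output (σ : Store) (m : ℕ) : Fin m → ℝ := fun i => σ.real 4 i

end BilevelSelection

/-! Let the follower's capacity be β with k ≤ β ≤ k + 1. In a scenario d the follower takes k
cheapest items completely and one further item e with the fraction β - k. The threshold δ = d e
certifies optimality, being the multiplier of the capacity constraint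
(`isContSelection_of_threshold`). If only e and δ are known, the items of `itemsBefore δ` are
certainly taken, and those of `itemsAround e δ` can be put on either side of δ, independently of
each other because the uncertainty set is a product. So no scenario with this pair beats the choice
of the items around δ that cost the leader most (`exists_guess_ge`), and the scenario with minima on
the chosen set and maxima elsewhere attains it (`IsGuessedSet.isContSelection`). Together, the
maximum over all guesses is the adversary's optimum (`isGreatest_responseCosts`).

All this is done for pessimistic tie-breaking. If the sets of costs are pairwise disjoint, every
scenario is injective, the response is unique (`IsContSelection.eq_of_injective`), and the
optimistic rule gives the same costs (`isScenarioCost_iff`).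

For the leader, a solution with sum t has a worst case equal to its own cost plus a function of t
alone. The best solution with sum t is a fractional prefix, so one minimizes a function of one real
variable. It is continuous on each of finitely many compact pieces, hence the minimum exists
(`exists_leaderAlg`).

The running times rest on three observations. One scan of the items by non-increasing cost passes
through the guessed sets of a pair for all k at once, so the table of their costs takes time O(nu)
(`runs_tableRow`). With the pairs sorted once by slope, each upper envelope is built on a stack in
time O(u), since removals are paid for by insertions (`runs_envProg`). An envelope plus a linear
function is minimal at a breakpoint (`EnvInv.exists_candidate`). For the leader, logarithms enter
only through merge sort. For the adversary even a quadratic bound on sorting suffices, because every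
item has at least one cost and hence the follower has at most u items.

Programs are verified with `Runs`, which combines termination, a step bound and a postcondition, and
with the syntactic frame condition `Unchanged`. -/

namespace BilevelSelection

/-! ### Greedy solutions of the continuous selection problem. -/

section Selection

variable {α : Type*} [Fintype α]

/-- Repeatedly move a minimum of the complement into the prefix. The keys lie in an arbitrary linear
order so that lexicographic pairs can be used to break ties. -/
theorem exists_prefix {κ : Type*} [LinearOrder κ] (w : α → κ) {k : ℕ}
    (hk : k < Fintype.card α) :
    ∃ (P : Finset α) (e : α), e ∉ P ∧ P.card = k ∧ (∀ p ∈ P, w p ≤ w e) ∧ ∀ q ∉ P, w e ≤ w q := by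
  classical
  induction k with
  | zero =>
    have hne : (Finset.univ : Finset α).Nonempty := by
      rw [← Finset.card_pos, Finset.card_univ]; exact hk
    obtain ⟨e, -, he⟩ := Finset.exists_min_image Finset.univ w hne
    exact ⟨∅, e, by simp, by simp, by simp, fun q _ => he q (Finset.mem_univ q)⟩
  | succ k ih =>
    obtain ⟨P, e, he, hP, h1, h2⟩ := ih (by omega)
    have hne : ((insert e P)ᶜ).Nonempty := by
      rw [← Finset.card_pos, Finset.card_compl, Finset.card_insert_of_notMem he]; omega
    obtain ⟨e', he', hmin⟩ := Finset.exists_min_image _ w hne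
    have he'' : e' ∉ insert e P := by simpa using he'
    have hee' : w e ≤ w e' := h2 e' fun h => he'' (Finset.mem_insert_of_mem h)
    refine ⟨insert e P, e', he'', by rw [Finset.card_insert_of_notMem he, hP], ?_, ?_⟩
    · intro p hp
      rcases Finset.mem_insert.1 hp with rfl | hp
      · exact hee'
      · exact (h1 p hp).trans hee'
    · intro q hq
      exact hmin q (by simpa using hq)

/-- The solution that selects `P` completely and `e` with the fraction `r`. -/
noncomputable def prefixSol [DecidableEq α] (P : Finset α) (e : α) (r : ℝ) : α → ℝ :=
  fun i => if i = e then r else if i ∈ P then 1 else 0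

theorem sum_mul_prefixSol [DecidableEq α] {P : Finset α} {e : α} (he : e ∉ P) (r : ℝ) (c : α → ℝ) :
    ∑ i, c i * prefixSol P e r i = ∑ i ∈ P, c i + c e * r := by
  have h : ∀ i, c i * prefixSol P e r i
      = (if i ∈ P then c i else 0) + (if i = e then c e * r else 0) := by
    intro i
    unfold prefixSol
    by_cases hi : i = e
    · subst hi; simp [he]
    · simp [hi]
  simp only [h, Finset.sum_add_distrib, Finset.sum_ite_mem, Finset.sum_ite_eq',
    Finset.mem_univ, if_true, Finset.univ_inter]

theorem isFractional_prefixSol [DecidableEq α] {P : Finset α} {e : α} (he : e ∉ P) {β : ℝ}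
    (h1 : P.card ≤ β) (h2 : β ≤ P.card + 1) : IsFractional β (prefixSol P e (β - P.card)) := by
  constructor
  · intro i
    unfold prefixSol
    split_ifs
    · constructor <;> linarith
    · simp
    · simp
  · have := sum_mul_prefixSol he (β - P.card) fun _ => 1
    simp only [one_mul] at this
    rw [this]; simp

section Threshold

variable {β δ : ℝ} {d y y' : α → ℝ}

/-- The two solutions have the same sum, so shifting all costs by a constant does not change the
difference of their values. -/
theorem sum_sub_threshold (hy : IsFractional β y) (hy' : IsFractional β y') (d : α → ℝ) (δ : ℝ) :
    ∑ i, (d i - δ) * (y' i - y i) = ∑ i, d i * y' i - ∑ i, d i * y i := by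
  have : ∑ i, (d i - δ) * (y' i - y i)
      = ∑ i, d i * y' i - ∑ i, d i * y i - δ * (∑ i, y' i - ∑ i, y i) := by
    rw [← Finset.sum_sub_distrib, ← Finset.sum_sub_distrib, Finset.mul_sum,
      ← Finset.sum_sub_distrib]
    exact Finset.sum_congr rfl fun i _ => by ring
  rw [this, hy.2, hy'.2]; ring

theorem threshold_term_nonneg (h1 : ∀ i, d i < δ → y i = 1) (h0 : ∀ i, δ < d i → y i = 0)
    (hy' : IsFractional β y') (i : α) : 0 ≤ (d i - δ) * (y' i - y i) := by
  rcases lt_trichotomy (d i) δ with h | h | h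
  · rw [h1 i h]
    exact mul_nonneg_of_nonpos_of_nonpos (by linarith) (by linarith [(hy'.1 i).2])
  · simp [h]
  · rw [h0 i h]
    exact mul_nonneg (by linarith) (by linarith [(hy'.1 i).1])

/-- Weak duality: after the costs are shifted by δ, every item separately contributes a nonnegative
amount to the difference from any competitor. -/
theorem isContSelection_of_threshold (hy : IsFractional β y) (h1 : ∀ i, d i < δ → y i = 1)
    (h0 : ∀ i, δ < d i → y i = 0) : IsContSelection β d y := by
  refine ⟨hy, fun y' hy' => ?_⟩
  have := sum_sub_threshold hy hy' d δ
  have h2 := Finset.sum_nonneg fun i (_ : i ∈ Finset.univ) => threshold_term_nonneg h1 h0 hy' i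
  linarith

/-- Complementary slackness: if the competitor is optimal as well, the nonnegative contributions of
the single items sum to zero, so each of them vanishes. -/
theorem eq_off_threshold (hy : IsFractional β y) (h1 : ∀ i, d i < δ → y i = 1)
    (h0 : ∀ i, δ < d i → y i = 0) (hy' : IsContSelection β d y') {i : α} (hi : d i ≠ δ) :
    y' i = y i := by
  have h2 := sum_sub_threshold hy hy'.1 d δ
  have h3 := hy'.2 y hy
  have h4 := fun i => threshold_term_nonneg h1 h0 hy'.1 i
  have h5 : ∑ i, (d i - δ) * (y' i - y i) = 0 :=
    le_antisymm (by linarith) (Finset.sum_nonneg fun i _ => h4 i)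
  have h6 := (Finset.sum_eq_zero_iff_of_nonneg fun i _ => h4 i).1 h5 i (Finset.mem_univ i)
  rcases mul_eq_zero.1 h6 with h | h
  · exact absurd (by linarith) hi
  · linarith

end Threshold

theorem isContSelection_prefixSol [DecidableEq α] {d : α → ℝ} {P : Finset α} {e : α} (he : e ∉ P)
    (h1 : ∀ p ∈ P, d p ≤ d e) (h2 : ∀ q ∉ P, d e ≤ d q) {β : ℝ} (hβ : P.card ≤ β)
    (hβ' : β ≤ P.card + 1) : IsContSelection β d (prefixSol P e (β - P.card)) := by
  refine isContSelection_of_threshold (δ := d e) (isFractional_prefixSol he hβ hβ') ?_ ?_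
  · intro i hi
    have h3 : i ≠ e := by rintro rfl; exact lt_irrefl _ hi
    have h4 : i ∈ P := by by_contra h; exact absurd (h2 i h) (not_le.2 hi)
    simp [prefixSol, h3, h4]
  · intro i hi
    have h3 : i ≠ e := by rintro rfl; exact lt_irrefl _ hi
    have h4 : i ∉ P := fun h => absurd (h1 i h) (not_le.2 hi)
    simp [prefixSol, h3, h4]

/-- Among all optimal solutions, the greedy one with ties broken in favour of `c` maximizes `c`. -/
theorem sum_le_prefixSol [DecidableEq α] {d c : α → ℝ} {P : Finset α} {e : α} (he : e ∉ P)
    (h1 : ∀ p ∈ P, d p < d e ∨ d p = d e ∧ c e ≤ c p)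
    (h2 : ∀ q ∉ P, d e < d q ∨ d e = d q ∧ c q ≤ c e) {β : ℝ} (hβ : P.card ≤ β)
    (hβ' : β ≤ P.card + 1) {y : α → ℝ} (hy : IsContSelection β d y) :
    ∑ i, c i * y i ≤ ∑ i ∈ P, c i + c e * (β - P.card) := by
  rw [← sum_mul_prefixSol he]
  set z := prefixSol P e (β - P.card) with hz
  have hzf : IsFractional β z := isFractional_prefixSol he hβ hβ'
  have hoff : ∀ i, d i ≠ d e → y i = z i := by
    intro i hi
    refine eq_off_threshold hzf (δ := d e) ?_ ?_ hy hi
    · intro i hi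
      have h3 : i ≠ e := by rintro rfl; exact lt_irrefl _ hi
      have h4 : i ∈ P := by
        by_contra h
        rcases h2 i h with h | h <;> linarith
      simp [hz, prefixSol, h3, h4]
    · intro i hi
      have h3 : i ≠ e := by rintro rfl; exact lt_irrefl _ hi
      have h4 : i ∉ P := fun h => by rcases h1 i h with h | h <;> linarith
      simp [hz, prefixSol, h3, h4]
  -- The solutions `y` and `z` can differ only where `d` equals `d e`. There the items are ordered
  -- by `c`, and the threshold argument is repeated for `c` with the threshold `c e`.
  have hsum := sum_sub_threshold hy.1 hzf c (c e)
  have hnn : 0 ≤ ∑ i, (c i - c e) * (z i - y i) := by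
    refine Finset.sum_nonneg fun i _ => ?_
    by_cases hi : i = e
    · simp [hi]
    by_cases hd : d i = d e
    · by_cases hP : i ∈ P
      · have : z i = 1 := by simp [hz, prefixSol, hi, hP]
        rw [this]
        rcases h1 i hP with h | h
        · linarith
        · exact mul_nonneg (by linarith) (by linarith [(hy.1.1 i).2])
      · have : z i = 0 := by simp [hz, prefixSol, hi, hP]
        rw [this]
        rcases h2 i hP with h | h
        · linarith
        · exact mul_nonneg_of_nonpos_of_nonpos (by linarith) (by linarith [(hy.1.1 i).1])
    · rw [hoff i hd]; simp
  linarith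

/-- The threshold determines all fractions except that of the single item whose cost equals it, and
the capacity determines this last one. -/
theorem IsContSelection.eq_of_injective {d : α → ℝ} (hd : Function.Injective d)
    {β : ℝ} {y y' : α → ℝ} (hy : IsContSelection β d y) (hy' : IsContSelection β d y') :
    y = y' := by
  classical
  have hβ0 : 0 ≤ β := by rw [← hy.1.2]; exact Finset.sum_nonneg fun i _ => (hy.1.1 i).1
  have hβ1 : β ≤ Fintype.card α := by
    rw [← hy.1.2]
    calc ∑ i, y i ≤ ∑ _i : α, (1 : ℝ) := Finset.sum_le_sum fun i _ => (hy.1.1 i).2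
      _ = _ := by simp
  rcases Nat.eq_zero_or_pos (Fintype.card α) with h0 | h0
  · have := Fintype.card_eq_zero_iff.1 h0
    exact Subsingleton.elim _ _
  obtain ⟨k, hk, hk1, hk2⟩ : ∃ k < Fintype.card α, (k : ℝ) ≤ β ∧ β ≤ k + 1 := by
    rcases lt_or_ge β (Fintype.card α) with h | h
    · refine ⟨⌊β⌋₊, (Nat.floor_lt hβ0).2 h, Nat.floor_le hβ0, (Nat.lt_floor_add_one β).le⟩
    · refine ⟨Fintype.card α - 1, by omega, ?_, ?_⟩ <;> push_cast [h0] <;> linarith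
  obtain ⟨P, e, he, rfl, h1, h2⟩ := exists_prefix d hk
  have hz := isFractional_prefixSol he hk1 hk2
  have key : ∀ y, IsContSelection β d y → y = prefixSol P e (β - P.card) := by
    intro y hy
    have hne : ∀ i, i ≠ e → y i = prefixSol P e (β - P.card) i := by
      intro i hi
      refine eq_off_threshold (δ := d e) hz ?_ ?_ hy fun h => hi (hd h)
      · intro i hi
        have h3 : i ≠ e := by rintro rfl; exact lt_irrefl _ hi
        have h4 : i ∈ P := by by_contra h; exact absurd (h2 i h) (not_le.2 hi)
        simp [prefixSol, h3, h4]
      · intro i hi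
        have h3 : i ≠ e := by rintro rfl; exact lt_irrefl _ hi
        have h4 : i ∉ P := fun h => absurd (h1 i h) (not_le.2 hi)
        simp [prefixSol, h3, h4]
    funext i
    by_cases hi : i = e
    · subst hi
      have h3 := hy.1.2.trans hz.2.symm
      rw [← Finset.add_sum_erase _ _ (Finset.mem_univ i),
        ← Finset.add_sum_erase _ _ (Finset.mem_univ i),
        Finset.sum_congr rfl fun j hj => hne j (Finset.ne_of_mem_erase hj)] at h3
      linarith
    · exact hne i hi
  rw [key y hy, key y' hy']

/-- This differs from the floor only for β = m, where the answer is m - 1; a piece whose index is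
below m then exists on the whole closed interval. -/
theorem exists_natPart {m : ℕ} (hm : 0 < m) {β : ℝ} (h0 : 0 ≤ β) (h1 : β ≤ m) :
    ∃ k < m, (k : ℝ) ≤ β ∧ β ≤ k + 1 := by
  rcases lt_or_ge β m with h | h
  · exact ⟨⌊β⌋₊, (Nat.floor_lt h0).2 h, Nat.floor_le h0, (Nat.lt_floor_add_one β).le⟩
  · refine ⟨m - 1, by omega, ?_, ?_⟩ <;> push_cast [hm] <;> linarith

/-- Every scenario admits an optimal solution that maximizes `c`, and it is a greedy solution. -/
theorem exists_isGreatest_prefix (d c : α → ℝ) {k : ℕ} (hk : k < Fintype.card α) {β : ℝ}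
    (h1 : k ≤ β) (h2 : β ≤ k + 1) :
    ∃ (P : Finset α) (e : α), e ∉ P ∧ P.card = k ∧ (∀ p ∈ P, d p ≤ d e) ∧ (∀ q ∉ P, d e ≤ d q) ∧
      IsGreatest {w | ∃ y, IsContSelection β d y ∧ w = ∑ i, c i * y i}
        (∑ i ∈ P, c i + c e * (β - k)) := by
  classical
  -- The second component makes the greedy solution prefer large `c` among items of equal `d`.
  obtain ⟨P, e, he, rfl, hP, hQ⟩ := exists_prefix (fun i => toLex (d i, -c i)) hk
  have hP' : ∀ p ∈ P, d p < d e ∨ d p = d e ∧ c e ≤ c p := by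
    intro p hp
    simpa [Prod.Lex.toLex_le_toLex] using hP p hp
  have hQ' : ∀ q ∉ P, d e < d q ∨ d e = d q ∧ c q ≤ c e := by
    intro p hp
    simpa [Prod.Lex.toLex_le_toLex] using hQ p hp
  have hP'' : ∀ p ∈ P, d p ≤ d e := fun p hp => by
    rcases hP' p hp with h | h
    · exact h.le
    · exact h.1.le
  have hQ'' : ∀ q ∉ P, d e ≤ d q := fun p hp => by
    rcases hQ' p hp with h | h
    · exact h.le
    · exact h.1.le
  refine ⟨P, e, he, rfl, hP'', hQ'', ⟨_, isContSelection_prefixSol he hP'' hQ'' h1 h2,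
    (sum_mul_prefixSol he _ _).symm⟩, ?_⟩
  rintro w ⟨y, hy, rfl⟩
  exact sum_le_prefixSol he hP' hQ' h1 h2 hy

theorem exists_isGreatest_contSelection (d c : α → ℝ) {β : ℝ} (h0 : 0 ≤ β)
    (h1 : β ≤ Fintype.card α) :
    ∃ w, IsGreatest {w | ∃ y, IsContSelection β d y ∧ w = ∑ i, c i * y i} w := by
  rcases Nat.eq_zero_or_pos (Fintype.card α) with h | h
  · have := Fintype.card_eq_zero_iff.1 h
    rw [h] at h1
    have hβ : β = 0 := le_antisymm (by simpa using h1) h0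
    refine ⟨0, ⟨fun _ => 0, ⟨⟨by simp, by simp [hβ]⟩, by simp⟩, by simp⟩, ?_⟩
    rintro w ⟨y, -, rfl⟩
    simp
  · obtain ⟨k, hk, hk1, hk2⟩ := exists_natPart h h0 h1
    obtain ⟨P, e, -, -, -, -, hg⟩ := exists_isGreatest_prefix d c hk hk1 hk2
    exact ⟨_, hg⟩

/-- The fraction with which the `i`-th item belongs to the fractional prefix of size `t`. -/
noncomputable def clamp (t : ℝ) (i : ℕ) : ℝ := max 0 (min 1 (t - i))

theorem clamp_nonneg (t : ℝ) (i : ℕ) : 0 ≤ clamp t i := le_max_left _ _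

theorem clamp_le_one (t : ℝ) (i : ℕ) : clamp t i ≤ 1 := max_le zero_le_one (min_le_left _ _)

theorem clamp_of_le {t : ℝ} {i : ℕ} (h : t ≤ i) : clamp t i = 0 :=
  max_eq_left ((min_le_right _ _).trans (by linarith))

theorem clamp_of_ge {t : ℝ} {i : ℕ} (h : (i : ℝ) + 1 ≤ t) : clamp t i = 1 := by
  rw [clamp, min_eq_left (by linarith)]; simp

theorem clamp_of_mem {t : ℝ} {i : ℕ} (h : (i : ℝ) ≤ t) (h' : t ≤ i + 1) : clamp t i = t - i := by
  rw [clamp, min_eq_right (by linarith), max_eq_right (by linarith)]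

/-- Items before `j` have the fraction 1, items after `j` the fraction 0, and only `j` itself is
fractional. -/
theorem sum_range_mul_clamp (a : ℕ → ℝ) {n j : ℕ} (hj : j < n) {t : ℝ} (h : (j : ℝ) ≤ t)
    (h' : t ≤ j + 1) :
    ∑ i ∈ Finset.range n, a i * clamp t i = ∑ i ∈ Finset.range j, a i + a j * (t - j) := by
  rw [← Finset.sum_range_add_sum_Ico _ hj, Finset.sum_range_succ, clamp_of_mem h h']
  have h1 : ∑ i ∈ Finset.range j, a i * clamp t i = ∑ i ∈ Finset.range j, a i := by
    refine Finset.sum_congr rfl fun i hi => ?_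
    have : ((i + 1 : ℕ) : ℝ) ≤ j := by exact_mod_cast Finset.mem_range.1 hi
    rw [clamp_of_ge (by push_cast at this; linarith), mul_one]
  have h2 : ∑ i ∈ Finset.Ico (j + 1) n, a i * clamp t i = 0 := by
    refine Finset.sum_eq_zero fun i hi => ?_
    have : ((j + 1 : ℕ) : ℝ) ≤ i := by exact_mod_cast (Finset.mem_Ico.1 hi).1
    rw [clamp_of_le (by push_cast at this; linarith), mul_zero]
  rw [h1, h2, add_zero]

theorem sum_range_clamp {n : ℕ} {t : ℝ} (h0 : 0 ≤ t) (h1 : t ≤ n) :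
    ∑ i ∈ Finset.range n, clamp t i = t := by
  rcases Nat.eq_zero_or_pos n with rfl | hn
  · simp at h1; simp; linarith
  · obtain ⟨k, hk, hk1, hk2⟩ := exists_natPart hn h0 h1
    have := sum_range_mul_clamp (fun _ => 1) hk hk1 hk2
    simpa using this

/-- A sorted list of numbers is determined by its multiset, so any sorting bijection may be used,
however it treats ties. -/
theorem plf_eq_sum {n : ℕ} (c : α → ℝ) (σ : Fin n ≃ α) (hσ : Monotone (c ∘ σ)) (t : ℝ) :
    plf c t = ∑ i : Fin n, c (σ i) * clamp t i := by
  have hn : Fintype.card α = n := by rw [← Fintype.card_congr σ, Fintype.card_fin]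
  have hl : (Finset.univ.val.map c).sort (· ≤ ·) = List.ofFn (c ∘ σ) := by
    have h1 : (Finset.univ.val.map c) = ((List.ofFn (c ∘ σ) : List ℝ) : Multiset ℝ) := by
      have h2 : (Finset.univ : Finset α) = Finset.univ.map σ.toEmbedding := by simp
      rw [h2, Finset.map_val, Multiset.map_map, List.ofFn_eq_map, ← Multiset.map_coe]
      rfl
    rw [h1]
    refine List.Perm.eq_of_pairwise (le := (· ≤ ·)) (fun a b _ _ hab hba => le_antisymm hab hba)
      (Multiset.pairwise_sort _ _) ?_ ?_
    · rw [List.pairwise_ofFn]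
      exact fun i j hij => hσ hij.le
    · rw [← Multiset.coe_eq_coe, Multiset.sort_eq]
  rw [plf, hl, hn, Finset.sum_range]
  refine Finset.sum_congr rfl fun i _ => ?_
  rw [List.getD_eq_getElem _ _ (by simp)]
  simp [clamp]

/-- The threshold is the cost of the item at the possibly fractional position `k`. -/
theorem isContSelection_clamp {n : ℕ} (c : α → ℝ) (σ : Fin n ≃ α) (hσ : Monotone (c ∘ σ)) {t : ℝ}
    (h0 : 0 ≤ t) (h1 : t ≤ n) : IsContSelection t c fun a => clamp t (σ.symm a) := by
  have hf : IsFractional t fun a => clamp t (σ.symm a) := by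
    refine ⟨fun e => ⟨clamp_nonneg _ _, clamp_le_one _ _⟩, ?_⟩
    rw [Equiv.sum_comp σ.symm (fun i : Fin n => clamp t i), ← Finset.sum_range, sum_range_clamp h0 h1]
  rcases Nat.eq_zero_or_pos n with rfl | hn
  · have : IsEmpty α := σ.symm.isEmpty
    exact ⟨hf, by simp⟩
  · obtain ⟨k, hk, hk1, hk2⟩ := exists_natPart hn h0 h1
    refine isContSelection_of_threshold (δ := c (σ ⟨k, hk⟩)) hf ?_ ?_
    · intro a ha
      have h2 : ((σ.symm a : Fin n) : ℕ) < k := by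
        by_contra h
        have := hσ (show (⟨k, hk⟩ : Fin n) ≤ σ.symm a from not_lt.1 h)
        simp only [Function.comp_apply, Equiv.apply_symm_apply] at this
        linarith
      have h3 : (((σ.symm a : Fin n) : ℕ) : ℝ) + 1 ≤ k := by exact_mod_cast h2
      exact clamp_of_ge (by linarith)
    · intro a ha
      have h2 : k < ((σ.symm a : Fin n) : ℕ) := by
        by_contra h
        have := hσ (show σ.symm a ≤ (⟨k, hk⟩ : Fin n) from not_lt.1 h)
        simp only [Function.comp_apply, Equiv.apply_symm_apply] at this
        linarith
      have h3 : (k : ℝ) + 1 ≤ (((σ.symm a : Fin n) : ℕ) : ℝ) := by exact_mod_cast h2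
      exact clamp_of_le (by linarith)

theorem exists_monotone_equiv (c : α → ℝ) :
    ∃ σ : Fin (Fintype.card α) ≃ α, Monotone (c ∘ σ) := by
  classical
  let e := (Fintype.equivFin α).symm
  exact ⟨(Tuple.sort (c ∘ e)).trans e, Tuple.monotone_sort (c ∘ e)⟩

theorem IsContSelection.sum_eq_plf {c x : α → ℝ} {t : ℝ} (hx : IsContSelection t c x) :
    ∑ e, c e * x e = plf c t := by
  have h0 : 0 ≤ t := by rw [← hx.1.2]; exact Finset.sum_nonneg fun i _ => (hx.1.1 i).1
  have h1 : t ≤ Fintype.card α := by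
    rw [← hx.1.2]
    calc ∑ i, x i ≤ ∑ _i : α, (1 : ℝ) := Finset.sum_le_sum fun i _ => (hx.1.1 i).2
      _ = _ := by simp
  obtain ⟨σ, hσ⟩ := exists_monotone_equiv c
  have h := isContSelection_clamp c σ hσ h0 h1
  rw [plf_eq_sum c σ hσ, ← Equiv.sum_comp σ]
  have h2 := le_antisymm (hx.2 _ h.1) (h.2 _ hx.1)
  rw [← Equiv.sum_comp σ, ← Equiv.sum_comp σ] at h2
  simpa using h2

theorem exists_isContSelection (c : α → ℝ) {t : ℝ} (h0 : 0 ≤ t) (h1 : t ≤ Fintype.card α) :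
    ∃ x, IsContSelection t c x := by
  obtain ⟨σ, hσ⟩ := exists_monotone_equiv c
  exact ⟨_, isContSelection_clamp c σ hσ h0 h1⟩

/-- This is the lower bound for arbitrary leader's solutions; `IsContSelection.sum_eq_plf` gives
equality for the optimal ones. -/
theorem plf_le_sum {c x : α → ℝ} {t : ℝ} (hx : IsFractional t x) : plf c t ≤ ∑ e, c e * x e := by
  have h0 : 0 ≤ t := by rw [← hx.2]; exact Finset.sum_nonneg fun i _ => (hx.1 i).1
  have h1 : t ≤ Fintype.card α := by
    rw [← hx.2]
    calc ∑ i, x i ≤ ∑ _i : α, (1 : ℝ) := Finset.sum_le_sum fun i _ => (hx.1 i).2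
      _ = _ := by simp
  obtain ⟨z, hz⟩ := exists_isContSelection c h0 h1
  rw [← hz.sum_eq_plf]
  exact hz.2 x hx

theorem continuous_plf (c : α → ℝ) : Continuous (plf c) := by
  unfold plf
  fun_prop

end Selection

/-! ### Reduction of both problems to the values that the adversary can enforce. -/

namespace Instance

variable {L F : Type*} [Fintype L] [Fintype F] (I : Instance L F)

/-- The follower's part of the leader's costs that the adversary can enforce when the follower's
capacity is `β`, ties being broken to the disadvantage of the leader. -/
def responseCosts (β : ℝ) : Set ℝ :=
  {w | ∃ d, I.IsScenario d ∧ ∃ y, IsContSelection β d y ∧ w = ∑ e, I.cf e * y e}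

/-- The tie-breaking rule does not matter or is the pessimistic one. -/
def TiesIrrelevant (s : Setting) : Prop :=
  s = .pessimistic ∨ ∀ e e' : F, e ≠ e' → Disjoint (I.U e) (I.U e')

theorem isFollowerFeasible_iff {x : L → ℝ} {y : F → ℝ} :
    I.IsFollowerFeasible x y ↔ IsFractional (I.b - ∑ e, x e) y := by
  refine and_congr_right fun _ => ?_
  constructor <;> intro h <;> linarith

theorem isFollowerOptimal_iff {x : L → ℝ} {d y : F → ℝ} :
    I.IsFollowerOptimal x d y ↔ IsContSelection (I.b - ∑ e, x e) d y := by
  simp only [IsFollowerOptimal, IsContSelection, isFollowerFeasible_iff]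

variable {I}

theorem IsScenario.injective {d : F → ℝ} (hd : I.IsScenario d)
    (hU : ∀ e e' : F, e ≠ e' → Disjoint (I.U e) (I.U e')) : Function.Injective d := by
  intro e e' h
  by_contra hne
  exact Finset.disjoint_left.1 (hU e e' hne) (hd e) (h ▸ hd e')

/-- In the pessimistic case the follower maximizes by definition. Otherwise the scenario is
injective, there is only one optimal response, and the tie-breaking rule has no effect. -/
theorem isScenarioCost_iff {s : Setting} (hs : I.TiesIrrelevant s) {x : L → ℝ} {d : F → ℝ}
    (hd : I.IsScenario d) {w v : ℝ}
    (hw : IsGreatest {w | ∃ y, IsContSelection (I.b - ∑ e, x e) d y ∧ w = ∑ e, I.cf e * y e} w) :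
    I.IsScenarioCost s x d v ↔ v = ∑ e, I.cl e * x e + w := by
  obtain ⟨⟨y₀, hy₀, rfl⟩, hmax⟩ := hw
  unfold IsScenarioCost IsFollowerResponse
  simp only [isFollowerOptimal_iff]
  rcases hs with rfl | hU
  · constructor
    · rintro ⟨y, ⟨hy, hy'⟩, rfl⟩
      have h1 := hy' y₀ hy₀
      have h2 := hmax ⟨y, hy, rfl⟩
      simp only [leaderCost] at *
      linarith
    · rintro rfl
      refine ⟨y₀, ⟨hy₀, fun y' hy' => ?_⟩, rfl⟩
      have h2 := hmax ⟨y', hy', rfl⟩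
      simp only [leaderCost]
      linarith
  · have hinj := hd.injective hU
    constructor
    · rintro ⟨y, ⟨hy, -⟩, rfl⟩
      rw [IsContSelection.eq_of_injective hinj hy hy₀]; rfl
    · rintro rfl
      refine ⟨y₀, ⟨hy₀, fun y' hy' => ?_⟩, rfl⟩
      rw [IsContSelection.eq_of_injective hinj hy' hy₀]
      cases s <;> exact le_rfl

theorem IsLeaderFeasible.capacity_mem {x : L → ℝ} (hx : I.IsLeaderFeasible x) :
    0 ≤ (I.b : ℝ) - ∑ e, x e ∧ (I.b : ℝ) - ∑ e, x e ≤ Fintype.card F := by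
  obtain ⟨-, y, hy⟩ := hx
  rw [isFollowerFeasible_iff] at hy
  rw [← hy.2]
  refine ⟨Finset.sum_nonneg fun i _ => (hy.1 i).1, ?_⟩
  calc ∑ i, y i ≤ ∑ _i : F, (1 : ℝ) := Finset.sum_le_sum fun i _ => (hy.1 i).2
    _ = _ := by simp

/-- The leader's own part of the cost does not depend on the scenario and can be split off from the
maximum. -/
theorem isRobustCost_of_isGreatest {s : Setting} (hs : I.TiesIrrelevant s) {x : L → ℝ}
    (hx : I.IsLeaderFeasible x) {g : ℝ}
    (hg : IsGreatest (I.responseCosts (I.b - ∑ e, x e)) g) :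
    I.IsRobustCost s x (∑ e, I.cl e * x e + g) := by
  have hcap := hx.capacity_mem
  constructor
  · obtain ⟨d, hd, y, hy, hgy⟩ := hg.1
    refine ⟨d, hd, (isScenarioCost_iff hs hd ⟨⟨y, hy, hgy⟩, ?_⟩).2 rfl⟩
    rintro w ⟨y', hy', rfl⟩
    exact hg.2 ⟨d, hd, y', hy', rfl⟩
  · rintro v ⟨d, hd, hv⟩
    obtain ⟨w, hw⟩ := exists_isGreatest_contSelection d I.cf hcap.1 hcap.2
    rw [isScenarioCost_iff hs hd hw] at hv
    obtain ⟨y, hy, hwy⟩ := hw.1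
    have := hg.2 ⟨d, hd, y, hy, hwy⟩
    linarith

/-- A scenario is optimal for the adversary if the worst response to it attains the maximum. -/
theorem isAdversaryOptimal_of_attains {s : Setting} (hs : I.TiesIrrelevant s) {x : L → ℝ}
    (hx : I.IsLeaderFeasible x) {g : ℝ} (hg : IsGreatest (I.responseCosts (I.b - ∑ e, x e)) g)
    {d : F → ℝ} (hd : I.IsScenario d) {y : F → ℝ} (hy : IsContSelection (I.b - ∑ e, x e) d y)
    (hgy : g = ∑ e, I.cf e * y e) : I.IsAdversaryOptimal s x d := by
  refine ⟨hd, _, (isScenarioCost_iff hs hd ⟨⟨y, hy, hgy⟩, ?_⟩).2 rfl,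
    isRobustCost_of_isGreatest hs hx hg⟩
  rintro w ⟨y', hy', rfl⟩
  exact hg.2 ⟨d, hd, y', hy', rfl⟩

theorem exists_isScenario (I : Instance L F) : ∃ d, I.IsScenario d :=
  ⟨I.dmin, fun _ => Finset.min'_mem _ _⟩

theorem dmin_mem (e : F) : I.dmin e ∈ I.U e := Finset.min'_mem _ _

theorem dmax_mem (e : F) : I.dmax e ∈ I.U e := Finset.max'_mem _ _

theorem dmin_le {e : F} {δ : ℝ} (h : δ ∈ I.U e) : I.dmin e ≤ δ := Finset.min'_le _ _ h

theorem le_dmax {e : F} {δ : ℝ} (h : δ ∈ I.U e) : δ ≤ I.dmax e := Finset.le_max' _ _ h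

theorem mem_itemsBefore {δ : ℝ} {e : F} : e ∈ I.itemsBefore δ ↔ I.dmax e < δ := by
  simp [itemsBefore]

theorem floor_spec {β : ℝ} {m : ℕ} (h0 : 0 ≤ β) (h1 : β ≤ m) (hne : β ≠ m) :
    ⌊β⌋₊ < m ∧ ((⌊β⌋₊ : ℕ) : ℝ) ≤ β ∧ β ≤ (⌊β⌋₊ : ℕ) + 1 :=
  ⟨(Nat.floor_lt h0).2 (lt_of_le_of_ne h1 hne), Nat.floor_le h0, (Nat.lt_floor_add_one β).le⟩

theorem cast_blMin (I : Instance L F) : (I.blMin : ℝ) = max 0 ((I.b : ℝ) - Fintype.card F) := by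
  rw [blMin]
  rcases le_total (Fintype.card F) I.b with h | h
  · rw [Nat.cast_sub h, max_eq_right]
    have : (Fintype.card F : ℝ) ≤ I.b := by exact_mod_cast h
    linarith
  · rw [Nat.sub_eq_zero_of_le h, Nat.cast_zero, max_eq_left]
    have : (I.b : ℝ) ≤ Fintype.card F := by exact_mod_cast h
    linarith

theorem cast_blMax (I : Instance L F) : (I.blMax : ℝ) = min (I.b : ℝ) (Fintype.card L) := by
  rw [blMax, Nat.cast_min]

theorem blMin_le_blMax (I : Instance L F) : I.blMin ≤ I.blMax := by
  have := I.b_le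
  rw [blMin, blMax]
  omega

/-- The integral bounds use truncated subtraction; this form says that both players can fill their
shares of the capacity. -/
theorem mem_Icc_iff {t : ℝ} : t ∈ Set.Icc (I.blMin : ℝ) I.blMax ↔
    (0 ≤ t ∧ t ≤ Fintype.card L) ∧ 0 ≤ I.b - t ∧ I.b - t ≤ Fintype.card F := by
  rw [Set.mem_Icc, cast_blMin, cast_blMax, max_le_iff, le_min_iff]
  constructor
  · rintro ⟨⟨h1, h2⟩, h3, h4⟩
    exact ⟨⟨h1, h4⟩, by linarith, by linarith⟩
  · rintro ⟨⟨h1, h4⟩, h2, h3⟩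
    exact ⟨⟨h1, by linarith⟩, by linarith, h4⟩

theorem IsLeaderFeasible.sum_mem {x : L → ℝ} (hx : I.IsLeaderFeasible x) :
    ∑ e, x e ∈ Set.Icc (I.blMin : ℝ) I.blMax := by
  refine mem_Icc_iff.2 ⟨⟨Finset.sum_nonneg fun i _ => (hx.1 i).1, ?_⟩, hx.capacity_mem⟩
  calc ∑ i, x i ≤ ∑ _i : L, (1 : ℝ) := Finset.sum_le_sum fun i _ => (hx.1 i).2
    _ = _ := by simp

theorem isLeaderFeasible_of_mem {x : L → ℝ} {t : ℝ} (hx : IsFractional t x)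
    (ht : t ∈ Set.Icc (I.blMin : ℝ) I.blMax) : I.IsLeaderFeasible x := by
  refine ⟨hx.1, ?_⟩
  obtain ⟨y, hy⟩ := exists_isContSelection (fun _ : F => (0 : ℝ)) (mem_Icc_iff.1 ht).2.1
    (mem_Icc_iff.1 ht).2.2
  exact ⟨y, I.isFollowerFeasible_iff.2 (by rw [hx.2]; exact hy.1)⟩

/-- A natural number `k` that belongs to a linear piece which contains `t`. -/
theorem exists_piece (hne : I.blMin ≠ I.blMax) {t : ℝ}
    (ht : t ∈ Set.Icc (I.blMin : ℝ) I.blMax) :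
    ∃ k : ℕ, I.b - I.blMax ≤ k ∧ k < I.b - I.blMin ∧ (I.b : ℝ) - k - 1 ≤ t ∧ t ≤ I.b - k := by
  have h1 := I.blMin_le_blMax
  have h2 : I.blMax ≤ I.b := min_le_left _ _
  obtain ⟨k, hk, hk1, hk2⟩ := exists_natPart (m := I.blMax - I.blMin) (β := I.blMax - t) (by omega)
    (by linarith [ht.2]) (by rw [Nat.cast_sub h1]; linarith [ht.1])
  refine ⟨I.b - I.blMax + k, by omega, by omega, ?_, ?_⟩ <;> push_cast [h2] <;> linarith

theorem lt_card_of_piece {k : ℕ} (hk : k < I.b - I.blMin) : k < Fintype.card F := by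
  rw [blMin] at hk
  omega

theorem sub_bounds_of_piece {k : ℕ} {t : ℝ} (h1 : (I.b : ℝ) - k - 1 ≤ t) (h2 : t ≤ I.b - k) :
    (k : ℝ) ≤ I.b - t ∧ (I.b : ℝ) - t ≤ k + 1 := ⟨by linarith, by linarith⟩

/-! ### Guesses of the fractional item and its cost. -/

variable [DecidableEq F]

theorem mem_itemsAround {e e' : F} {δ : ℝ} :
    e' ∈ I.itemsAround e δ ↔ e' ≠ e ∧ I.dmin e' ≤ δ ∧ δ ≤ I.dmax e' := by
  simp [itemsAround]

theorem disjoint_before_around (e : F) (δ : ℝ) :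
    Disjoint (I.itemsBefore δ) (I.itemsAround e δ) := by
  rw [Finset.disjoint_left]
  intro i hi hi'
  rw [mem_itemsBefore] at hi
  rw [mem_itemsAround] at hi'
  linarith [hi'.2.2]

section GuessedSet

variable {k : ℕ} {e : F} {δ : ℝ} {Y : Finset F}

theorem IsGuess.exists_isGuessedSet (h : I.IsGuess k e δ) : ∃ Y, I.IsGuessedSet k e δ Y := by
  obtain ⟨-, -, h3⟩ := h
  have hne := Finset.powersetCard_nonempty.2 h3
  obtain ⟨Y₀, h4, h5⟩ := Finset.exists_min_image _ (fun Y => ∑ i ∈ Y, -I.cf i) hne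
  rw [Finset.mem_powersetCard] at h4
  exact ⟨_, Y₀, ⟨h4, fun X' h6 h7 => h5 X' (Finset.mem_powersetCard.2 ⟨h6, h7⟩)⟩, rfl⟩

theorem IsGuessedSet.card_eq (h : I.IsGuess k e δ) (hY : I.IsGuessedSet k e δ Y) : Y.card = k := by
  obtain ⟨Y₀, hY₀, rfl⟩ := hY
  rw [Finset.card_union_of_disjoint
    ((disjoint_before_around e δ).mono_right hY₀.1.1), hY₀.1.2]
  have := h.2.1
  omega

theorem IsGuessedSet.notMem (h : δ ∈ I.U e) (hY : I.IsGuessedSet k e δ Y) : e ∉ Y := by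
  obtain ⟨Y₀, hY₀, rfl⟩ := hY
  rw [Finset.mem_union, mem_itemsBefore]
  rintro (h1 | h1)
  · linarith [le_dmax h]
  · exact (mem_itemsAround.1 (hY₀.1.1 h1)).1 rfl

/-- Both sets contain all items before δ, so the comparison reduces to the optimality of the part
chosen around δ. -/
theorem IsGuessedSet.sum_le {P : Finset F} (hY : I.IsGuessedSet k e δ Y)
    (h1 : I.itemsBefore δ ⊆ P) (h2 : P ⊆ I.itemsBefore δ ∪ I.itemsAround e δ) (hP : P.card = k) :
    ∑ i ∈ P, I.cf i ≤ ∑ i ∈ Y, I.cf i := by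
  obtain ⟨Y₀, hY₀, rfl⟩ := hY
  rw [Finset.sum_union ((disjoint_before_around e δ).mono_right hY₀.1.1)]
  have h3 : P \ I.itemsBefore δ ⊆ I.itemsAround e δ := by
    intro i hi
    rw [Finset.mem_sdiff] at hi
    exact (Finset.mem_union.1 (h2 hi.1)).resolve_left hi.2
  have h4 := hY₀.2 _ h3 (by rw [Finset.card_sdiff_of_subset h1, hP])
  rw [Finset.sum_neg_distrib, Finset.sum_neg_distrib] at h4
  rw [← Finset.sum_sdiff h1]
  linarith

/-- The value of a guess is therefore well defined, whichever optimal selection the subroutine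
returns. -/
theorem IsGuessedSet.sum_eq {Y' : Finset F} (h : I.IsGuess k e δ) (hY : I.IsGuessedSet k e δ Y)
    (hY' : I.IsGuessedSet k e δ Y') : ∑ i ∈ Y, I.cf i = ∑ i ∈ Y', I.cf i := by
  have key : ∀ {Y Y' : Finset F}, I.IsGuessedSet k e δ Y → I.IsGuessedSet k e δ Y' →
      ∑ i ∈ Y', I.cf i ≤ ∑ i ∈ Y, I.cf i := by
    intro Y Y' hY hY'
    have hc := hY'.card_eq h
    obtain ⟨Y₀, hY₀, rfl⟩ := hY'
    exact hY.sum_le Finset.subset_union_left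
      (Finset.union_subset_union_right hY₀.1.1) hc
  exact le_antisymm (key hY' hY) (key hY hY')

theorem isScenario_guessedScenario (h : δ ∈ I.U e) (Y : Finset F) :
    I.IsScenario (I.guessedScenario e δ Y) := by
  intro i
  unfold guessedScenario
  split_ifs with h1
  · exact h1 ▸ h
  · exact dmin_mem i
  · exact dmax_mem i

/-- The constructed scenario puts `Y` at costs at most δ by using minima and all other items at
costs at least δ by using maxima, so `Y` followed by `e` is a greedy order. -/
theorem IsGuessedSet.isContSelection (h : I.IsGuess k e δ) (hY : I.IsGuessedSet k e δ Y) {β : ℝ}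
    (h1 : k ≤ β) (h2 : β ≤ k + 1) :
    IsContSelection β (I.guessedScenario e δ Y) (prefixSol Y e (β - k)) := by
  have hc := hY.card_eq h
  have he := hY.notMem h.1
  subst hc
  have hde : I.guessedScenario e δ Y e = δ := by simp [guessedScenario]
  refine isContSelection_prefixSol he ?_ ?_ h1 h2
  · intro p hp
    have hpe : p ≠ e := by rintro rfl; exact he hp
    rw [hde]
    simp only [guessedScenario, hpe, if_false, hp, if_true]
    obtain ⟨Y₀, hY₀, rfl⟩ := hY
    rcases Finset.mem_union.1 hp with hp | hp
    · exact ((dmin_le (dmax_mem p)).trans_lt (mem_itemsBefore.1 hp)).le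
    · exact (mem_itemsAround.1 (hY₀.1.1 hp)).2.1
  · intro q hq
    rw [hde]
    by_cases hqe : q = e
    · simp [guessedScenario, hqe]
    · simp only [guessedScenario, hqe, if_false, hq]
      obtain ⟨Y₀, hY₀, rfl⟩ := hY
      by_contra h3
      exact hq (Finset.mem_union_left _ (mem_itemsBefore.2 (not_le.1 h3)))

end GuessedSet

/-- The values of all guesses for `k` at the follower's capacity `β`. -/
def guessValues (I : Instance L F) (k : ℕ) (β : ℝ) : Set ℝ :=
  {w | ∃ e δ Y, I.IsGuess k e δ ∧ I.IsGuessedSet k e δ Y ∧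
    w = ∑ i ∈ Y, I.cf i + I.cf e * (β - k)}

/-- This is the upper bound. With δ = `d e`, items always below δ must lie in the prefix `P`, and
items always above δ cannot, so `P` competes in the selection that defines the guessed set. -/
theorem exists_guess_ge {d : F → ℝ} (hd : I.IsScenario d) {k : ℕ} {P : Finset F} {e : F}
    (he : e ∉ P) (hP : P.card = k) (h1 : ∀ p ∈ P, d p ≤ d e) (h2 : ∀ q ∉ P, d e ≤ d q) :
    I.IsGuess k e (d e) ∧ ∀ Y, I.IsGuessedSet k e (d e) Y → ∑ i ∈ P, I.cf i ≤ ∑ i ∈ Y, I.cf i := by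
  have h3 : I.itemsBefore (d e) ⊆ P := by
    intro i hi
    by_contra h
    have := le_dmax (hd i)
    linarith [h2 i h, mem_itemsBefore.1 hi]
  have h4 : P ⊆ I.itemsBefore (d e) ∪ I.itemsAround e (d e) := by
    intro i hi
    rw [Finset.mem_union, mem_itemsBefore, mem_itemsAround]
    by_cases h : I.dmax i < d e
    · exact Or.inl h
    · exact Or.inr ⟨by rintro rfl; exact he hi, (dmin_le (hd i)).trans (h1 i hi), not_lt.1 h⟩
  refine ⟨⟨hd e, hP ▸ Finset.card_le_card h3, ?_⟩, fun Y hY => hY.sum_le h3 h4 hP⟩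
  have := Finset.card_le_card h4
  rw [Finset.card_union_of_disjoint (disjoint_before_around _ _)] at this
  omega

/-- The greedy solution of any single scenario is already a guess. -/
theorem exists_isGuess (I : Instance L F) {k : ℕ} (hk : k < Fintype.card F) :
    ∃ e δ, I.IsGuess k e δ := by
  obtain ⟨d, hd⟩ := I.exists_isScenario
  obtain ⟨P, e, he, hP, h1, h2⟩ := exists_prefix d hk
  exact ⟨e, d e, (exists_guess_ge hd he hP h1 h2).1⟩

/-- The maximum over all guesses is the optimal value of the adversary's problem. -/
theorem isGreatest_responseCosts {k : ℕ} (hk : k < Fintype.card F) {β : ℝ}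
    (h1 : k ≤ β) (h2 : β ≤ k + 1) {g : ℝ} (hg : IsGreatest (I.guessValues k β) g) :
    IsGreatest (I.responseCosts β) g := by
  constructor
  · obtain ⟨e, δ, Y, hG, hY, rfl⟩ := hg.1
    exact ⟨_, isScenario_guessedScenario hG.1 Y, _, hY.isContSelection hG h1 h2,
      (sum_mul_prefixSol (hY.notMem hG.1) _ _).symm⟩
  · rintro w ⟨d, hd, y, hy, rfl⟩
    obtain ⟨P, e, he, hP, h3, h4, hmax⟩ := exists_isGreatest_prefix d I.cf hk h1 h2
    obtain ⟨hG, hle⟩ := exists_guess_ge hd he hP h3 h4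
    obtain ⟨Y, hY⟩ := hG.exists_isGuessedSet
    have h5 := hmax.2 ⟨y, hy, rfl⟩
    have h6 := hg.2 ⟨e, d e, Y, hG, hY, rfl⟩
    linarith [hle Y hY]

/-- All pairs of an item and one of its possible costs. -/
noncomputable def pairs (I : Instance L F) : Finset (Σ _ : F, ℝ) := Finset.univ.sigma I.U

theorem finite_guessValues (I : Instance L F) (k : ℕ) (β : ℝ) : (I.guessValues k β).Finite := by
  refine Set.Finite.subset (Set.Finite.image
    (fun q : (Σ _ : F, ℝ) × Finset F => ∑ i ∈ q.2, I.cf i + I.cf q.1.1 * (β - k))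
    (I.pairs ×ˢ (Finset.univ : Finset (Finset F))).finite_toSet) ?_
  rintro w ⟨e, δ, Y, hG, hY, rfl⟩
  exact ⟨(⟨e, δ⟩, Y), by simpa [pairs] using hG.1, rfl⟩

theorem nonempty_guessValues (I : Instance L F) {k : ℕ} (hk : k < Fintype.card F) (β : ℝ) :
    (I.guessValues k β).Nonempty := by
  obtain ⟨e, δ, hG⟩ := I.exists_isGuess hk
  obtain ⟨Y, hY⟩ := hG.exists_isGuessedSet
  exact ⟨_, e, δ, Y, hG, hY, rfl⟩

theorem exists_isGreatest_guessValues (I : Instance L F) {k : ℕ} (hk : k < Fintype.card F)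
    (β : ℝ) : ∃ g, IsGreatest (I.guessValues k β) g :=
  ⟨_, ((I.nonempty_guessValues hk β).csSup_mem (I.finite_guessValues k β)),
    fun _ hw => le_csSup (I.finite_guessValues k β).bddAbove hw⟩

theorem exists_isGreatest_responseCosts (I : Instance L F) {β : ℝ} (h0 : 0 ≤ β)
    (h1 : β ≤ Fintype.card F) : ∃ g, IsGreatest (I.responseCosts β) g := by
  rcases Nat.eq_zero_or_pos (Fintype.card F) with h | h
  · have := Fintype.card_eq_zero_iff.1 h
    obtain ⟨d, hd⟩ := I.exists_isScenario
    obtain ⟨w, hw⟩ := exists_isGreatest_contSelection d I.cf h0 h1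
    refine ⟨w, ⟨d, hd, hw.1⟩, ?_⟩
    rintro w' ⟨d', hd', y, hy, rfl⟩
    rw [Subsingleton.elim d' d] at hy
    exact hw.2 ⟨y, hy, rfl⟩
  · obtain ⟨k, hk, hk1, hk2⟩ := exists_natPart h h0 h1
    obtain ⟨g, hg⟩ := I.exists_isGreatest_guessValues hk β
    exact ⟨g, isGreatest_responseCosts hk hk1 hk2 hg⟩

/-! ### The adversary's algorithm -/

/-- With capacity 0 or |F| the follower has only one feasible solution, so the scenario is
irrelevant. -/
theorem isAdversaryOptimal_of_extreme {s : Setting} (hs : I.TiesIrrelevant s) {x : L → ℝ}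
    (hx : I.IsLeaderFeasible x)
    (hext : (I.b : ℝ) - ∑ e, x e = 0 ∨ (I.b : ℝ) - ∑ e, x e = Fintype.card F) {d : F → ℝ}
    (hd : I.IsScenario d) : I.IsAdversaryOptimal s x d := by
  have hcap := hx.capacity_mem
  obtain ⟨g, hg⟩ := I.exists_isGreatest_responseCosts hcap.1 hcap.2
  obtain ⟨w, hw⟩ := exists_isGreatest_contSelection d I.cf hcap.1 hcap.2
  obtain ⟨y, hy, -⟩ := hw.1
  refine isAdversaryOptimal_of_attains hs hx hg hd hy ?_
  obtain ⟨d', -, y', hy', rfl⟩ := hg.1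
  have huniq : ∀ y z : F → ℝ, IsFractional (I.b - ∑ e, x e) y → IsFractional (I.b - ∑ e, x e) z →
      y = z := by
    intro y z hy hz
    rcases hext with h | h <;> rw [h] at hy hz
    · have : ∀ y : F → ℝ, IsFractional 0 y → y = 0 := by
        intro y hy
        funext i
        exact (Finset.sum_eq_zero_iff_of_nonneg fun i _ => (hy.1 i).1).1 hy.2 i (Finset.mem_univ i)
      rw [this y hy, this z hz]
    · have : ∀ y : F → ℝ, IsFractional (Fintype.card F : ℝ) y → y = 1 := by
        intro y hy
        have h3 : ∑ i, (1 - y i) = 0 := by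
          rw [Finset.sum_sub_distrib, hy.2]; simp
        funext i
        have := (Finset.sum_eq_zero_iff_of_nonneg fun i _ => by linarith [(hy.1 i).2]).1 h3 i
          (Finset.mem_univ i)
        simp only [Pi.one_apply]
        linarith
      rw [this y hy, this z hz]
  rw [huniq y' y hy'.1 hy.1]

/-- The set `guessValues` ranges over all possible guessed sets, the algorithms over one fixed
choice; the values coincide by `IsGuessedSet.sum_eq`. -/
theorem isGreatest_guessValues_of_choice {k : ℕ} {β g : ℝ} {Y : F → ℝ → Finset F}
    (hY : ∀ e δ, I.IsGuess k e δ → I.IsGuessedSet k e δ (Y e δ)) :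
    IsGreatest (I.guessValues k β) g ↔
      IsGreatest {w | ∃ e δ, I.IsGuess k e δ ∧ w = ∑ i ∈ Y e δ, I.cf i + I.cf e * (β - k)} g := by
  have : I.guessValues k β =
      {w | ∃ e δ, I.IsGuess k e δ ∧ w = ∑ i ∈ Y e δ, I.cf i + I.cf e * (β - k)} := by
    ext w
    constructor
    · rintro ⟨e, δ, Y', hG, hY', rfl⟩
      exact ⟨e, δ, hG, by rw [hY'.sum_eq hG (hY e δ hG)]⟩
    · rintro ⟨e, δ, hG, rfl⟩
      exact ⟨e, δ, _, hG, hY e δ hG, rfl⟩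
  rw [this]

theorem exists_choice (I : Instance L F) (k : ℕ) :
    ∃ Y : F → ℝ → Finset F, ∀ e δ, I.IsGuess k e δ → I.IsGuessedSet k e δ (Y e δ) := by
  classical
  refine ⟨fun e δ => if h : I.IsGuess k e δ then h.exists_isGuessedSet.choose else ∅, ?_⟩
  intro e δ h
  simp only [h, dif_pos]
  exact h.exists_isGuessedSet.choose_spec

theorem exists_adversaryAlg {x : L → ℝ} (hx : I.IsLeaderFeasible x) : ∃ d, I.AdversaryAlg x d := by
  by_cases h : (I.b : ℝ) - ∑ e, x e = 0 ∨ (I.b : ℝ) - ∑ e, x e = Fintype.card F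
  · simp only [AdversaryAlg, if_pos h]
    exact I.exists_isScenario
  · simp only [AdversaryAlg, if_neg h]
    obtain ⟨hk, hk1, hk2⟩ := floor_spec hx.capacity_mem.1 hx.capacity_mem.2 fun h' => h (Or.inr h')
    obtain ⟨Y, hY⟩ := I.exists_choice ⌊(I.b : ℝ) - ∑ e, x e⌋₊
    obtain ⟨g, hg⟩ := I.exists_isGreatest_guessValues hk (I.b - ∑ e, x e)
    rw [isGreatest_guessValues_of_choice hY] at hg
    obtain ⟨⟨e, δ, hG, rfl⟩, hmax⟩ := hg
    exact ⟨_, Y, hY, e, δ, hG, fun e' δ' hG' => hmax ⟨e', δ', hG', rfl⟩, rfl⟩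

theorem AdversaryAlg.isAdversaryOptimal {s : Setting} (hs : I.TiesIrrelevant s) {x : L → ℝ}
    (hx : I.IsLeaderFeasible x) {d : F → ℝ} (hd : I.AdversaryAlg x d) :
    I.IsAdversaryOptimal s x d := by
  by_cases h : (I.b : ℝ) - ∑ e, x e = 0 ∨ (I.b : ℝ) - ∑ e, x e = Fintype.card F
  · simp only [AdversaryAlg, if_pos h] at hd
    exact isAdversaryOptimal_of_extreme hs hx h hd
  · simp only [AdversaryAlg, if_neg h] at hd
    obtain ⟨hk, hk1, hk2⟩ := floor_spec hx.capacity_mem.1 hx.capacity_mem.2 fun h' => h (Or.inr h')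
    obtain ⟨Y, hY, e, δ, hG, hmax, rfl⟩ := hd
    have hg := isGreatest_responseCosts hk hk1 hk2 ((isGreatest_guessValues_of_choice hY).2
      ⟨⟨e, δ, hG, rfl⟩, by rintro w ⟨e', δ', hG', rfl⟩; exact hmax e' δ' hG'⟩)
    exact isAdversaryOptimal_of_attains hs hx hg (isScenario_guessedScenario hG.1 _)
      ((hY e δ hG).isContSelection hG hk1 hk2)
      (sum_mul_prefixSol ((hY e δ hG).notMem hG.1) _ _).symm

/-! ### The leader's algorithm -/

/-- This removes the choice of the guessed sets from the definition. -/
theorem isFollowerPLF_iff {gf : ℝ → ℝ} : I.IsFollowerPLF gf ↔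
    ∀ k : ℕ, I.b - I.blMax ≤ k → k < I.b - I.blMin → ∀ t : ℝ, (I.b : ℝ) - k - 1 ≤ t →
      t ≤ (I.b : ℝ) - k → IsGreatest (I.guessValues k (I.b - t)) (gf t) := by
  constructor
  · rintro ⟨Y, hY⟩ k hk1 hk2 t ht1 ht2
    obtain ⟨h1, h2⟩ := hY k hk1 hk2
    rw [isGreatest_guessValues_of_choice h1]
    simpa only [sub_right_comm] using h2 t ht1 ht2
  · intro h
    choose Y hY using I.exists_choice
    refine ⟨Y, fun k hk1 hk2 => ⟨hY k, fun t ht1 ht2 => ?_⟩⟩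
    have := (isGreatest_guessValues_of_choice (hY k)).1 (h k hk1 hk2 t ht1 ht2)
    simpa only [sub_right_comm] using this

theorem exists_isFollowerPLF (I : Instance L F) : ∃ gf, I.IsFollowerPLF gf := by
  classical
  -- Neighbouring pieces share an endpoint, where two values of `k` prescribe the same `gf t`. The
  -- adversary's optimal value does not mention `k`, so it satisfies both conditions.
  refine ⟨fun t => sSup (I.responseCosts (I.b - t)), isFollowerPLF_iff.2 ?_⟩
  intro k _ hk t ht1 ht2
  obtain ⟨h1, h2⟩ := I.sub_bounds_of_piece ht1 ht2
  obtain ⟨g, hg⟩ := I.exists_isGreatest_guessValues (lt_card_of_piece hk) (I.b - t)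
  rwa [(isGreatest_responseCosts (lt_card_of_piece hk) h1 h2 hg).csSup_eq]

theorem IsFollowerPLF.isGreatest {gf : ℝ → ℝ} (hgf : I.IsFollowerPLF gf)
    (hne : I.blMin ≠ I.blMax) {t : ℝ} (ht : t ∈ Set.Icc (I.blMin : ℝ) I.blMax) :
    IsGreatest (I.responseCosts (I.b - t)) (gf t) := by
  obtain ⟨k, hk1, hk2, ht1, ht2⟩ := exists_piece hne ht
  obtain ⟨h1, h2⟩ := I.sub_bounds_of_piece ht1 ht2
  exact isGreatest_responseCosts (lt_card_of_piece hk2) h1 h2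
    (isFollowerPLF_iff.1 hgf k hk1 hk2 t ht1 ht2)

/-- For fixed `k` the function is a maximum of finitely many affine functions, indexed by the finite
set `T` of guesses with their guessed sets. -/
theorem continuousOn_of_isGreatest {k : ℕ} {gf : ℝ → ℝ} {s : Set ℝ}
    (h : ∀ t ∈ s, IsGreatest (I.guessValues k (I.b - t)) (gf t)) : ContinuousOn gf s := by
  classical
  rcases s.eq_empty_or_nonempty with rfl | ⟨t₀, ht₀⟩
  · exact continuousOn_empty _
  let T : Finset ((Σ _ : F, ℝ) × Finset F) := (I.pairs ×ˢ Finset.univ).filter fun q =>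
    I.IsGuess k q.1.1 q.1.2 ∧ I.IsGuessedSet k q.1.1 q.1.2 q.2
  have hT : T.Nonempty := by
    obtain ⟨e, δ, Y, hG, hY, -⟩ := (h t₀ ht₀).1
    exact ⟨(⟨e, δ⟩, Y), by simpa [T, pairs, hG, hY] using hG.1⟩
  have hcont : Continuous fun t : ℝ => T.sup' hT
      fun q => ∑ i ∈ q.2, I.cf i + I.cf q.1.1 * ((I.b : ℝ) - t - k) := by
    refine Continuous.finset_sup'_apply hT fun q _ => ?_
    fun_prop
  refine hcont.continuousOn.congr fun t ht => ?_
  refine le_antisymm ?_ ?_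
  · obtain ⟨e, δ, Y, hG, hY, hw⟩ := (h t ht).1
    rw [hw]
    exact Finset.le_sup' (fun q : (Σ _ : F, ℝ) × Finset F =>
      ∑ i ∈ q.2, I.cf i + I.cf q.1.1 * ((I.b : ℝ) - t - k)) (b := (⟨e, δ⟩, Y))
      (by simpa [T, pairs, hG, hY] using hG.1)
  · refine Finset.sup'_le _ _ fun q hq => (h t ht).2 ?_
    simp only [T, Finset.mem_filter] at hq
    exact ⟨q.1.1, q.1.2, q.2, hq.2.1, hq.2.2, rfl⟩

theorem exists_leaderAlg (I : Instance L F) : ∃ x, I.LeaderAlg x := by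
  have hex : ∀ bl ∈ Set.Icc (I.blMin : ℝ) I.blMax, ∃ x, IsContSelection bl I.cl x := fun bl h =>
    exists_isContSelection _ (mem_Icc_iff.1 h).1.1 (mem_Icc_iff.1 h).1.2
  have hle : (I.blMin : ℝ) ≤ I.blMax := by exact_mod_cast I.blMin_le_blMax
  by_cases hne : I.blMin = I.blMax
  · obtain ⟨x, hx⟩ := hex I.blMin ⟨le_rfl, hle⟩
    exact ⟨x, _, by rw [if_pos hne], hx⟩
  obtain ⟨gf, hgf⟩ := I.exists_isFollowerPLF
  have hbM : I.blMax ≤ I.b := min_le_left _ _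
  -- The minimum is taken on each compact piece separately, then over the finitely many pieces. The
  -- implications inside the existential let `choose` produce a total function, with 0 as a dummy
  -- value.
  have hpiece : ∀ k : ℕ, ∃ t, (I.b - I.blMax ≤ k → k < I.b - I.blMin →
      ((I.b : ℝ) - k - 1 ≤ t ∧ t ≤ (I.b : ℝ) - k ∧ ∀ t' : ℝ, (I.b : ℝ) - k - 1 ≤ t' →
        t' ≤ (I.b : ℝ) - k → plf I.cl t + gf t ≤ plf I.cl t' + gf t')) := by
    intro k
    by_cases hk : I.b - I.blMax ≤ k ∧ k < I.b - I.blMin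
    · have hc : ContinuousOn (fun t => plf I.cl t + gf t)
          (Set.Icc ((I.b : ℝ) - k - 1) ((I.b : ℝ) - k)) :=
        (continuous_plf I.cl).continuousOn.add (continuousOn_of_isGreatest fun t ht =>
          isFollowerPLF_iff.1 hgf k hk.1 hk.2 t ht.1 ht.2)
      obtain ⟨t, ht, hmin⟩ := isCompact_Icc.exists_isMinOn
        (Set.nonempty_Icc.2 (by linarith : (I.b : ℝ) - k - 1 ≤ (I.b : ℝ) - k)) hc
      exact ⟨t, fun _ _ => ⟨ht.1, ht.2, fun t' h1 h2 => hmin ⟨h1, h2⟩⟩⟩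
    · exact ⟨0, fun h1 h2 => absurd ⟨h1, h2⟩ hk⟩
  choose T hT using hpiece
  obtain ⟨k, hk, hmin⟩ := Finset.exists_min_image (Finset.Ico (I.b - I.blMax) (I.b - I.blMin))
    (fun k => plf I.cl (T k) + gf (T k)) (by
      rw [Finset.nonempty_Ico]
      have := I.blMin_le_blMax
      omega)
  rw [Finset.mem_Ico] at hk
  obtain ⟨h1, h2, h3⟩ := hT k hk.1 hk.2
  have hmem : T k ∈ Set.Icc (I.blMin : ℝ) I.blMax := by
    have h4 : ((k + 1 : ℕ) : ℝ) ≤ (I.b - I.blMin : ℕ) := by exact_mod_cast hk.2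
    have h5 : ((I.b - I.blMax : ℕ) : ℝ) ≤ k := by exact_mod_cast hk.1
    rw [Nat.cast_sub (I.blMin_le_blMax.trans hbM)] at h4
    rw [Nat.cast_sub hbM] at h5
    push_cast at h4
    exact ⟨by linarith, by linarith⟩
  obtain ⟨x, hx⟩ := hex _ hmem
  refine ⟨x, T k, ?_, hx⟩
  rw [if_neg hne]
  refine ⟨gf, hgf, hmem, fun t ht => ?_⟩
  obtain ⟨k', hk1, hk2, ht1, ht2⟩ := exists_piece hne ht
  exact (hmin k' (Finset.mem_Ico.2 ⟨hk1, hk2⟩)).trans ((hT k' hk1 hk2).2.2 t ht1 ht2)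

/-- The robust cost of any feasible solution with sum t is at least `plf I.cl t` plus the
adversary's value at t; a solution that is optimal for its own sum attains this bound. -/
theorem LeaderAlg.isLeaderOptimal {s : Setting} (hs : I.TiesIrrelevant s) {x : L → ℝ}
    (h : I.LeaderAlg x) : I.IsLeaderOptimal s x := by
  obtain ⟨bl, hbl, hx⟩ := h
  have hmem : bl ∈ Set.Icc (I.blMin : ℝ) I.blMax := by
    by_cases hne : I.blMin = I.blMax
    · rw [if_pos hne] at hbl
      rw [hbl, hne]; exact ⟨le_rfl, le_rfl⟩
    · rw [if_neg hne] at hbl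
      obtain ⟨gf, -, h, -⟩ := hbl
      exact h
  have hfeas := isLeaderFeasible_of_mem hx.1 hmem
  have hrob : ∀ x', I.IsLeaderFeasible x' → ∃ g,
      IsGreatest (I.responseCosts (I.b - ∑ e, x' e)) g := fun x' hx' =>
    I.exists_isGreatest_responseCosts hx'.capacity_mem.1 hx'.capacity_mem.2
  obtain ⟨g, hg⟩ := hrob x hfeas
  refine ⟨hfeas, _, isRobustCost_of_isGreatest hs hfeas hg, fun x' hx' => ?_⟩
  obtain ⟨g', hg'⟩ := hrob x' hx'
  refine ⟨_, isRobustCost_of_isGreatest hs hx' hg', ?_⟩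
  have h1 : plf I.cl (∑ e, x' e) ≤ ∑ e, I.cl e * x' e := plf_le_sum ⟨hx'.1, rfl⟩
  rw [hx.sum_eq_plf]
  by_cases hne : I.blMin = I.blMax
  · rw [if_pos hne] at hbl
    have h2 := hx'.sum_mem
    rw [← hne] at h2
    have h3 : ∑ e, x' e = bl := hbl ▸ le_antisymm h2.2 h2.1
    rw [h3] at h1 hg'
    rw [hx.1.2] at hg
    linarith [hg.unique hg']
  · rw [if_neg hne] at hbl
    obtain ⟨gf, hgf, -, hmin⟩ := hbl
    have h2 := hmin _ hx'.sum_mem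
    rw [hx.1.2] at hg
    rw [hg.unique (hgf.isGreatest hne hmem), hg'.unique (hgf.isGreatest hne hx'.sum_mem)]
    linarith

end Instance

/-! ## Reasoning about programs -/

instance : Add NatExpr := ⟨.add⟩
instance : Sub NatExpr := ⟨.sub⟩
instance : Add RealExpr := ⟨.add⟩
instance : Sub RealExpr := ⟨.sub⟩
instance : Mul RealExpr := ⟨.mul⟩
instance : Div RealExpr := ⟨.div⟩

/-- The natural number `k`. -/
abbrev nc (k : ℕ) : NatExpr := .const k
/-- The scalar variable `a` for natural numbers. -/
abbrev nv (a : ℕ) : NatExpr := .get a (.const 0)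
/-- The cell `i` of the array `a` of natural numbers. -/
abbrev na (a : ℕ) (i : NatExpr) : NatExpr := .get a i
/-- The scalar variable `a` for real numbers. -/
abbrev rv (a : ℕ) : RealExpr := .get a (.const 0)
/-- The cell `i` of the array `a` of real numbers. -/
abbrev ra (a : ℕ) (i : NatExpr) : RealExpr := .get a i
/-- Conversion to a real number. -/
abbrev rn (p : NatExpr) : RealExpr := .ofNat p

namespace Test

/-- `p < q` for natural numbers. -/
abbrev natLt (p q : NatExpr) : Test := .not (.natLe q p)
/-- `p < q` for real numbers. -/
abbrev realLt (p q : RealExpr) : Test := .not (.realLe q p)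
/-- Disjunction. -/
abbrev or (t t' : Test) : Test := .not (.and (.not t) (.not t'))

end Test

namespace Prog

/-- Assignment to a scalar variable for natural numbers. -/
abbrev letNat (a : ℕ) (v : NatExpr) : Prog := .setNat a (.const 0) v
/-- Assignment to a scalar variable for real numbers. -/
abbrev letReal (a : ℕ) (v : RealExpr) : Prog := .setReal a (.const 0) v

/-- Whether a program contains an assignment to the array `a` of natural numbers. -/
def writesNat (a : ℕ) : Prog → Bool
  | .skip => false
  | .setNat a' _ _ => a' == a
  | .setReal _ _ _ => false
  | .seq P Q => P.writesNat a || Q.writesNat a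
  | .branch _ P Q => P.writesNat a || Q.writesNat a
  | .loop _ P => P.writesNat a

/-- Whether a program contains an assignment to the array `a` of real numbers. -/
def writesReal (a : ℕ) : Prog → Bool
  | .skip => false
  | .setNat _ _ _ => false
  | .setReal a' _ _ => a' == a
  | .seq P Q => P.writesReal a || Q.writesReal a
  | .branch _ P Q => P.writesReal a || Q.writesReal a
  | .loop _ P => P.writesReal a

/-- The weakest precondition of a program without loops. -/
def wp : Prog → (Store → Prop) → Store → Prop
  | .skip, Q => Q
  | .setNat a i v, Q => fun σ => Q (σ.setNat a (i.eval σ) (v.eval σ))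
  | .setReal a i v, Q => fun σ => Q (σ.setReal a (i.eval σ) (v.eval σ))
  | .seq P P', Q => P.wp (P'.wp Q)
  | .branch t P P', Q => fun σ => (t.Holds σ → P.wp Q σ) ∧ (¬ t.Holds σ → P'.wp Q σ)
  | .loop _ _, _ => fun _ => False

/-- A bound on the number of steps of a program without loops. -/
def size : Prog → ℕ
  | .skip => 1
  | .setNat _ _ _ => 1
  | .setReal _ _ _ => 1
  | .seq P Q => P.size + Q.size
  | .branch _ P Q => P.size + Q.size + 1
  -- A dummy value: `wp` assigns the precondition `False` to a loop, so no bound is ever claimed for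
  -- executing one.
  | .loop _ _ => 0

/-- A loop in which the counter `i` runs through the natural numbers below `N`. -/
def forLoop (i : ℕ) (N : NatExpr) (P : Prog) : Prog :=
  .seq (.letNat i (nc 0))
    (.loop (.natLt (nv i) N) (.seq P (.letNat i (nv i + nc 1))))

end Prog

infixr:60 " ;; " => Prog.seq

attribute [simp] NatExpr.eval RealExpr.eval Test.Holds

section Store

variable (σ : Store) {a b : ℕ} (i v : ℕ) (r : ℝ)

@[simp] theorem NatExpr.eval_add (p q : NatExpr) : (p + q).eval σ = p.eval σ + q.eval σ := rfl
@[simp] theorem NatExpr.eval_sub (p q : NatExpr) : (p - q).eval σ = p.eval σ - q.eval σ := rfl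
@[simp] theorem RealExpr.eval_add (p q : RealExpr) : (p + q).eval σ = p.eval σ + q.eval σ := rfl
@[simp] theorem RealExpr.eval_sub (p q : RealExpr) : (p - q).eval σ = p.eval σ - q.eval σ := rfl
@[simp] theorem RealExpr.eval_div (p q : RealExpr) : (p / q).eval σ = p.eval σ / q.eval σ := rfl

@[simp] theorem Store.nat_setReal : (σ.setReal a i r).nat = σ.nat := rfl
@[simp] theorem Store.real_setNat : (σ.setNat a i v).real = σ.real := rfl

@[simp] theorem Store.nat_setNat_self :
    (σ.setNat a i v).nat a = Function.update (σ.nat a) i v := by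
  simp [Store.setNat]

@[simp] theorem Store.nat_setNat_of_ne (h : b ≠ a) : (σ.setNat a i v).nat b = σ.nat b := by
  simp [Store.setNat, h]

@[simp] theorem Store.real_setReal_self :
    (σ.setReal a i r).real a = Function.update (σ.real a) i r := by
  simp [Store.setReal]

@[simp] theorem Store.real_setReal_of_ne (h : b ≠ a) : (σ.setReal a i r).real b = σ.real b := by
  simp [Store.setReal, h]

end Store

/-- The arrays to which `P` contains no assignment agree. -/
structure Unchanged (P : Prog) (σ τ : Store) : Prop where
  nat : ∀ a, P.writesNat a = false → τ.nat a = σ.nat a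
  real : ∀ a, P.writesReal a = false → τ.real a = σ.real a

/-- This makes framing syntactic: for a concrete program and array the side condition usually holds
by `rfl`. -/
theorem Exec.unchanged {P : Prog} {σ τ : Store} {k : ℕ} (h : Exec P σ k τ) :
    Unchanged P σ τ := by
  induction h with
  | skip σ => exact ⟨fun _ _ => rfl, fun _ _ => rfl⟩
  | setNat σ a i v =>
    refine ⟨fun b hb => ?_, fun _ _ => rfl⟩
    have : a ≠ b := by simpa [Prog.writesNat] using hb
    exact Store.nat_setNat_of_ne _ _ _ this.symm
  | setReal σ a i v =>
    refine ⟨fun _ _ => rfl, fun b hb => ?_⟩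
    have : a ≠ b := by simpa [Prog.writesReal] using hb
    exact Store.real_setReal_of_ne _ _ _ this.symm
  | seq _ _ ih ih' =>
    constructor
    · intro a ha
      simp only [Prog.writesNat, Bool.or_eq_false_iff] at ha
      rw [ih'.nat a ha.2, ih.nat a ha.1]
    · intro a ha
      simp only [Prog.writesReal, Bool.or_eq_false_iff] at ha
      rw [ih'.real a ha.2, ih.real a ha.1]
  | branchTrue _ _ ih =>
    constructor
    · intro a ha
      simp only [Prog.writesNat, Bool.or_eq_false_iff] at ha
      exact ih.nat a ha.1
    · intro a ha
      simp only [Prog.writesReal, Bool.or_eq_false_iff] at ha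
      exact ih.real a ha.1
  | branchFalse _ _ ih =>
    constructor
    · intro a ha
      simp only [Prog.writesNat, Bool.or_eq_false_iff] at ha
      exact ih.nat a ha.2
    · intro a ha
      simp only [Prog.writesReal, Bool.or_eq_false_iff] at ha
      exact ih.real a ha.2
  | loopFalse _ => exact ⟨fun _ _ => rfl, fun _ _ => rfl⟩
  | loopTrue _ _ _ ih ih' =>
    constructor
    · intro a ha
      rw [ih'.nat a ha, ih.nat a ha]
    · intro a ha
      rw [ih'.real a ha, ih.real a ha]

/-- `P`, started with `σ`, stops after at most `m` steps, and then `Q` holds. -/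
def Runs (P : Prog) (σ : Store) (m : ℕ) (Q : Store → Prop) : Prop :=
  ∃ k τ, Exec P σ k τ ∧ k ≤ m ∧ Q τ

/-! ### Rules for time-bounded termination. -/

namespace Runs

variable {P P' : Prog} {σ : Store} {m m' : ℕ} {Q Q' R : Store → Prop} {t : Test}

theorem mono (h : Runs P σ m Q) (hm : m ≤ m') (hQ : ∀ τ, Q τ → Q' τ) : Runs P σ m' Q' := by
  obtain ⟨k, τ, h1, h2, h3⟩ := h
  exact ⟨k, τ, h1, h2.trans hm, hQ τ h3⟩

theorem frame (h : Runs P σ m Q) : Runs P σ m fun τ => Unchanged P σ τ ∧ Q τ := by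
  obtain ⟨k, τ, h1, h2, h3⟩ := h
  exact ⟨k, τ, h1, h2, h1.unchanged, h3⟩

theorem seq (h : Runs P σ m R) (h' : ∀ τ, Unchanged P σ τ → R τ → Runs P' τ m' Q) :
    Runs (P ;; P') σ (m + m') Q := by
  obtain ⟨k, τ, h1, h2, h3⟩ := h
  obtain ⟨k', τ', h1', h2', h3'⟩ := h' τ h1.unchanged h3
  exact ⟨k + k', τ', .seq h1 h1', by omega, h3'⟩

theorem branch (h : t.Holds σ → Runs P σ m Q) (h' : ¬ t.Holds σ → Runs P' σ m Q) :
    Runs (.branch t P P') σ (m + 1) Q := by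
  by_cases ht : t.Holds σ
  · obtain ⟨k, τ, h1, h2, h3⟩ := h ht
    exact ⟨k + 1, τ, .branchTrue ht h1, by omega, h3⟩
  · obtain ⟨k, τ, h1, h2, h3⟩ := h' ht
    exact ⟨k + 1, τ, .branchFalse ht h1, by omega, h3⟩

/-- `Inv m σ` means that the invariant holds and that at most `m` steps remain, except for the
last test. -/
theorem loop (Inv : ℕ → Store → Prop) (h0 : Inv m σ)
    (hstep : ∀ m τ, Inv m τ → t.Holds τ → ∃ c m', c + 1 + m' ≤ m ∧ Runs P τ c (Inv m')) :
    Runs (.loop t P) σ (m + 1) fun τ => (∃ m, Inv m τ) ∧ ¬ t.Holds τ := by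
  induction m using Nat.strong_induction_on generalizing σ with
  | _ m ih =>
    by_cases ht : t.Holds σ
    · obtain ⟨c, m', hc, k, τ, h1, h2, h3⟩ := hstep m σ h0 ht
      obtain ⟨k', τ', h1', h2', h3'⟩ := ih m' (by omega) h3
      exact ⟨k + k' + 1, τ', .loopTrue ht h1 h1', by omega, h3'⟩
    · exact ⟨1, σ, .loopFalse ht, by omega, ⟨m, h0⟩, ht⟩

theorem of_wp (h : P.wp Q σ) (hm : P.size ≤ m) : Runs P σ m Q := by
  refine mono (m := P.size) ?_ hm fun _ => id
  induction P generalizing Q σ m with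
  | skip => exact ⟨1, σ, .skip σ, le_rfl, h⟩
  | setNat a i v => exact ⟨1, _, .setNat σ a i v, le_rfl, h⟩
  | setReal a i v => exact ⟨1, _, .setReal σ a i v, le_rfl, h⟩
  | seq P P' ih ih' => exact (ih h le_rfl).seq fun τ _ hτ => ih' hτ le_rfl
  | branch t P P' ih ih' =>
    exact branch (fun ht => (ih (h.1 ht) le_rfl).mono (by omega) fun _ => id)
      (fun ht => (ih' (h.2 ht) le_rfl).mono (by omega) fun _ => id)
  | loop => exact h.elim

/-- The counter is incremented outside the body, so the invariant is required after this assignment.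
Each round costs two extra steps, the test and the increment; two more are the initialization and
the last test. -/
theorem forLoop {i : ℕ} {e : NatExpr} (N : ℕ) (c : ℕ → ℕ) (Inv : ℕ → Store → Prop)
    (hi : P.writesNat i = false)
    (hN : ∀ τ, Unchanged (Prog.forLoop i e P) σ τ → e.eval τ = N)
    (h0 : Inv 0 (σ.setNat i 0 0))
    (hstep : ∀ j τ, j < N → Unchanged (Prog.forLoop i e P) σ τ → τ.nat i 0 = j → Inv j τ →
      Runs P τ (c j) fun τ' => Inv (j + 1) (τ'.setNat i 0 (j + 1))) :
    Runs (Prog.forLoop i e P) σ (∑ j ∈ Finset.range N, (c j + 2) + 2)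
      fun τ => Unchanged (Prog.forLoop i e P) σ τ ∧ Inv N τ := by
  suffices h : Runs (Prog.forLoop i e P) σ (∑ j ∈ Finset.range N, (c j + 2) + 2) (Inv N) from
    h.frame
  let body := Prog.loop (.natLt (nv i) e) (P ;; .letNat i (nv i + nc 1))
  have hw : ∀ a, (Prog.forLoop i e P).writesNat a = false ↔ i ≠ a ∧ P.writesNat a = false := by
    intro a
    simp only [Prog.forLoop, Prog.writesNat, Bool.or_eq_false_iff, beq_eq_false_iff_ne]
    tauto
  have hw' : ∀ a, (Prog.forLoop i e P).writesReal a = P.writesReal a := by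
    intro a
    simp [Prog.forLoop, Prog.writesReal]
  have hrest : ∀ n j τ, j + n = N → Unchanged (Prog.forLoop i e P) σ τ → τ.nat i 0 = j →
      Inv j τ → Runs body τ (∑ j ∈ Finset.Ico j N, (c j + 2) + 1) (Inv N) := by
    intro n
    induction n with
    | zero =>
      intro j τ hj hu hτ hinv
      obtain rfl : j = N := by omega
      refine ⟨1, τ, .loopFalse ?_, by omega, hinv⟩
      simp [hN τ hu, hτ]
    | succ n ih =>
      intro j τ hj hu hτ hinv
      obtain ⟨k, τ', h1, h2, h3⟩ := hstep j τ (by omega) hu hτ hinv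
      have hu' := h1.unchanged
      have hτ' : τ'.nat i 0 = j := by rw [hu'.nat i hi, hτ]
      obtain ⟨k', τ'', h4, h5, h6⟩ := ih (j + 1) (τ'.setNat i 0 (j + 1)) (by omega)
        ⟨fun a ha => by
          rw [Store.nat_setNat_of_ne _ _ _ ((hw a).1 ha).1.symm, hu'.nat a ((hw a).1 ha).2,
            hu.nat a ha],
        fun a ha => by rw [Store.real_setNat, hu'.real a (hw' a ▸ ha), hu.real a ha]⟩
        (by simp) h3
      have hset := Exec.setNat τ' i (nc 0) (nv i + nc 1)
      have hval : (nv i + nc 1).eval τ' = j + 1 := by simp [hτ']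
      rw [hval] at hset
      refine ⟨_, τ'', .loopTrue ?_ (.seq h1 hset) h4, ?_, h6⟩
      · simp [hN τ hu, hτ]; omega
      · rw [← Finset.sum_Ioo_add_eq_sum_Ico (by omega : j < N),
          show Finset.Ioo j N = Finset.Ico (j + 1) N from rfl]
        omega
  have hset : Runs (Prog.letNat i (nc 0)) σ 1 fun τ => τ = σ.setNat i 0 0 :=
    ⟨1, _, .setNat σ i (nc 0) (nc 0), le_rfl, rfl⟩
  refine (hset.seq (m' := ∑ j ∈ Finset.range N, (c j + 2) + 1) (Q := Inv N) ?_).mono (by omega)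
    fun _ => id
  rintro τ - rfl
  rw [Finset.range_eq_Ico]
  exact hrest N 0 _ (by omega) ⟨fun a ha => Store.nat_setNat_of_ne _ _ _ ((hw a).1 ha).1.symm,
    fun a _ => rfl⟩ (by simp) h0

theorem forLoop_const {i : ℕ} {e : NatExpr} (N c : ℕ) (Inv : ℕ → Store → Prop)
    (hi : P.writesNat i = false)
    (hN : ∀ τ, Unchanged (Prog.forLoop i e P) σ τ → e.eval τ = N)
    (h0 : Inv 0 (σ.setNat i 0 0))
    (hstep : ∀ j τ, j < N → Unchanged (Prog.forLoop i e P) σ τ → τ.nat i 0 = j → Inv j τ →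
      Runs P τ c fun τ' => Inv (j + 1) (τ'.setNat i 0 (j + 1))) :
    Runs (Prog.forLoop i e P) σ (N * (c + 2) + 2)
      fun τ => Unchanged (Prog.forLoop i e P) σ τ ∧ Inv N τ :=
  (forLoop N (fun _ => c) Inv hi hN h0 hstep).mono (by simp) fun _ => id

end Runs

/-! ## Merge sort

The program sorts the indices below `N` by the keys in the array `20` of real numbers. Arrays of
natural numbers: `20` holds `N`, `21` the result, `22` the result of the current pass, `23` the
length `w` of the sorted blocks, `24`, `25` and `26` the bounds `lo ≤ mid ≤ hi` of the two blocks
that are merged, `27`, `28` and `29` the positions in these blocks and in the result. -/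

/-- The keys of the entries of `A` from `l` to `h - 1` are sorted. -/
def SortedOn (key : ℕ → ℝ) (A : ℕ → ℕ) (l h : ℕ) : Prop :=
  ∀ a b, l ≤ a → a ≤ b → b < h → key (A a) ≤ key (A b)

/-- Take the next element in a merge. -/
def mergeStep : Prog :=
  .branch (.and (.natLt (nv 27) (nv 25))
      (.or (.natLe (nv 26) (nv 28))
        (.realLe (ra 20 (na 21 (nv 27))) (ra 20 (na 21 (nv 28))))))
    (.setNat 22 (nv 29) (na 21 (nv 27)) ;; .letNat 27 (nv 27 + nc 1))
    (.setNat 22 (nv 29) (na 21 (nv 28)) ;; .letNat 28 (nv 28 + nc 1)) ;;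
  .letNat 29 (nv 29 + nc 1)

/-- Merge the two blocks from `lo` to `mid` and from `mid` to `hi`. -/
def mergeBlocks : Prog :=
  (.letNat 27 (nv 24) ;; .letNat 28 (nv 25) ;; .letNat 29 (nv 24)) ;;
  .loop (.natLt (nv 29) (nv 26)) mergeStep

/-- Merge the next two blocks of length `w`. -/
def mergeNext : Prog :=
  (.letNat 25 (nv 24 + nv 23) ;;
    .branch (.natLt (nv 20) (nv 25)) (.letNat 25 (nv 20)) .skip ;;
    .letNat 26 (nv 25 + nv 23) ;;
    .branch (.natLt (nv 20) (nv 26)) (.letNat 26 (nv 20)) .skip) ;;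
  mergeBlocks ;;
  .letNat 24 (nv 26)

/-- Merge all pairs of adjacent blocks of length `w`. -/
def mergePass : Prog :=
  .letNat 24 (nc 0) ;;
  .loop (.natLt (nv 24) (nv 20)) mergeNext ;;
  .forLoop 29 (nv 20) (.setNat 21 (nv 29) (na 22 (nv 29))) ;;
  .letNat 23 (nv 23 + nv 23)

/-- Merge sort. -/
def sortProg : Prog :=
  .forLoop 29 (nv 20) (.setNat 21 (nv 29) (nv 29)) ;;
  .letNat 23 (nc 1) ;;
  .loop (.natLt (nv 23) (nv 20)) mergePass

/-- The positions `i` and `j` are the next ones to be read, `o` is the next one to be written, and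
`pos` says that as many entries were written as read. Only the occurrence of every entry is
recorded; injectivity follows later by counting. -/
structure MergeInv (A B₀ : ℕ → ℕ) (key : ℕ → ℝ) (lo mid hi : ℕ) (B : ℕ → ℕ) (i j o : ℕ) : Prop where
  lo_le : lo ≤ i
  le_mid : i ≤ mid
  mid_le : mid ≤ j
  le_hi : j ≤ hi
  pos : i + j = o + mid
  sorted : SortedOn key B lo o
  left : ∀ a c, lo ≤ a → a < o → i ≤ c → c < mid → key (B a) ≤ key (A c)
  right : ∀ a c, lo ≤ a → a < o → j ≤ c → c < hi → key (B a) ≤ key (A c)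
  hit_left : ∀ c, lo ≤ c → c < i → ∃ a, lo ≤ a ∧ a < o ∧ B a = A c
  hit_right : ∀ c, mid ≤ c → c < j → ∃ a, lo ≤ a ∧ a < o ∧ B a = A c
  below : ∀ a, a < lo → B a = B₀ a

namespace MergeInv

variable {A B₀ B : ℕ → ℕ} {key : ℕ → ℝ} {lo mid hi i j o : ℕ}

/-- The hypothesis on the other block is all that the comparison must provide; the rest of the same
block is handled by its sortedness. -/
theorem takeLeft (h : MergeInv A B₀ key lo mid hi B i j o) (hA : SortedOn key A lo mid)
    (hi' : i < mid) (hc : ∀ c, j ≤ c → c < hi → key (A i) ≤ key (A c)) :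
    MergeInv A B₀ key lo mid hi (Function.update B o (A i)) (i + 1) j (o + 1) := by
  have hlo := h.lo_le
  have hpos := h.pos
  have hmj := h.mid_le
  have hne : ∀ a, a < o → Function.update B o (A i) a = B a := fun a ha =>
    Function.update_of_ne ha.ne _ _
  have heq : Function.update B o (A i) o = A i := Function.update_self _ _ _
  refine ⟨by omega, by omega, h.mid_le, h.le_hi, by omega, ?_, ?_, ?_, ?_, ?_, ?_⟩
  · intro a b h1 h2 h3
    rcases Nat.lt_succ_iff_lt_or_eq.1 h3 with h4 | rfl
    · rw [hne a (by omega), hne b h4]; exact h.sorted a b h1 h2 h4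
    · rw [heq]
      rcases h2.lt_or_eq with h4 | rfl
      · rw [hne a h4]; exact h.left a i h1 h4 le_rfl hi'
      · rw [heq]
  · intro a c h1 h2 h3 h4
    rcases Nat.lt_succ_iff_lt_or_eq.1 h2 with h5 | rfl
    · rw [hne a h5]; exact h.left a c h1 h5 (by omega) h4
    · rw [heq]; exact hA i c hlo (by omega) h4
  · intro a c h1 h2 h3 h4
    rcases Nat.lt_succ_iff_lt_or_eq.1 h2 with h5 | rfl
    · rw [hne a h5]; exact h.right a c h1 h5 (by omega) h4
    · rw [heq]; exact hc c h3 h4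
  · intro c h1 h2
    rcases Nat.lt_succ_iff_lt_or_eq.1 h2 with h3 | rfl
    · obtain ⟨a, h4, h5, h6⟩ := h.hit_left c h1 h3
      exact ⟨a, h4, by omega, by rw [hne a h5, h6]⟩
    · exact ⟨o, by omega, by omega, heq⟩
  · intro c h1 h2
    obtain ⟨a, h4, h5, h6⟩ := h.hit_right c h1 h2
    exact ⟨a, h4, by omega, by rw [hne a h5, h6]⟩
  · intro a ha
    rw [hne a (by omega), h.below a ha]

theorem takeRight (h : MergeInv A B₀ key lo mid hi B i j o) (hA : SortedOn key A mid hi)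
    (hj' : j < hi) (hc : ∀ c, i ≤ c → c < mid → key (A j) ≤ key (A c)) :
    MergeInv A B₀ key lo mid hi (Function.update B o (A j)) i (j + 1) (o + 1) := by
  have hlo := h.lo_le
  have hpos := h.pos
  have hmj := h.mid_le
  have him := h.le_mid
  have hne : ∀ a, a < o → Function.update B o (A j) a = B a := fun a ha =>
    Function.update_of_ne ha.ne _ _
  have heq : Function.update B o (A j) o = A j := Function.update_self _ _ _
  refine ⟨by omega, by omega, by omega, by omega, by omega, ?_, ?_, ?_, ?_, ?_, ?_⟩
  · intro a b h1 h2 h3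
    rcases Nat.lt_succ_iff_lt_or_eq.1 h3 with h4 | rfl
    · rw [hne a (by omega), hne b h4]; exact h.sorted a b h1 h2 h4
    · rw [heq]
      rcases h2.lt_or_eq with h4 | rfl
      · rw [hne a h4]; exact h.right a j h1 h4 le_rfl hj'
      · rw [heq]
  · intro a c h1 h2 h3 h4
    rcases Nat.lt_succ_iff_lt_or_eq.1 h2 with h5 | rfl
    · rw [hne a h5]; exact h.left a c h1 h5 (by omega) h4
    · rw [heq]; exact hc c h3 h4
  · intro a c h1 h2 h3 h4
    rcases Nat.lt_succ_iff_lt_or_eq.1 h2 with h5 | rfl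
    · rw [hne a h5]; exact h.right a c h1 h5 (by omega) h4
    · rw [heq]; exact hA j c hmj (by omega) h4
  · intro c h1 h2
    obtain ⟨a, h4, h5, h6⟩ := h.hit_left c h1 h2
    exact ⟨a, h4, by omega, by rw [hne a h5, h6]⟩
  · intro c h1 h2
    rcases Nat.lt_succ_iff_lt_or_eq.1 h2 with h3 | rfl
    · obtain ⟨a, h4, h5, h6⟩ := h.hit_right c h1 h3
      exact ⟨a, h4, by omega, by rw [hne a h5, h6]⟩
    · exact ⟨o, by omega, by omega, heq⟩
  · intro a ha
    rw [hne a (by omega), h.below a ha]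

end MergeInv

theorem runs_mergeBlocks (σ : Store) {lo mid hi : ℕ} (hlo : σ.nat 24 0 = lo)
    (hmid : σ.nat 25 0 = mid) (hhi : σ.nat 26 0 = hi) (h1 : lo ≤ mid) (h2 : mid ≤ hi)
    (hl : SortedOn (σ.real 20) (σ.nat 21) lo mid) (hr : SortedOn (σ.real 20) (σ.nat 21) mid hi) :
    Runs mergeBlocks σ (9 * (hi - lo) + 4) fun τ =>
      SortedOn (σ.real 20) (τ.nat 22) lo hi ∧
      (∀ c, lo ≤ c → c < hi → ∃ a, lo ≤ a ∧ a < hi ∧ τ.nat 22 a = σ.nat 21 c) ∧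
      ∀ a, a < lo → τ.nat 22 a = σ.nat 22 a := by
  let Inv : ℕ → Store → Prop := fun m τ => m = 9 * (hi - τ.nat 29 0) ∧ τ.nat 21 = σ.nat 21 ∧
    τ.nat 25 0 = mid ∧ τ.nat 26 0 = hi ∧ τ.real 20 = σ.real 20 ∧
    MergeInv (σ.nat 21) (σ.nat 22) (σ.real 20) lo mid hi (τ.nat 22) (τ.nat 27 0) (τ.nat 28 0)
      (τ.nat 29 0)
  have hloop : ∀ τ, Inv (9 * (hi - lo)) τ →
      Runs (.loop (.natLt (nv 29) (nv 26)) mergeStep) τ (9 * (hi - lo) + 1) fun τ =>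
        SortedOn (σ.real 20) (τ.nat 22) lo hi ∧
        (∀ c, lo ≤ c → c < hi → ∃ a, lo ≤ a ∧ a < hi ∧ τ.nat 22 a = σ.nat 21 c) ∧
        ∀ a, a < lo → τ.nat 22 a = σ.nat 22 a := by
    intro τ hτ
    refine (Runs.loop Inv hτ ?_).mono le_rfl ?_
    · rintro m τ ⟨rfl, hA, hm, hh, hK, hinv⟩ ht
      simp only [Test.Holds, NatExpr.eval, hh, not_le] at ht
      refine ⟨8, 9 * (hi - (τ.nat 29 0 + 1)), by omega, Runs.of_wp ?_ (by decide)⟩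
      have hpos := hinv.pos
      have him := hinv.le_mid
      simp only [mergeStep, Prog.wp, Test.Holds, NatExpr.eval, RealExpr.eval, hA, hm, hh, hK]
      constructor
      · rintro ⟨h3, h4⟩
        refine ⟨by simp, by simp [hA], by simp [hm], by simp [hh], by simp [hK], ?_⟩
        simp only [Store.nat_setNat_self, ne_eq,
          Store.nat_setNat_of_ne, Function.update_self, Nat.reduceEqDiff,
          not_false_eq_true]
        refine hinv.takeLeft hl (by omega) fun c h5 h6 => ?_
        by_cases h7 : hi ≤ τ.nat 28 0
        · omega
        · exact (by_contra fun h8 => h4 ⟨h7, h8⟩ : _ ≤ _).trans (hr _ c hinv.mid_le h5 h6)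
      · intro h3
        refine ⟨by simp, by simp [hA], by simp [hm], by simp [hh], by simp [hK], ?_⟩
        simp only [Store.nat_setNat_self, ne_eq,
          Store.nat_setNat_of_ne, Function.update_self, Nat.reduceEqDiff,
          not_false_eq_true]
        -- If the right block were exhausted, the left one would not be, and the test would have
        -- chosen it.
        have hj : τ.nat 28 0 < hi := by
          by_contra h4
          refine h3 ⟨by omega, fun h5 => h5.1 (by omega)⟩
        refine hinv.takeRight hr hj fun c h5 h6 => ?_
        have h7 : ¬ (σ.real 20 (σ.nat 21 (τ.nat 27 0)) ≤ σ.real 20 (σ.nat 21 (τ.nat 28 0))) :=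
          fun h8 => h3 ⟨by omega, fun h9 => h9.2 h8⟩
        exact (not_le.1 h7).le.trans (hl _ c hinv.lo_le h5 h6)
    · rintro τ ⟨⟨m, -, -, -, hh, -, hinv⟩, ht⟩
      simp only [Test.Holds, NatExpr.eval, hh, not_le, not_lt] at ht
      have hpos := hinv.pos
      have him := hinv.le_mid
      have hjh := hinv.le_hi
      have ho : τ.nat 29 0 = hi := by omega
      have hi1 : τ.nat 27 0 = mid := by omega
      have hj1 : τ.nat 28 0 = hi := by omega
      rw [ho, hi1, hj1] at hinv
      refine ⟨hinv.sorted, fun c h3 h4 => ?_, hinv.below⟩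
      by_cases h5 : c < mid
      · exact hinv.hit_left c h3 h5
      · exact hinv.hit_right c (by omega) h4
  refine (Runs.seq (m := 3) (Runs.of_wp (Q := Inv (9 * (hi - lo))) ?_ le_rfl)
    fun τ _ hτ => hloop τ hτ).mono (by omega) fun _ => id
  simp only [Prog.wp, Inv]
  simp only [NatExpr.eval, Store.nat_setNat_self, ne_eq, Store.real_setNat, Store.nat_setNat_of_ne,
    Function.update_self, Nat.reduceEqDiff, not_false_eq_true, hlo, hmid, hhi, true_and]
  refine ⟨le_rfl, h1, le_rfl, h2, by omega, ?_, ?_, ?_, ?_, ?_, ?_⟩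
  · intro a b h3 h4 h5; omega
  · intros; omega
  · intros; omega
  · intros; omega
  · intros; omega
  · intros; rfl

/-- All blocks of length `w` are sorted. -/
def BlocksSorted (key : ℕ → ℝ) (A : ℕ → ℕ) (w N : ℕ) : Prop :=
  ∀ q, SortedOn key A (q * w) (min (q * w + w) N)

theorem BlocksSorted.zero_width_one (key : ℕ → ℝ) (A : ℕ → ℕ) (N : ℕ) :
    BlocksSorted key A 1 N := by
  intro q a b h1 h2 h3
  obtain rfl : a = b := by omega
  exact le_rfl

/-- The invariant of a pass: the blocks of length `2 w` below `lo` have been merged. -/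
structure PassInv (key : ℕ → ℝ) (A B : ℕ → ℕ) (w N lo : ℕ) : Prop where
  le : lo ≤ N
  dvd : (∃ q, lo = q * (w + w)) ∨ lo = N
  sorted : ∀ q, SortedOn key B (q * (w + w)) (min (q * (w + w) + (w + w)) lo)
  hit : ∀ c, c < lo → ∃ a, a < lo ∧ B a = A c

/-- All merged blocks but possibly the last have full length `2 w`: either `hi` is again a multiple
of `2 w`, or the end `N` has been reached. -/
theorem PassInv.next {key : ℕ → ℝ} {A B B' : ℕ → ℕ} {w N lo mid hi : ℕ}
    (h : PassInv key A B w N lo) (hlo : lo < N) (hmid : mid = min (lo + w) N)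
    (hhi : hi = min (mid + w) N) (hw : 0 < w) (hs : SortedOn key B' lo hi)
    (hh : ∀ c, lo ≤ c → c < hi → ∃ a, lo ≤ a ∧ a < hi ∧ B' a = A c)
    (hb : ∀ a, a < lo → B' a = B a) : PassInv key A B' w N hi := by
  obtain ⟨q, hq⟩ : ∃ q, lo = q * (w + w) := h.dvd.resolve_right hlo.ne
  refine ⟨by omega, ?_, ?_, ?_⟩
  · by_cases h1 : hi = N
    · exact Or.inr h1
    · exact Or.inl ⟨q + 1, by rw [add_mul, one_mul, ← hq]; omega⟩
  · intro r a b h1 h2 h3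
    rcases lt_trichotomy r q with h4 | rfl | h4
    · have h5 : (r + 1) * (w + w) ≤ q * (w + w) := Nat.mul_le_mul_right _ h4
      rw [add_mul, one_mul] at h5
      rw [hb a (by omega), hb b (by omega)]
      exact h.sorted r a b h1 h2 (by omega)
    · exact hs a b (by omega) h2 (by omega)
    · have h5 : (q + 1) * (w + w) ≤ r * (w + w) := Nat.mul_le_mul_right _ h4
      rw [add_mul, one_mul] at h5
      omega
  · intro c hc
    by_cases h1 : c < lo
    · obtain ⟨a, h2, h3⟩ := h.hit c h1
      exact ⟨a, by omega, by rw [hb a h2, h3]⟩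
    · obtain ⟨a, h2, h3, h4⟩ := hh c (by omega) hc
      exact ⟨a, h3, h4⟩

theorem runs_mergeNext (σ : Store) {N w lo : ℕ} (hN : σ.nat 20 0 = N) (hw : σ.nat 23 0 = w)
    (hlo : σ.nat 24 0 = lo) (hw0 : 0 < w) (hlt : lo < N)
    (hA : BlocksSorted (σ.real 20) (σ.nat 21) w N)
    (h : PassInv (σ.real 20) (σ.nat 21) (σ.nat 22) w N lo) :
    ∃ hi, lo < hi ∧ hi ≤ N ∧ Runs mergeNext σ (9 * (hi - lo) + 13) fun τ =>
      τ.nat 24 0 = hi ∧ PassInv (σ.real 20) (σ.nat 21) (τ.nat 22) w N hi := by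
  obtain ⟨mid, hmid⟩ : ∃ mid, mid = min (lo + w) N := ⟨_, rfl⟩
  obtain ⟨hi, hhi⟩ : ∃ hi, hi = min (mid + w) N := ⟨_, rfl⟩
  obtain ⟨q, hq⟩ : ∃ q, lo = q * (w + w) := h.dvd.resolve_right hlt.ne
  -- The pair of blocks starting at `q * (w + w)` consists of the blocks `2 q` and `2 q + 1` of
  -- length `w`.
  have hl : SortedOn (σ.real 20) (σ.nat 21) lo mid := by
    have := hA (2 * q)
    have h1 : 2 * q * w = lo := by rw [hq]; ring
    rwa [h1, ← hmid] at this
  have hr : SortedOn (σ.real 20) (σ.nat 21) mid hi := by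
    by_cases h2 : mid = N
    · intro a b _ _ _; omega
    · have := hA (2 * q + 1)
      have h1 : (2 * q + 1) * w = lo + w := by rw [hq]; ring
      rwa [h1, show lo + w = mid by omega, ← hhi] at this
  refine ⟨hi, by omega, by omega, ?_⟩
  have hpre : Runs (.letNat 25 (nv 24 + nv 23) ;;
      .branch (.natLt (nv 20) (nv 25)) (.letNat 25 (nv 20)) .skip ;;
      .letNat 26 (nv 25 + nv 23) ;;
      .branch (.natLt (nv 20) (nv 26)) (.letNat 26 (nv 20)) .skip) σ 8
      fun τ => τ.nat 25 0 = mid ∧ τ.nat 26 0 = hi := by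
    refine Runs.of_wp ?_ le_rfl
    simp only [Prog.wp, Test.Holds, NatExpr.eval, Store.nat_setNat_self, ne_eq,
      Store.nat_setNat_of_ne, Function.update_self, Nat.reduceEqDiff, not_false_eq_true, hN, hw,
      hlo]
    constructor <;> intro h1 <;> constructor <;> intro h2 <;> constructor <;> omega
  unfold mergeNext
  refine Runs.mono (m := 8 + (9 * (hi - lo) + 4 + 1)) ?_ (by omega) fun _ => id
  refine hpre.seq fun τ hu hτ => ?_
  have h24 : τ.nat 24 = σ.nat 24 := hu.nat _ rfl
  have h21 : τ.nat 21 = σ.nat 21 := hu.nat _ rfl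
  have h22 : τ.nat 22 = σ.nat 22 := hu.nat _ rfl
  have h20 : τ.real 20 = σ.real 20 := hu.real _ rfl
  refine (runs_mergeBlocks τ (by rw [h24, hlo]) hτ.1 hτ.2 (by omega) (by omega)
    (by rwa [h20, h21]) (by rwa [h20, h21])).seq fun τ' hu' hτ' => Runs.of_wp ?_ le_rfl
  have h26 : τ'.nat 26 = τ.nat 26 := hu'.nat _ rfl
  rw [h20, h21, h22] at hτ'
  simp only [Prog.wp, NatExpr.eval, Store.nat_setNat_self, ne_eq, Store.nat_setNat_of_ne,
    Function.update_self, Nat.reduceEqDiff, not_false_eq_true, h26, hτ.2, true_and]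
  exact h.next hlt hmid hhi hw0 hτ'.1 hτ'.2.1 hτ'.2.2

theorem runs_mergePass (σ : Store) {N w : ℕ} (hN : σ.nat 20 0 = N) (hw : σ.nat 23 0 = w)
    (hw0 : 0 < w) (hA : BlocksSorted (σ.real 20) (σ.nat 21) w N) :
    Runs mergePass σ (26 * N + 5) fun τ => τ.nat 23 0 = w + w ∧
      BlocksSorted (σ.real 20) (τ.nat 21) (w + w) N ∧
      ∀ c, c < N → ∃ a, a < N ∧ τ.nat 21 a = σ.nat 21 c := by
  let Inv : ℕ → Store → Prop := fun m τ => m = 23 * (N - τ.nat 24 0) ∧ Unchanged mergeNext σ τ ∧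
    PassInv (σ.real 20) (σ.nat 21) (τ.nat 22) w N (τ.nat 24 0)
  refine Runs.mono (m := 1 + (23 * N + 1 + (N * (1 + 2) + 2 + 1))) ?_ (by omega) fun _ => id
  refine (Runs.of_wp (P := .letNat 24 (nc 0)) (Q := Inv (23 * N)) ?_ le_rfl).seq fun τ _ hτ => ?_
  · refine ⟨by simp, ⟨fun a ha => ?_, fun _ _ => rfl⟩, by simp, Or.inl ⟨0, by simp⟩, ?_, by simp⟩
    · have : 24 ≠ a := by rintro rfl; exact absurd ha (by decide)
      exact Store.nat_setNat_of_ne _ _ _ this.symm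
    · intro q a b h1 h2 h3
      simp at h3
  refine (Runs.loop Inv hτ ?_).seq fun τ _ hτ => ?_
  · rintro m τ ⟨rfl, hu, hinv⟩ ht
    have h20 : τ.nat 20 = σ.nat 20 := hu.nat _ rfl
    have h21 : τ.nat 21 = σ.nat 21 := hu.nat _ rfl
    have h23 : τ.nat 23 = σ.nat 23 := hu.nat _ rfl
    have hk : τ.real 20 = σ.real 20 := hu.real _ rfl
    simp only [Test.Holds, NatExpr.eval, h20, hN, not_le] at ht
    obtain ⟨hi, h1, h2, hrun⟩ := runs_mergeNext τ (by rw [h20, hN]) (by rw [h23, hw]) rfl hw0 ht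
      (by rwa [hk, h21]) (by rwa [hk, h21])
    -- Since `lo < hi`, the constant overhead of 14 steps per merge is charged to the merged
    -- entries: 9 + 14 = 23.
    refine ⟨_, 23 * (N - hi), ?_, hrun.frame.mono le_rfl fun τ' hτ' => ?_⟩
    · omega
    · refine ⟨by rw [hτ'.2.1], ⟨fun a ha => ?_, fun a ha => ?_⟩, ?_⟩
      · rw [hτ'.1.nat a ha, hu.nat a ha]
      · rw [hτ'.1.real a ha, hu.real a ha]
      · rw [hτ'.2.1, ← hk, ← h21]; exact hτ'.2.2
  obtain ⟨⟨m, -, hu, hinv⟩, ht⟩ := hτ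
  have h20 : τ.nat 20 = σ.nat 20 := hu.nat _ rfl
  simp only [Test.Holds, NatExpr.eval, h20, hN, not_le, not_lt] at ht
  have hlo : τ.nat 24 0 = N := le_antisymm hinv.le ht
  rw [hlo] at hinv
  refine (Runs.forLoop_const N 1 (fun j τ' => ∀ a, a < j → τ'.nat 21 a = τ.nat 22 a) rfl ?_ ?_
    ?_).seq fun τ' hu' hτ' => ?_
  · intro τ' hu'
    have h1 : τ'.nat 20 = τ.nat 20 := hu'.nat _ rfl
    simp [h1, h20, hN]
  · intro a ha; omega
  · intro j τ' hj hu' hτ'j hinv'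
    refine Runs.of_wp ?_ le_rfl
    intro a ha
    have h22 : τ'.nat 22 = τ.nat 22 := hu'.nat _ rfl
    simp only [NatExpr.eval, hτ'j, h22, ne_eq, Nat.reduceEqDiff, not_false_eq_true,
      Store.nat_setNat_of_ne, Store.nat_setNat_self, Function.update_apply]
    split_ifs with h1
    · rw [h1]
    · exact hinv' a (by omega)
  · have h23 : τ'.nat 23 = σ.nat 23 := (hu'.nat _ rfl).trans (hu.nat _ rfl)
    refine Runs.of_wp ?_ le_rfl
    simp only [Prog.wp, NatExpr.eval, ne_eq, Nat.reduceEqDiff,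
      not_false_eq_true, Store.nat_setNat_of_ne, Store.nat_setNat_self, Function.update_self, h23,
      hw, true_and]
    refine ⟨fun q a b h1 h2 h3 => ?_, fun c hc => ?_⟩
    · rw [hτ'.2 a (by omega), hτ'.2 b (by omega)]
      exact hinv.sorted q a b h1 h2 h3
    · obtain ⟨a, h1, h2⟩ := hinv.hit c hc
      exact ⟨a, h1, by rw [hτ'.2 a h1, h2]⟩

/-- `A` is a sorting permutation of the indices below `N`. -/
structure IsSorting (key : ℕ → ℝ) (A : ℕ → ℕ) (N : ℕ) : Prop where
  hit : ∀ v, v < N → ∃ a, a < N ∧ A a = v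
  sorted : SortedOn key A 0 N

/-- The block length doubles in each pass, so `Nat.clog 2 N` passes suffice. Each pass keeps every
index among the entries. -/
theorem runs_sortProg (σ : Store) {N : ℕ} (hN : σ.nat 20 0 = N) :
    Runs sortProg σ (Nat.clog 2 N * (26 * N + 6) + (3 * N + 4)) fun τ =>
      IsSorting (σ.real 20) (τ.nat 21) N := by
  let Inv : ℕ → Store → Prop := fun m τ => ∃ j, τ.nat 23 0 = 2 ^ j ∧
    m = (Nat.clog 2 N - j) * (26 * N + 6) ∧ τ.nat 20 0 = N ∧ τ.real 20 = σ.real 20 ∧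
    BlocksSorted (σ.real 20) (τ.nat 21) (2 ^ j) N ∧ ∀ v, v < N → ∃ a, a < N ∧ τ.nat 21 a = v
  refine Runs.mono (m := N * (1 + 2) + 2 + (1 + (Nat.clog 2 N * (26 * N + 6) + 1))) ?_ (by omega)
    fun _ => id
  refine (Runs.forLoop_const N 1 (fun j τ => ∀ a, a < j → τ.nat 21 a = a) rfl ?_ ?_
    ?_).seq fun τ _ hτ => ?_
  · intro τ hu
    have h1 : τ.nat 20 = σ.nat 20 := hu.nat _ rfl
    simp [h1, hN]
  · intro a ha; omega
  · intro j τ hj hu hτj hinv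
    refine Runs.of_wp ?_ le_rfl
    intro a ha
    simp only [NatExpr.eval, hτj, ne_eq, Nat.reduceEqDiff, not_false_eq_true,
      Store.nat_setNat_of_ne, Store.nat_setNat_self, Function.update_apply]
    split_ifs with h1
    · rw [h1]
    · exact hinv a (by omega)
  obtain ⟨hu, hτ⟩ := hτ
  have h20 : τ.nat 20 = σ.nat 20 := hu.nat _ rfl
  have hk : τ.real 20 = σ.real 20 := hu.real _ rfl
  refine (Runs.of_wp (P := .letNat 23 (nc 1)) (Q := Inv (Nat.clog 2 N * (26 * N + 6))) ?_
    le_rfl).seq fun τ _ hτ => ?_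
  · refine ⟨0, by simp, by simp, by simp [h20, hN], by simp [hk], ?_, ?_⟩
    · exact BlocksSorted.zero_width_one _ _ _
    · intro v hv
      exact ⟨v, hv, by simp [hτ v hv]⟩
  refine (Runs.loop Inv hτ ?_).mono le_rfl ?_
  · rintro m τ ⟨j, hw, rfl, hN', hk', hs, hh⟩ ht
    simp only [Test.Holds, NatExpr.eval, hN', hw, not_le] at ht
    have hj : j < Nat.clog 2 N := (Nat.lt_clog_iff_pow_lt one_lt_two).2 ht
    refine ⟨26 * N + 5, (Nat.clog 2 N - (j + 1)) * (26 * N + 6), ?_, ?_⟩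
    · have : Nat.clog 2 N - j = Nat.clog 2 N - (j + 1) + 1 := by omega
      rw [this, add_mul, one_mul]
      omega
    · refine (runs_mergePass τ hN' hw (by positivity) (by rwa [hk'])).frame.mono le_rfl ?_
      rintro τ' ⟨hu', h1, h2, h3⟩
      have h20' : τ'.nat 20 = τ.nat 20 := hu'.nat _ rfl
      have hk'' : τ'.real 20 = τ.real 20 := hu'.real _ rfl
      refine ⟨j + 1, by rw [h1, pow_succ]; ring, rfl, by rw [h20', hN'], by rw [hk'', hk'], ?_, ?_⟩
      · rw [show 2 ^ (j + 1) = 2 ^ j + 2 ^ j by rw [pow_succ]; ring, ← hk']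
        exact h2
      · intro v hv
        obtain ⟨a, h4, rfl⟩ := hh v hv
        exact h3 a h4
  · rintro τ ⟨⟨m, j, hw, -, hN', -, hs, hh⟩, ht⟩
    simp only [Test.Holds, NatExpr.eval, hN', hw, not_le, not_lt] at ht
    refine ⟨hh, ?_⟩
    have := hs 0
    rwa [zero_mul, zero_add, min_eq_right ht] at this

namespace IsSorting

variable {key key' : ℕ → ℝ} {A : ℕ → ℕ} {N : ℕ}

/-- Pigeonhole: `N` cells contain all of the `N` indices, so they contain nothing else and no index
twice. -/
theorem image_eq (h : IsSorting key A N) : (Finset.range N).image A = Finset.range N := by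
  symm
  refine Finset.eq_of_subset_of_card_le (fun v hv => ?_) Finset.card_image_le
  obtain ⟨a, h1, h2⟩ := h.hit v (Finset.mem_range.1 hv)
  exact Finset.mem_image.2 ⟨a, Finset.mem_range.2 h1, h2⟩

theorem lt (h : IsSorting key A N) {a : ℕ} (ha : a < N) : A a < N := by
  have : A a ∈ (Finset.range N).image A := Finset.mem_image_of_mem _ (Finset.mem_range.2 ha)
  rw [h.image_eq] at this
  exact Finset.mem_range.1 this

theorem inj (h : IsSorting key A N) {a b : ℕ} (ha : a < N) (hb : b < N) (hab : A a = A b) :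
    a = b := by
  have : Set.InjOn A (Finset.range N : Finset ℕ) := by
    rw [← Finset.card_image_iff, h.image_eq]
  exact this (by simpa using ha) (by simpa using hb) hab

theorem congr (h : IsSorting key A N) (hk : ∀ i, i < N → key' i = key i) {A' : ℕ → ℕ}
    (hA : ∀ a, a < N → A' a = A a) : IsSorting key' A' N := by
  refine ⟨fun v hv => ?_, fun a b h1 h2 h3 => ?_⟩
  · obtain ⟨a, ha, hav⟩ := h.hit v hv
    exact ⟨a, ha, by rw [hA a ha, hav]⟩
  · rw [hA a (by omega), hA b h3, hk _ (h.lt (by omega)), hk _ (h.lt h3)]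
    exact h.sorted a b h1 h2 h3

end IsSorting

/-- Store in the array `dst` the indices below `n`, sorted by the keys that `key` computes from the
counter `10`. -/
def sortBy (n : NatExpr) (key : RealExpr) (dst : ℕ) : Prog :=
  .letNat 20 n ;;
  .forLoop 10 (nv 20) (.setReal 20 (nv 10) key) ;;
  sortProg ;;
  .forLoop 10 (nv 20) (.setNat dst (nv 10) (na 21 (nv 10)))

/-- A bound on the running time of `sortBy`. -/
def sortTime (N : ℕ) : ℕ := Nat.clog 2 N * (26 * N + 6) + (9 * N + 9)

/-- The key expression is evaluated while scratch arrays change. Hence it is required to give `K j`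
in every store that agrees with `σ` on the low arrays, which sorting does not touch before the
result is copied. -/
theorem runs_sortBy (σ : Store) {n : NatExpr} {key : RealExpr} {dst N : ℕ} {K : ℕ → ℝ}
    (hdst : dst < 10) (hn : n.eval σ = N)
    (hK : ∀ j τ, j < N → (∀ a, a < 10 → τ.nat a = σ.nat a) → (∀ a, a < 20 → τ.real a = σ.real a) →
      τ.nat 10 0 = j → key.eval τ = K j) :
    Runs (sortBy n key dst) σ (sortTime N) fun τ => IsSorting K (τ.nat dst) N := by
  refine Runs.mono (m := 1 + (N * (1 + 2) + 2 + (Nat.clog 2 N * (26 * N + 6) + (3 * N + 4) +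
    (N * (1 + 2) + 2)))) ?_ (by rw [sortTime]; omega) fun _ => id
  refine (Runs.of_wp (P := .letNat 20 n) (Q := fun τ => τ.nat 20 0 = N) (by simp [Prog.wp, hn])
    le_rfl).seq fun τ hu hτ => ?_
  refine (Runs.forLoop_const N 1 (fun j τ => ∀ i, i < j → τ.real 20 i = K i) rfl ?_ ?_
    ?_).seq fun τ' _ hτ' => ?_
  · intro τ' hu'
    have h1 : τ'.nat 20 = τ.nat 20 := hu'.nat _ rfl
    simp [h1, hτ]
  · intro a ha; omega
  · intro j τ' hj hu' hτ'j hinv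
    have hw : ∀ a, a < 10 → τ'.nat a = σ.nat a := by
      intro a ha
      rw [hu'.nat a, hu.nat a]
      · simp [Prog.writesNat]; omega
      · simp [Prog.forLoop, Prog.writesNat]; omega
    have hw' : ∀ a, a < 20 → τ'.real a = σ.real a := by
      intro a ha
      rw [hu'.real a, hu.real a]
      · rfl
      · simp [Prog.forLoop, Prog.writesReal]; omega
    refine Runs.of_wp ?_ le_rfl
    intro i hi
    simp only [NatExpr.eval, hτ'j, hK j τ' hj hw hw' hτ'j, Store.real_setNat,
      Store.real_setReal_self, Function.update_apply]
    split_ifs with h1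
    · rw [h1]
    · exact hinv i (by omega)
  obtain ⟨hu', hτ'⟩ := hτ'
  have h20 : τ'.nat 20 0 = N := by rw [hu'.nat 20 rfl, hτ]
  refine (runs_sortProg τ' h20).seq fun τ'' hu'' hτ'' => ?_
  have h20' : τ''.nat 20 0 = N := by rw [hu''.nat 20 rfl, h20]
  refine (Runs.forLoop_const N 1 (fun j ρ => ∀ a, a < j → ρ.nat dst a = τ''.nat 21 a) ?_ ?_ ?_
    ?_).mono le_rfl ?_
  · simp [Prog.writesNat]; omega
  · intro ρ hρ
    have h1 : ρ.nat 20 = τ''.nat 20 := hρ.nat _ (by simp [Prog.forLoop, Prog.writesNat]; omega)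
    simp [h1, h20']
  · intro a ha; omega
  · intro j ρ hj hρ hρj hinv
    have h21 : ρ.nat 21 = τ''.nat 21 := hρ.nat _ (by simp [Prog.forLoop, Prog.writesNat]; omega)
    refine Runs.of_wp ?_ le_rfl
    intro a ha
    rw [Store.nat_setNat_of_ne _ _ _ (by omega)]
    simp only [NatExpr.eval, hρj, h21, Store.nat_setNat_self, Function.update_apply]
    split_ifs with h1
    · rw [h1]
    · exact hinv a (by omega)
  · rintro ρ ⟨-, hρ⟩
    exact hτ''.congr (fun i hi => (hτ' i hi).symm) hρ

/-! ### Reading the input from the memory. -/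

variable {nl nf : ℕ}

/-- The memory contains a description of the instance. -/
structure Loaded (I : Instance (Fin nl) (Fin nf)) (σ : Store) : Prop where
  hnl : σ.nat 0 0 = nl
  hnf : σ.nat 0 1 = nf
  hb : σ.nat 0 2 = I.b
  hcl : ∀ e : Fin nl, σ.real 0 e = I.cl e
  hcf : ∀ e : Fin nf, σ.real 1 e = I.cf e
  hsum : ∑ i ∈ Finset.range nf, σ.nat 1 i = I.numValues
  mem_iff : ∀ (e : Fin nf) (δ : ℝ), δ ∈ I.U e ↔
    ∃ r, r < σ.nat 1 e ∧ σ.real 2 (∑ i ∈ Finset.range e, σ.nat 1 i + r) = δ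

theorem Loaded.congr {I : Instance (Fin nl) (Fin nf)} {σ τ : Store} (h : Loaded I σ)
    (h0 : τ.nat 0 = σ.nat 0) (h1 : τ.nat 1 = σ.nat 1) (h2 : τ.real 0 = σ.real 0)
    (h3 : τ.real 1 = σ.real 1) (h4 : τ.real 2 = σ.real 2) : Loaded I τ := by
  obtain ⟨a, b, c, d, e, f, g⟩ := h
  constructor <;> simp only [h0, h1, h2, h3, h4] <;> assumption

/-- The list of `e` begins in the concatenation at the sum of the lengths of the preceding lists. -/
theorem flatten_ofFn_getD {n : ℕ} (V : Fin n → List ℝ) (e : Fin n) {r : ℕ}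
    (hr : r < (V e).length) :
    (List.ofFn V).flatten.getD
      (∑ i ∈ Finset.range e, (List.ofFn fun e => (V e).length).getD i 0 + r) 0 = (V e)[r] := by
  have hlen : ∀ m, m ≤ n → (((List.ofFn V).map List.length).take m).sum
      = ∑ i ∈ Finset.range m, (List.ofFn fun e => (V e).length).getD i 0 := by
    intro m
    rw [List.map_ofFn]
    induction m with
    | zero => simp
    | succ m ih =>
      intro hm
      rw [List.sum_take_succ _ _ (by simpa using hm), ih (by omega), Finset.sum_range_succ]
      congr 1
      rw [List.getD_eq_getElem _ _ (by simpa using hm)]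
      simp
  have hd := List.drop_sum_flatten (List.ofFn V) e
  rw [hlen e e.2.le] at hd
  rw [List.getD_eq_getElem?_getD, ← List.getElem?_drop, hd,
    List.drop_eq_getElem_cons (by simp), List.flatten_cons, List.getElem?_append_left (by simpa)]
  simp [hr]

theorem loaded_leaderInput {I : Instance (Fin nl) (Fin nf)} {V : Fin nf → List ℝ}
    (hV : I.IsListing V) : Loaded I (I.leaderInput V) := by
  have hlen : ∀ e : Fin nf, (List.ofFn fun e => (V e).length).getD e 0 = (V e).length := by
    intro e
    rw [List.getD_eq_getElem _ _ (by simp)]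
    simp
  refine ⟨rfl, rfl, rfl, fun e => ?_, fun e => ?_, ?_, fun e δ => ?_⟩
  · simp [Instance.leaderInput]
  · simp [Instance.leaderInput]
  · simp only [Instance.leaderInput]
    rw [Finset.sum_range, Instance.numValues]
    refine Finset.sum_congr rfl fun e _ => ?_
    rw [hlen, ← List.toFinset_card_of_nodup (hV e).1]
    congr 1
    ext r
    rw [List.mem_toFinset, (hV e).2]
  · simp only [Instance.leaderInput]
    rw [← (hV e).2, List.mem_iff_getElem, hlen]
    constructor
    · rintro ⟨r, hr, rfl⟩
      exact ⟨r, hr, flatten_ofFn_getD V e hr⟩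
    · rintro ⟨r, hr, rfl⟩
      exact ⟨r, hr, (flatten_ofFn_getD V e hr).symm⟩

theorem loaded_adversaryInput {I : Instance (Fin nl) (Fin nf)} {V : Fin nf → List ℝ}
    (hV : I.IsListing V) (x : Fin nl → ℝ) : Loaded I (I.adversaryInput V x) :=
  (loaded_leaderInput hV).congr rfl rfl rfl rfl rfl

/-! ### The pairs of an item and a value -/

/-- Process the next value in the list of the item `e`: store its owner, and update the minimum and
the maximum. -/
def pairStep : Prog :=
  .setNat 2 (nv 5) (nv 10) ;;
  .branch (.realLt (ra 2 (nv 5)) (ra 5 (nv 10))) (.setReal 5 (nv 10) (ra 2 (nv 5))) .skip ;;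
  .branch (.realLt (ra 6 (nv 10)) (ra 2 (nv 5))) (.setReal 6 (nv 10) (ra 2 (nv 5))) .skip ;;
  .letNat 5 (nv 5 + nc 1)

/-- Process the list of the item `e`. -/
def pairRow : Prog :=
  (.setReal 5 (nv 10) (ra 2 (nv 5)) ;; .setReal 6 (nv 10) (ra 2 (nv 5))) ;;
  .forLoop 11 (na 1 (nv 10)) pairStep

/-- Compute the owners of all values (array `2` of natural numbers), their number (array `5`), and
the minima and maxima (arrays `5` and `6` of real numbers). -/
def pairProg : Prog :=
  .letNat 5 (nc 0) ;; .forLoop 10 (na 0 (nc 1)) pairRow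

/-- The memory contains the results of `pairProg`. -/
structure PairsReady (I : Instance (Fin nl) (Fin nf)) (σ : Store) : Prop where
  hu : σ.nat 5 0 = I.numValues
  own : ∀ p, p < I.numValues → ∃ e : Fin nf, σ.nat 2 p = e ∧ σ.real 2 p ∈ I.U e
  hit : ∀ (e : Fin nf) (δ : ℝ), δ ∈ I.U e → ∃ p, p < I.numValues ∧ σ.nat 2 p = e ∧ σ.real 2 p = δ
  hmin : ∀ e : Fin nf, σ.real 5 e = I.dmin e
  hmax : ∀ e : Fin nf, σ.real 6 e = I.dmax e

theorem runs_pairRow {I : Instance (Fin nl) (Fin nf)} (σ : Store) (h : Loaded I σ) (e : Fin nf)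
    (h10 : σ.nat 10 0 = e) (h5 : σ.nat 5 0 = ∑ i ∈ Finset.range e, σ.nat 1 i) :
    Runs pairRow σ (10 * σ.nat 1 e + 4) fun τ =>
      τ.nat 5 0 = ∑ i ∈ Finset.range (e + 1), σ.nat 1 i ∧
      (∀ p, p < σ.nat 5 0 → τ.nat 2 p = σ.nat 2 p) ∧
      (∀ r, r < σ.nat 1 e → τ.nat 2 (σ.nat 5 0 + r) = e) ∧
      (∀ i, i ≠ (e : ℕ) → τ.real 5 i = σ.real 5 i ∧ τ.real 6 i = σ.real 6 i) ∧
      τ.real 5 e = I.dmin e ∧ τ.real 6 e = I.dmax e := by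
  have hmem := h.mem_iff e
  rw [← h5] at hmem
  set o := σ.nat 5 0 with ho
  -- The list of `e` is nonempty, so its first entry is a legitimate initial value for both the
  -- minimum and the maximum.
  have h0 : σ.real 2 o ∈ I.U e := by
    obtain ⟨δ, hδ⟩ := I.U_nonempty e
    obtain ⟨r, hr, -⟩ := (hmem δ).1 hδ
    exact (hmem _).2 ⟨0, by omega, rfl⟩
  let Inv : ℕ → Store → Prop := fun j τ => τ.nat 5 0 = o + j ∧
    (∀ p, p < o → τ.nat 2 p = σ.nat 2 p) ∧ (∀ r, r < j → τ.nat 2 (o + r) = e) ∧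
    (∀ i, i ≠ (e : ℕ) → τ.real 5 i = σ.real 5 i ∧ τ.real 6 i = σ.real 6 i) ∧
    (τ.real 5 e ∈ I.U e ∧ ∀ r, r < j → τ.real 5 e ≤ σ.real 2 (o + r)) ∧
    (τ.real 6 e ∈ I.U e ∧ ∀ r, r < j → σ.real 2 (o + r) ≤ τ.real 6 e)
  refine Runs.mono (m := 2 + (σ.nat 1 e * (8 + 2) + 2)) ?_ (by omega) fun _ => id
  refine (Runs.of_wp (Q := fun τ => Inv 0 (τ.setNat 11 0 0)) ?_ le_rfl).seq fun τ hu hτ => ?_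
  · simp only [Prog.wp, Inv]
    simp only [NatExpr.eval, RealExpr.eval, ne_eq, Store.real_setNat,
      Store.nat_setNat_of_ne, Function.update_self, Nat.reduceEqDiff, not_false_eq_true, h10,
      Store.nat_setReal, Store.real_setReal_self, Store.real_setReal_of_ne, ← ho]
    refine ⟨rfl, by simp, by simp, fun i hi => ?_, ⟨h0, by simp⟩, h0, by simp⟩
    rw [Function.update_of_ne hi, Function.update_of_ne hi]
    exact ⟨rfl, rfl⟩
  have g1 : τ.nat 1 = σ.nat 1 := hu.nat _ rfl
  have g10 : τ.nat 10 = σ.nat 10 := hu.nat _ rfl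
  have g2 : τ.real 2 = σ.real 2 := hu.real _ rfl
  refine (Runs.forLoop_const (σ.nat 1 e) 8 Inv rfl ?_ hτ ?_).mono le_rfl ?_
  · intro ρ hρ
    have k1 : ρ.nat 1 = τ.nat 1 := hρ.nat _ rfl
    have k10 : ρ.nat 10 = τ.nat 10 := hρ.nat _ rfl
    simp [k1, k10, g1, g10, h10]
  · rintro j ρ hj hρ - ⟨i1, i2, i3, i4, ⟨i5, i6⟩, i7, i8⟩
    have k10 : ρ.nat 10 0 = e := by rw [hρ.nat 10 rfl, g10, h10]
    have k2 : ρ.real 2 = σ.real 2 := (hρ.real _ rfl).trans g2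
    have hj' : σ.real 2 (o + j) ∈ I.U e := (hmem _).2 ⟨j, hj, rfl⟩
    refine Runs.of_wp ?_ (by decide)
    simp only [Prog.wp, pairStep, Inv, Test.Holds, not_le, not_lt]
    simp only [NatExpr.eval, RealExpr.eval, Store.nat_setNat_self, ne_eq, Store.real_setNat,
      Store.nat_setNat_of_ne, Function.update_self, Nat.reduceEqDiff, not_false_eq_true, k10, i1,
      Store.nat_setReal, Store.real_setReal_self, Store.real_setReal_of_ne, k2]
    have c1 : ∀ p, p < o → Function.update (ρ.nat 2) (o + j) (e : ℕ) p = σ.nat 2 p := by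
      intro p hp
      rw [Function.update_of_ne (by omega), i2 p hp]
    have c2 : ∀ r, r < j + 1 → Function.update (ρ.nat 2) (o + j) (e : ℕ) (o + r) = e := by
      intro r hr
      rcases Nat.lt_succ_iff_lt_or_eq.1 hr with h1 | rfl
      · rw [Function.update_of_ne (by omega), i3 r h1]
      · rw [Function.update_self]
    have cmin : ∀ m : ℝ, m ≤ σ.real 2 (o + j) → m ≤ ρ.real 5 e →
        ∀ r, r < j + 1 → m ≤ σ.real 2 (o + r) := by
      intro m hm hm' r hr
      rcases Nat.lt_succ_iff_lt_or_eq.1 hr with h1 | rfl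
      · exact hm'.trans (i6 r h1)
      · exact hm
    have cmax : ∀ m : ℝ, σ.real 2 (o + j) ≤ m → ρ.real 6 e ≤ m →
        ∀ r, r < j + 1 → σ.real 2 (o + r) ≤ m := by
      intro m hm hm' r hr
      rcases Nat.lt_succ_iff_lt_or_eq.1 hr with h1 | rfl
      · exact (i8 r h1).trans hm'
      · exact hm
    refine ⟨fun h1 => ⟨fun h2 => ?_, fun h2 => ?_⟩, fun h1 => ⟨fun h2 => ?_, fun h2 => ?_⟩⟩ <;>
      refine ⟨by omega, c1, c2, fun i hi => ?_, ⟨?_, ?_⟩, ?_, ?_⟩ <;>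
      try simp only [Function.update_self]
    all_goals
      first
      | exact hj'
      | exact i5
      | exact i7
      | exact cmin _ le_rfl h1.le
      | exact cmin _ h1 le_rfl
      | exact cmax _ le_rfl h2.le
      | exact cmax _ h2 le_rfl
      | simpa only [Function.update_of_ne hi] using i4 i hi
  · rintro ρ ⟨-, i1, i2, i3, i4, ⟨i5, i6⟩, i7, i8⟩
    refine ⟨by rw [i1, Finset.sum_range_succ, h5], i2, i3, i4, ?_, ?_⟩
    · refine le_antisymm ?_ (Instance.dmin_le i5)
      obtain ⟨r, hr, hr'⟩ := (hmem _).1 (Instance.dmin_mem (I := I) e)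
      rw [← hr']; exact i6 r hr
    · refine le_antisymm (Instance.le_dmax i7) ?_
      obtain ⟨r, hr, hr'⟩ := (hmem _).1 (Instance.dmax_mem (I := I) e)
      rw [← hr']; exact i8 r hr

/-- The rows have different lengths; since these add up to the number of values, the total time is
linear in it and in `nf`. -/
theorem runs_pairProg {I : Instance (Fin nl) (Fin nf)} (σ : Store) (h : Loaded I σ) :
    Runs pairProg σ (10 * I.numValues + 6 * nf + 3) (PairsReady I) := by
  let Inv : ℕ → Store → Prop := fun j τ => τ.nat 5 0 = ∑ i ∈ Finset.range j, σ.nat 1 i ∧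
    (∀ p, p < ∑ i ∈ Finset.range j, σ.nat 1 i →
      ∃ e : Fin nf, τ.nat 2 p = e ∧ σ.real 2 p ∈ I.U e) ∧
    (∀ (e : Fin nf) (δ : ℝ), (e : ℕ) < j → δ ∈ I.U e →
      ∃ p, p < ∑ i ∈ Finset.range j, σ.nat 1 i ∧ τ.nat 2 p = e ∧ σ.real 2 p = δ) ∧
    ∀ e : Fin nf, (e : ℕ) < j → τ.real 5 e = I.dmin e ∧ τ.real 6 e = I.dmax e
  refine Runs.mono (m := 1 + (∑ j ∈ Finset.range nf, (10 * σ.nat 1 j + 4 + 2) + 2)) ?_ ?_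
    fun _ => id
  swap
  · rw [← h.hsum, Finset.sum_add_distrib, Finset.sum_add_distrib, ← Finset.mul_sum]
    simp only [Finset.sum_const, Finset.card_range, smul_eq_mul]
    omega
  refine (Runs.of_wp (P := .letNat 5 (nc 0)) (Q := fun τ => τ.nat 5 0 = 0) (by simp [Prog.wp])
    le_rfl).seq fun τ hu hτ => ?_
  have g0 : τ.nat 0 = σ.nat 0 := hu.nat _ rfl
  have g1 : τ.nat 1 = σ.nat 1 := hu.nat _ rfl
  have gr : ∀ a, τ.real a = σ.real a := fun a => hu.real a rfl
  refine (Runs.forLoop nf (fun j => 10 * σ.nat 1 j + 4) Inv rfl ?_ ?_ ?_).mono le_rfl ?_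
  · intro ρ hρ
    have k0 : ρ.nat 0 = τ.nat 0 := hρ.nat _ rfl
    simp [k0, g0, h.hnf]
  · simp [Inv, hτ]
  · rintro j ρ hj hρ hρj ⟨i1, i2, i3, i4⟩
    have k1 : ρ.nat 1 = σ.nat 1 := (hρ.nat _ rfl).trans g1
    have k2 : ρ.real 2 = σ.real 2 := (hρ.real _ rfl).trans (gr 2)
    have hl : Loaded I ρ := h.congr ((hρ.nat _ rfl).trans g0) k1
      ((hρ.real _ rfl).trans (gr 0)) ((hρ.real _ rfl).trans (gr 1)) k2
    have hrun := runs_pairRow ρ hl ⟨j, hj⟩ hρj (by rw [i1, k1])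
    rw [k1, i1] at hrun
    refine hrun.mono le_rfl ?_
    rintro ρ' ⟨j1, j2, j3, j4, j5, j6⟩
    simp only [Inv, ne_eq, Nat.reduceEqDiff, not_false_eq_true, Store.nat_setNat_of_ne,
      Store.real_setNat]
    refine ⟨j1, fun p hp => ?_, fun e δ he hδ => ?_, fun e he => ?_⟩
    · rw [Finset.sum_range_succ] at hp
      by_cases h1 : p < ∑ i ∈ Finset.range j, σ.nat 1 i
      · rw [j2 p h1]; exact i2 p h1
      · obtain ⟨r, rfl⟩ := Nat.exists_eq_add_of_le (not_lt.1 h1)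
        exact ⟨⟨j, hj⟩, j3 r (by simpa using hp), (h.mem_iff ⟨j, hj⟩ _).2 ⟨r, by simpa using hp, rfl⟩⟩
    · rw [Finset.sum_range_succ]
      rcases Nat.lt_succ_iff_lt_or_eq.1 he with h1 | h1
      · obtain ⟨p, h2, h3, h4⟩ := i3 e δ h1 hδ
        exact ⟨p, by omega, by rw [j2 p h2, h3], h4⟩
      · obtain ⟨r, hr, hr'⟩ := (h.mem_iff e δ).1 hδ
        rw [h1] at hr hr'
        exact ⟨_, by omega, by rw [j3 r hr, h1], hr'⟩
    · rcases Nat.lt_succ_iff_lt_or_eq.1 he with h1 | h1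
      · rw [(j4 e h1.ne).1, (j4 e h1.ne).2]
        exact i4 e h1
      · obtain rfl : e = ⟨j, hj⟩ := Fin.ext h1
        exact ⟨j5, j6⟩
  · rintro ρ ⟨hρ, i1, i2, i3, i4⟩
    have k2 : ρ.real 2 = σ.real 2 := (hρ.real _ rfl).trans (gr 2)
    rw [h.hsum] at i1 i2 i3
    rw [← k2] at i2 i3
    exact ⟨i1, i2, fun e δ => i3 e δ e.2, fun e => (i4 e e.2).1, fun e => (i4 e e.2).2⟩

/-- The elements of `S` among the first `j` entries of the enumeration `A`. -/
def firstOf {n : ℕ} (A : ℕ → ℕ) (S : Finset (Fin n)) (j : ℕ) : Finset (Fin n) :=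
  S.filter fun i => ∃ q, q < j ∧ A q = i

/-! ### Sets of items enumerated along an array. -/

section FirstOf

variable {n : ℕ} {A : ℕ → ℕ} {S : Finset (Fin n)} {j : ℕ} {i : Fin n}

theorem mem_firstOf : i ∈ firstOf A S j ↔ i ∈ S ∧ ∃ q, q < j ∧ A q = i := by
  simp [firstOf]

theorem firstOf_zero : firstOf A S 0 = ∅ := by
  ext; simp [mem_firstOf]

theorem firstOf_subset : firstOf A S j ⊆ S := Finset.filter_subset _ _

theorem firstOf_all (hA : ∀ v, v < n → ∃ a, a < n ∧ A a = v) : firstOf A S n = S := by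
  ext i
  rw [mem_firstOf]
  exact ⟨fun h => h.1, fun h => ⟨h, hA i i.2⟩⟩

theorem firstOf_succ_of_mem (hi : A j = i) (hS : i ∈ S) :
    firstOf A S (j + 1) = insert i (firstOf A S j) := by
  ext i'
  rw [Finset.mem_insert, mem_firstOf, mem_firstOf]
  constructor
  · rintro ⟨h1, q, h2, h3⟩
    rcases Nat.lt_succ_iff_lt_or_eq.1 h2 with h4 | rfl
    · exact Or.inr ⟨h1, q, h4, h3⟩
    · exact Or.inl (Fin.ext (h3.symm.trans hi))
  · rintro (rfl | ⟨h1, q, h2, h3⟩)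
    · exact ⟨hS, j, by omega, hi⟩
    · exact ⟨h1, q, by omega, h3⟩

theorem firstOf_succ_of_notMem (hi : A j = i) (hS : i ∉ S) :
    firstOf A S (j + 1) = firstOf A S j := by
  ext i'
  rw [mem_firstOf, mem_firstOf]
  constructor
  · rintro ⟨h1, q, h2, h3⟩
    rcases Nat.lt_succ_iff_lt_or_eq.1 h2 with h4 | rfl
    · exact ⟨h1, q, h4, h3⟩
    · exact absurd (Fin.ext (h3.symm.trans hi) ▸ h1) hS
  · rintro ⟨h1, q, h2, h3⟩
    exact ⟨h1, q, by omega, h3⟩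

theorem notMem_firstOf (hA : ∀ q, q < j → A q ≠ A j) (hi : A j = i) : i ∉ firstOf A S j := by
  rw [mem_firstOf]
  rintro ⟨-, q, h1, h2⟩
  exact hA q h1 (h2.trans hi.symm)

end FirstOf

/-- Exchange argument: `S \ X` and `X \ S` have equal cardinality, and the least weight in `X \ S`
separates the two. -/
theorem isSelection_of_le {α : Type*} [DecidableEq α] {E S : Finset α} {w : α → ℝ} (hS : S ⊆ E)
    (h : ∀ s ∈ S, ∀ t ∈ E, t ∉ S → w s ≤ w t) : IsSelection E S.card w S := by
  refine ⟨⟨hS, rfl⟩, fun X hX hc => ?_⟩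
  rw [← Finset.sum_inter_add_sum_sdiff S X, ← Finset.sum_inter_add_sum_sdiff X S,
    Finset.inter_comm X S]
  have hcard : (S \ X).card = (X \ S).card := Finset.card_sdiff_comm hc.symm
  suffices ∑ i ∈ S \ X, w i ≤ ∑ i ∈ X \ S, w i by linarith
  rcases (X \ S).eq_empty_or_nonempty with h0 | h0
  · rw [h0, Finset.card_empty, Finset.card_eq_zero] at hcard
    rw [h0, hcard]
  · obtain ⟨t, ht, hmin⟩ := Finset.exists_min_image _ w h0
    rw [Finset.mem_sdiff] at ht
    have h1 := Finset.sum_le_card_nsmul (S \ X) w (w t) fun s hs =>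
      h s (Finset.mem_sdiff.1 hs).1 t (hX ht.1) ht.2
    have h2 := Finset.card_nsmul_le_sum (X \ S) w (w t) hmin
    rw [hcard] at h1
    exact h1.trans h2

variable {nl nf : ℕ}

namespace Instance

variable {I : Instance (Fin nl) (Fin nf)} {A : ℕ → ℕ} {key : ℕ → ℝ}

/-- The items before `δ` and those around `δ` among the first `j` items. -/
noncomputable def chosen (I : Instance (Fin nl) (Fin nf)) (A : ℕ → ℕ) (e : Fin nf) (δ : ℝ)
    (j : ℕ) : Finset (Fin nf) :=
  I.itemsBefore δ ∪ firstOf A (I.itemsAround e δ) j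

theorem chosen_zero (e : Fin nf) (δ : ℝ) : I.chosen A e δ 0 = I.itemsBefore δ := by
  rw [chosen, firstOf_zero, Finset.union_empty]

theorem chosen_all (hA : IsSorting key A nf) (e : Fin nf) (δ : ℝ) :
    I.chosen A e δ nf = I.itemsBefore δ ∪ I.itemsAround e δ := by
  rw [chosen, firstOf_all hA.hit]

theorem notMem_chosen (hA : IsSorting key A nf) {e i : Fin nf} {δ : ℝ} {j : ℕ} (hj : j < nf)
    (hi : A j = i) (hS : i ∈ I.itemsAround e δ) : i ∉ I.chosen A e δ j := by
  rw [chosen, Finset.mem_union]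
  rintro (h | h)
  · exact Finset.disjoint_left.1 (disjoint_before_around e δ) h hS
  · exact notMem_firstOf (fun q hq h => hq.ne (hA.inj (by omega) hj h)) hi h

theorem chosen_succ_of_mem {e i : Fin nf} {δ : ℝ} {j : ℕ}
    (hi : A j = i) (hS : i ∈ I.itemsAround e δ) :
    I.chosen A e δ (j + 1) = insert i (I.chosen A e δ j) := by
  rw [chosen, firstOf_succ_of_mem hi hS, Finset.union_insert, chosen]

theorem chosen_succ_of_notMem {e i : Fin nf} {δ : ℝ} {j : ℕ}
    (hi : A j = i) (hS : i ∉ I.itemsAround e δ) :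
    I.chosen A e δ (j + 1) = I.chosen A e δ j := by
  rw [chosen, firstOf_succ_of_notMem hi hS, chosen]

theorem chosen_subset (e : Fin nf) (δ : ℝ) (j : ℕ) :
    I.chosen A e δ j ⊆ I.itemsBefore δ ∪ I.itemsAround e δ :=
  Finset.union_subset_union_right firstOf_subset

theorem card_chosen (e : Fin nf) (δ : ℝ) (j : ℕ) : (I.chosen A e δ j).card =
    (I.itemsBefore δ).card + (firstOf A (I.itemsAround e δ) j).card :=
  Finset.card_union_of_disjoint ((disjoint_before_around e δ).mono_right firstOf_subset)

/-- With the items sorted by non-increasing leader's costs, the chosen items are a possible choice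
for the guess. -/
theorem isGuessedSet_chosen (hA : IsSorting key A nf) (hkey : ∀ i : Fin nf, key i = -I.cf i)
    (e : Fin nf) (δ : ℝ) (j : ℕ) :
    I.IsGuessedSet (I.chosen A e δ j).card e δ (I.chosen A e δ j) := by
  refine ⟨firstOf A (I.itemsAround e δ) j, ?_, rfl⟩
  rw [card_chosen, Nat.add_sub_cancel_left]
  refine isSelection_of_le firstOf_subset ?_
  intro s hs t ht ht'
  obtain ⟨-, q, hq, hqs⟩ := mem_firstOf.1 hs
  obtain ⟨r, hr, hrt⟩ := hA.hit t t.2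
  have h1 : j ≤ r := by
    by_contra h
    exact ht' (mem_firstOf.2 ⟨ht, r, not_le.1 h, hrt⟩)
  have := hA.sorted q r (Nat.zero_le _) (by omega) hr
  rwa [hqs, hrt, hkey, hkey] at this

/-- In this form `k` only has to lie between the sizes of the first and of the last set in the scan
of `chosen`. -/
theorem isGuess_iff (e : Fin nf) {δ : ℝ} (hδ : δ ∈ I.U e) (k : ℕ) : I.IsGuess k e δ ↔
    (I.itemsBefore δ).card ≤ k ∧ k ≤ (I.itemsBefore δ ∪ I.itemsAround e δ).card := by
  rw [Finset.card_union_of_disjoint (disjoint_before_around e δ), IsGuess]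
  constructor
  · rintro ⟨-, h1, h2⟩; omega
  · rintro ⟨h1, h2⟩; exact ⟨hδ, h1, by omega⟩

/-- The item `e` is missing from the union, so every admissible `k` is below `nf` and a row of `nf`
cells suffices. -/
theorem card_before_around_lt (e : Fin nf) {δ : ℝ} (hδ : δ ∈ I.U e) :
    (I.itemsBefore δ ∪ I.itemsAround e δ).card < nf := by
  have : e ∉ I.itemsBefore δ ∪ I.itemsAround e δ := by
    rw [Finset.mem_union, mem_itemsBefore, mem_itemsAround]
    rintro (h | h)
    · linarith [le_dmax hδ]
    · exact h.1 rfl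
  simpa using Finset.card_lt_univ_of_notMem this

end Instance

/-! ### The table of the costs of all guessed sets -/

/-- Record the cost of the current set. -/
def tableEntry : Prog :=
  .setNat 4 (nv 12 + nv 14) (nc 1) ;; .setReal 7 (nv 12 + nv 14) (rv 11)

/-- Count the item `i = 11` if it precedes the reference value. -/
def countBefore : Prog :=
  .branch (.realLt (ra 6 (nv 11)) (rv 10))
    (.letNat 14 (nv 14 + nc 1) ;; .letReal 11 (rv 11 + ra 1 (nv 11))) .skip

/-- The item with the number `15` belongs to the items around the reference value. -/
def aroundTest : Test :=
  .and (.not (.and (.natLe (nv 15) (nv 13)) (.natLe (nv 13) (nv 15))))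
    (.and (.realLe (ra 5 (nv 15)) (rv 10)) (.realLe (rv 10) (ra 6 (nv 15))))

/-- Add the next item in the order of non-increasing costs to the current set. -/
def tableStep : Prog :=
  .letNat 15 (na 3 (nv 11)) ;;
  .branch aroundTest
    (.letNat 14 (nv 14 + nc 1) ;; .letReal 11 (rv 11 + ra 1 (nv 15)) ;; tableEntry) .skip

/-- Fill the row of the pair with the number `10`. The row begins in the cell `12`. -/
def tableRow : Prog :=
  (.setNat 6 (nv 10) (nv 12) ;; .letNat 13 (na 2 (nv 10)) ;; .letReal 10 (ra 2 (nv 10)) ;;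
    .letNat 14 (nc 0) ;; .letReal 11 (rn (nc 0))) ;;
  .forLoop 11 (na 0 (nc 1)) countBefore ;;
  tableEntry ;;
  .forLoop 11 (na 0 (nc 1)) tableStep ;;
  .letNat 12 (nv 12 + na 0 (nc 1))

/-- Fill the table: for each pair and each `k`, the array `4` of natural numbers indicates whether
the guess is considered, and the array `7` of real numbers holds the cost of the guessed set. The
array `6` of natural numbers holds the beginnings of the rows. -/
def tableProg : Prog :=
  .letNat 12 (nc 0) ;; .forLoop 10 (nv 5) tableRow

/-- The row of the table that begins in the cell `o` is correct for the guess `(e, δ)`. -/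
def RowReady (I : Instance (Fin nl) (Fin nf)) (σ : Store) (e : Fin nf) (δ : ℝ) (o : ℕ) : Prop :=
  ∀ k, k < nf → (σ.nat 4 (o + k) = 1 ↔ I.IsGuess k e δ) ∧
    (I.IsGuess k e δ → ∃ Y, I.IsGuessedSet k e δ Y ∧ σ.real 7 (o + k) = ∑ i ∈ Y, I.cf i)

/-- The invariant for the contents of a row. -/
def RowInv (I : Instance (Fin nl) (Fin nf)) (σ τ : Store) (e : Fin nf) (δ : ℝ) (o : ℕ)
    (Y : Finset (Fin nf)) : Prop :=
  τ.nat 14 0 = Y.card ∧ τ.real 11 0 = ∑ i ∈ Y, I.cf i ∧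
    (∀ q, (q < o ∨ o + nf ≤ q) → τ.nat 4 q = σ.nat 4 q ∧ τ.real 7 q = σ.real 7 q) ∧
    ∀ k, k < nf → (τ.nat 4 (o + k) = 1 ↔ (I.itemsBefore δ).card ≤ k ∧ k ≤ Y.card) ∧
      ((I.itemsBefore δ).card ≤ k → k ≤ Y.card →
        ∃ Y', I.IsGuessedSet k e δ Y' ∧ τ.real 7 (o + k) = ∑ i ∈ Y', I.cf i)

theorem runs_countBefore {I : Instance (Fin nl) (Fin nf)} (σ : Store) (hl : Loaded I σ)
    (hp : PairsReady I σ) (h14 : σ.nat 14 0 = 0) (h11 : σ.real 11 0 = 0) :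
    Runs (.forLoop 11 (na 0 (nc 1)) countBefore) σ (6 * nf + 2) fun τ =>
      τ.nat 14 0 = (I.itemsBefore (σ.real 10 0)).card ∧
      τ.real 11 0 = ∑ i ∈ I.itemsBefore (σ.real 10 0), I.cf i := by
  refine (Runs.forLoop_const nf 4 (fun j τ =>
    τ.nat 14 0 = (firstOf id (I.itemsBefore (σ.real 10 0)) j).card ∧
    τ.real 11 0 = ∑ i ∈ firstOf id (I.itemsBefore (σ.real 10 0)) j, I.cf i) rfl ?_ ?_
    ?_).mono (by omega) ?_
  · intro τ hτ
    have h0 : τ.nat 0 = σ.nat 0 := hτ.nat _ rfl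
    simp [h0, hl.hnf]
  · simp [firstOf_zero, h14, h11]
  · rintro j τ hj hτ hτj ⟨i1, i2⟩
    have k6 : τ.real 6 = σ.real 6 := hτ.real _ rfl
    have k1 : τ.real 1 = σ.real 1 := hτ.real _ rfl
    have k10 : τ.real 10 = σ.real 10 := hτ.real _ rfl
    have hmax := hp.hmax ⟨j, hj⟩
    have hcf := hl.hcf ⟨j, hj⟩
    dsimp only at hmax hcf
    refine Runs.of_wp ?_ (by decide)
    simp only [Prog.wp, countBefore, Test.Holds, not_le, not_lt]
    simp only [NatExpr.eval, RealExpr.eval, Store.nat_setNat_self, ne_eq, Store.real_setNat,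
      Store.nat_setNat_of_ne, Function.update_self, Nat.reduceEqDiff, not_false_eq_true, hτj,
      Store.nat_setReal, Store.real_setReal_self, k6, k10, hmax, k1, hcf, i1, i2]
    constructor
    · intro h
      have hm : (⟨j, hj⟩ : Fin nf) ∈ I.itemsBefore (σ.real 10 0) := Instance.mem_itemsBefore.2 h
      have hn : (⟨j, hj⟩ : Fin nf) ∉ firstOf id (I.itemsBefore (σ.real 10 0)) j :=
        notMem_firstOf (fun q hq => hq.ne) rfl
      rw [firstOf_succ_of_mem (i := ⟨j, hj⟩) rfl hm, Finset.card_insert_of_notMem hn,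
        Finset.sum_insert hn]
      exact ⟨rfl, add_comm _ _⟩
    · intro h
      have hm : (⟨j, hj⟩ : Fin nf) ∉ I.itemsBefore (σ.real 10 0) := fun h' =>
        absurd (Instance.mem_itemsBefore.1 h') (not_lt.2 h)
      rw [firstOf_succ_of_notMem (i := ⟨j, hj⟩) rfl hm]
      exact ⟨rfl, rfl⟩
  · rintro τ ⟨-, h1, h2⟩
    rw [firstOf_all (A := id) fun v hv => ⟨v, hv, rfl⟩] at h1 h2
    exact ⟨h1, h2⟩

/-- Writing the cell with offset `Y'.card` extends the row by one size; all other cells must be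
right already. -/
theorem RowInv.entry {I : Instance (Fin nl) (Fin nf)} {σ τ : Store} {e : Fin nf} {δ : ℝ} {o : ℕ}
    {Y' : Finset (Fin nf)} (hcard : Y'.card < nf)
    (hY' : I.IsGuessedSet Y'.card e δ Y') (hB : (I.itemsBefore δ).card ≤ Y'.card)
    (h14 : τ.nat 14 0 = Y'.card) (h11 : τ.real 11 0 = ∑ i ∈ Y', I.cf i) (h12 : τ.nat 12 0 = o)
    (hout : ∀ q, (q < o ∨ o + nf ≤ q) → τ.nat 4 q = σ.nat 4 q ∧ τ.real 7 q = σ.real 7 q)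
    (hin : ∀ k, k < nf → k ≠ Y'.card → (τ.nat 4 (o + k) = 1 ↔ (I.itemsBefore δ).card ≤ k ∧
      k ≤ Y'.card) ∧ ((I.itemsBefore δ).card ≤ k → k ≤ Y'.card →
        ∃ Y', I.IsGuessedSet k e δ Y' ∧ τ.real 7 (o + k) = ∑ i ∈ Y', I.cf i)) :
    tableEntry.wp (fun τ' => RowInv I σ τ' e δ o Y') τ := by
  simp only [Prog.wp, tableEntry, RowInv]
  simp only [NatExpr.eval, RealExpr.eval, Store.nat_setNat_self, ne_eq, Store.real_setNat,
      Store.nat_setNat_of_ne, Nat.reduceEqDiff, not_false_eq_true,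
      Store.nat_setReal, Store.real_setReal_self, Store.real_setReal_of_ne, h14, h12, h11, true_and]
  refine ⟨fun q hq => ?_, fun k hk => ?_⟩
  · rw [Function.update_of_ne (by omega), Function.update_of_ne (by omega)]
    exact hout q hq
  · by_cases h : k = Y'.card
    · subst h
      rw [Function.update_self, Function.update_self]
      exact ⟨⟨fun _ => ⟨hB, le_rfl⟩, fun _ => rfl⟩, fun _ _ => ⟨Y', hY', rfl⟩⟩
    · rw [Function.update_of_ne (by omega), Function.update_of_ne (by omega)]
      exact hin k hk h

/-- The current set starts with the items before δ and grows by single items in the order of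
non-increasing cost. By `isGuessedSet_chosen` it is a guessed set for its own size at every moment,
so a single scan serves all `k`. -/
theorem runs_tableRow {I : Instance (Fin nl) (Fin nf)} (σ : Store) (hl : Loaded I σ)
    (hp : PairsReady I σ) (hs : IsSorting (fun i => -σ.real 1 i) (σ.nat 3) nf) {p o : ℕ}
    {e : Fin nf} {δ : ℝ} (h10 : σ.nat 10 0 = p) (he : σ.nat 2 p = e) (hδ : σ.real 2 p = δ)
    (hmem : δ ∈ I.U e) (h12 : σ.nat 12 0 = o) (hfresh : ∀ q, o ≤ q → σ.nat 4 q = 0) :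
    Runs tableRow σ (18 * nf + 12) fun τ =>
      τ.nat 12 0 = o + nf ∧ τ.nat 6 = Function.update (σ.nat 6) p o ∧ RowReady I τ e δ o ∧
      ∀ q, (q < o ∨ o + nf ≤ q) → τ.nat 4 q = σ.nat 4 q ∧ τ.real 7 q = σ.real 7 q := by
  refine Runs.mono (m := 5 + (6 * nf + 2 + (2 + (nf * (10 + 2) + 2 + 1)))) ?_ (by omega) fun _ => id
  have hlt := I.card_before_around_lt e hmem
  have hkey : ∀ i : Fin nf, -σ.real 1 i = -I.cf i := fun i => by rw [hl.hcf]
  refine (Runs.of_wp (Q := fun τ => τ.nat 6 = Function.update (σ.nat 6) p o ∧ τ.nat 13 0 = e ∧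
    τ.real 10 0 = δ ∧ τ.nat 14 0 = 0 ∧ τ.real 11 0 = 0) ?_ le_rfl).seq fun τ₁ u₁ q₁ => ?_
  · simp [Prog.wp, h10, h12, he, hδ]
  obtain ⟨a6, a13, a10, a14, a11⟩ := q₁
  have hl₁ : Loaded I τ₁ := hl.congr (u₁.nat _ rfl) (u₁.nat _ rfl) (u₁.real _ rfl) (u₁.real _ rfl)
    (u₁.real _ rfl)
  have hp₁ : PairsReady I τ₁ := by
    obtain ⟨b1, b2, b3, b4, b5⟩ := hp
    have c1 : τ₁.nat 5 = σ.nat 5 := u₁.nat _ rfl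
    have c2 : τ₁.nat 2 = σ.nat 2 := u₁.nat _ rfl
    have c3 : τ₁.real 2 = σ.real 2 := u₁.real _ rfl
    have c4 : τ₁.real 5 = σ.real 5 := u₁.real _ rfl
    have c5 : τ₁.real 6 = σ.real 6 := u₁.real _ rfl
    constructor <;> simpa only [c1, c2, c3, c4, c5]
  refine (runs_countBefore τ₁ hl₁ hp₁ a14 a11).seq fun τ₂ u₂ q₂ => ?_
  rw [a10] at q₂
  have hnat : ∀ a, a ≠ 6 → a ≠ 13 → a ≠ 14 → a ≠ 11 → τ₂.nat a = σ.nat a := by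
    intro a h1 h2 h3 h4
    rw [u₂.nat a, u₁.nat a] <;>
      simp [Prog.forLoop, Prog.writesNat, countBefore, h1.symm, h2.symm, h3.symm, h4.symm]
  have hreal : ∀ a, a ≠ 10 → a ≠ 11 → τ₂.real a = σ.real a := by
    intro a h1 h2
    rw [u₂.real a, u₁.real a] <;>
      simp [Prog.forLoop, Prog.writesReal, countBefore, h1.symm, h2.symm]
  have hset := I.isGuessedSet_chosen hs hkey e δ
  have hz := I.chosen_zero (A := σ.nat 3) e δ
  have hcl : ∀ j, (I.chosen (σ.nat 3) e δ j).card < nf := fun j =>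
    (Finset.card_le_card (I.chosen_subset e δ j)).trans_lt hlt
  refine (Runs.of_wp (Q := fun τ => RowInv I σ τ e δ o (I.chosen (σ.nat 3) e δ 0)) ?_
    le_rfl).seq fun τ₃ u₃ q₃ => ?_
  · refine RowInv.entry (hcl 0) (hset 0)
      (by rw [hz]) (by rw [hz, q₂.1]) (by rw [hz, q₂.2])
      (by rw [hnat 12 (by decide) (by decide) (by decide) (by decide), h12]) ?_ ?_
    · intro q _
      rw [hnat 4 (by decide) (by decide) (by decide) (by decide), hreal 7 (by decide) (by decide)]
      exact ⟨rfl, rfl⟩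
    -- The cells ahead are still zero, which the table reads as "not admissible"; this is why the
    -- array has to be fresh.
    · intro k hk hne
      rw [hz] at hne ⊢
      rw [hnat 4 (by decide) (by decide) (by decide) (by decide), hfresh _ (by omega)]
      exact ⟨by omega, by omega⟩
  refine (Runs.forLoop_const nf 10 (fun j τ => RowInv I σ τ e δ o (I.chosen (σ.nat 3) e δ j)) rfl
    ?_ ?_ ?_).seq fun τ₄ _ q₄ => ?_
  · intro τ hτ
    have h0 : τ.nat 0 = σ.nat 0 := (hτ.nat _ rfl).trans ((u₃.nat _ rfl).trans
      (hnat 0 (by decide) (by decide) (by decide) (by decide)))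
    simp [h0, hl.hnf]
  · simpa [RowInv] using q₃
  · rintro j τ hj hτ hτj ⟨i1, i2, i3, i4⟩
    have k3 : τ.nat 3 = σ.nat 3 := (hτ.nat _ rfl).trans ((u₃.nat _ rfl).trans
      (hnat 3 (by decide) (by decide) (by decide) (by decide)))
    have k13 : τ.nat 13 0 = e := by
      rw [hτ.nat 13 rfl, u₃.nat 13 rfl, u₂.nat 13 rfl, a13]
    have k12 : τ.nat 12 0 = o := by
      rw [hτ.nat 12 rfl, u₃.nat 12 rfl, hnat 12 (by decide) (by decide) (by decide) (by decide),
        h12]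
    have k10 : τ.real 10 0 = δ := by
      rw [hτ.real 10 rfl, u₃.real 10 rfl, u₂.real 10 rfl, a10]
    have k5 : τ.real 5 = σ.real 5 := (hτ.real _ rfl).trans ((u₃.real _ rfl).trans
      (hreal 5 (by decide) (by decide)))
    have k6 : τ.real 6 = σ.real 6 := (hτ.real _ rfl).trans ((u₃.real _ rfl).trans
      (hreal 6 (by decide) (by decide)))
    have k1 : τ.real 1 = σ.real 1 := (hτ.real _ rfl).trans ((u₃.real _ rfl).trans
      (hreal 1 (by decide) (by decide)))
    obtain ⟨i, hi⟩ : ∃ i : Fin nf, σ.nat 3 j = i := ⟨⟨_, hs.lt hj⟩, rfl⟩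
    have hmin := hp.hmin i
    have hmax := hp.hmax i
    have hcf := hl.hcf i
    have hiff : aroundTest.Holds (τ.setNat 15 0 i) ↔ i ∈ I.itemsAround e δ := by
      rw [Instance.mem_itemsAround, ne_eq, ← Fin.val_inj]
      simp [aroundTest, k13, k10, k5, k6, hmin, hmax, le_antisymm_iff]
    refine Runs.of_wp ?_ (by decide)
    simp only [tableStep, Prog.wp]
    simp only [NatExpr.eval, hτj, k3, hi, hiff]
    constructor
    · intro h
      have hn := I.notMem_chosen hs hj hi h
      have hc : (I.chosen (σ.nat 3) e δ (j + 1)).card = (I.chosen (σ.nat 3) e δ j).card + 1 := by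
        rw [Instance.chosen_succ_of_mem hi h, Finset.card_insert_of_notMem hn]
      have hB : (I.itemsBefore δ).card ≤ (I.chosen (σ.nat 3) e δ j).card :=
        Finset.card_le_card Finset.subset_union_left
      have := RowInv.entry (σ := σ) (τ := ((τ.setNat 15 0 i).setNat 14 0
        (τ.nat 14 0 + 1)).setReal 11 0 (τ.real 11 0 + I.cf i)) (o := o) (hcl (j + 1))
        (hset (j + 1)) (by omega) (by simp [i1, hc])
        (by simp [i2, Instance.chosen_succ_of_mem hi h, Finset.sum_insert hn, add_comm])
        (by simp [k12]) (by simpa using i3) ?_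
      · simpa [tableEntry, Prog.wp, k1, hcf, RowInv] using this
      · intro k hk hne
        have := i4 k hk
        simp only [ne_eq, Nat.reduceEqDiff, not_false_eq_true, Store.nat_setReal,
          Store.nat_setNat_of_ne, Store.real_setReal_of_ne, Store.real_setNat]
        rw [hc] at hne ⊢
        refine ⟨this.1.trans ?_, fun h1 h2 => this.2 h1 (by omega)⟩
        omega
    · intro h
      rw [Instance.chosen_succ_of_notMem hi h]
      simpa [RowInv] using ⟨i1, i2, i3, i4⟩
  · obtain ⟨hτ, i1, i2, i3, i4⟩ := q₄
    have k0 : τ₄.nat 0 = σ.nat 0 := (hτ.nat _ rfl).trans ((u₃.nat _ rfl).trans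
      (hnat 0 (by decide) (by decide) (by decide) (by decide)))
    have k12 : τ₄.nat 12 0 = o := by
      rw [hτ.nat 12 rfl, u₃.nat 12 rfl, hnat 12 (by decide) (by decide) (by decide) (by decide),
        h12]
    have k6 : τ₄.nat 6 = Function.update (σ.nat 6) p o := by
      rw [hτ.nat 6 rfl, u₃.nat 6 rfl, u₂.nat 6 rfl, a6]
    refine Runs.of_wp ?_ le_rfl
    refine ⟨by simp [k0, k12, hl.hnf], by simp [k6], ?_, by simpa using i3⟩
    intro k hk
    rw [I.isGuess_iff e hmem, ← I.chosen_all hs]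
    have := i4 k hk
    simp only [ne_eq, Nat.reduceEqDiff, not_false_eq_true,
          Store.nat_setNat_of_ne, Store.real_setNat]
    exact ⟨this.1, fun h => this.2 h.1 h.2⟩

/-- The memory contains the table. -/
structure TableReady (I : Instance (Fin nl) (Fin nf)) (σ : Store) : Prop where
  start : ∀ p, p < I.numValues → σ.nat 6 p = p * nf
  row : ∀ p, p < I.numValues → ∀ e : Fin nf, σ.nat 2 p = e →
    RowReady I σ e (σ.real 2 p) (p * nf)

/-- The machine cannot multiply natural numbers, so the beginning `p * nf` of a row is obtained by
repeated addition and stored. -/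
theorem runs_tableProg {I : Instance (Fin nl) (Fin nf)} (σ : Store) (hl : Loaded I σ)
    (hp : PairsReady I σ) (hs : IsSorting (fun i => -σ.real 1 i) (σ.nat 3) nf)
    (hfresh : ∀ q, σ.nat 4 q = 0) :
    Runs tableProg σ (I.numValues * (18 * nf + 14) + 3) (TableReady I) := by
  refine Runs.mono (m := 1 + (I.numValues * (18 * nf + 12 + 2) + 2)) ?_
    (by rw [show 18 * nf + 12 + 2 = 18 * nf + 14 by rfl]; omega) fun _ => id
  refine (Runs.of_wp (P := .letNat 12 (nc 0)) (Q := fun τ => τ.nat 12 0 = 0) (by simp [Prog.wp])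
    le_rfl).seq fun τ u q => ?_
  refine (Runs.forLoop_const I.numValues (18 * nf + 12) (fun j τ => τ.nat 12 0 = j * nf ∧
    (∀ q, j * nf ≤ q → τ.nat 4 q = 0) ∧ (∀ p, p < j → τ.nat 6 p = p * nf) ∧
    ∀ p, p < j → ∀ e : Fin nf, σ.nat 2 p = e → RowReady I τ e (σ.real 2 p) (p * nf)) rfl ?_ ?_
    ?_).mono le_rfl ?_
  · intro ρ hρ
    have h0 : ρ.nat 5 = σ.nat 5 := (hρ.nat _ rfl).trans (u.nat _ rfl)
    simp [h0, hp.hu]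
  · have k4 : τ.nat 4 = σ.nat 4 := u.nat _ rfl
    simp [q, k4, hfresh]
  · rintro p ρ hpu hρ hρp ⟨i1, i2, i3, i4⟩
    have hl' : Loaded I ρ := hl.congr ((hρ.nat _ rfl).trans (u.nat _ rfl))
      ((hρ.nat _ rfl).trans (u.nat _ rfl)) ((hρ.real _ rfl).trans (u.real _ rfl))
      ((hρ.real _ rfl).trans (u.real _ rfl)) ((hρ.real _ rfl).trans (u.real _ rfl))
    have c1 : ρ.nat 5 = σ.nat 5 := (hρ.nat _ rfl).trans (u.nat _ rfl)
    have c2 : ρ.nat 2 = σ.nat 2 := (hρ.nat _ rfl).trans (u.nat _ rfl)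
    have c3 : ρ.real 2 = σ.real 2 := (hρ.real _ rfl).trans (u.real _ rfl)
    have c4 : ρ.real 5 = σ.real 5 := (hρ.real _ rfl).trans (u.real _ rfl)
    have c5 : ρ.real 6 = σ.real 6 := (hρ.real _ rfl).trans (u.real _ rfl)
    have c6 : ρ.nat 3 = σ.nat 3 := (hρ.nat _ rfl).trans (u.nat _ rfl)
    have c7 : ρ.real 1 = σ.real 1 := (hρ.real _ rfl).trans (u.real _ rfl)
    have hp' : PairsReady I ρ := by
      obtain ⟨b1, b2, b3, b4, b5⟩ := hp
      constructor <;> simpa only [c1, c2, c3, c4, c5]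
    obtain ⟨e, he, hmem⟩ := hp.own p hpu
    refine (runs_tableRow ρ hl' hp' (by rw [c7, c6]; exact hs) hρp (by rw [c2, he]) (by rw [c3])
      hmem i1 i2).mono le_rfl ?_
    rintro ρ' ⟨j1, j2, j3, j4⟩
    have hmul : (p + 1) * nf = p * nf + nf := by rw [add_mul, one_mul]
    simp only [ne_eq, Nat.reduceEqDiff, not_false_eq_true,
          Store.nat_setNat_of_ne]
    refine ⟨by rw [j1, hmul], fun q hq => ?_, fun p' hp' => ?_, fun p' hp' e' he' => ?_⟩
    · rw [(j4 q (Or.inr (by omega))).1, i2 q (by omega)]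
    · rw [j2, Function.update_apply]
      split_ifs with h
      · rw [h]
      · exact i3 p' (by omega)
    · rcases Nat.lt_succ_iff_lt_or_eq.1 hp' with h | rfl
      · intro k hk
        have h1 : (p' + 1) * nf ≤ p * nf := Nat.mul_le_mul_right _ h
        rw [add_mul, one_mul] at h1
        have h2 := j4 (p' * nf + k) (Or.inl (by omega))
        simp only [ne_eq, Nat.reduceEqDiff, not_false_eq_true,
          Store.nat_setNat_of_ne, Store.real_setNat]
        rw [h2.1, h2.2]
        exact i4 p' h e' he' k hk
      · obtain rfl : e = e' := Fin.ext (he.symm.trans he')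
        intro k hk
        simpa using j3 k hk
  · rintro ρ ⟨hρ, -, -, i3, i4⟩
    have c2 : ρ.nat 2 = σ.nat 2 := (hρ.nat _ rfl).trans (u.nat _ rfl)
    have c3 : ρ.real 2 = σ.real 2 := (hρ.real _ rfl).trans (u.real _ rfl)
    exact ⟨i3, by rw [c2, c3]; exact i4⟩

variable {nl nf : ℕ}

/-! ### The preparation that both algorithms share -/

/-- Compute the pairs, sort the follower's items by non-increasing leader's costs and fill the
table. -/
def prepProg : Prog :=
  pairProg ;; sortBy (na 0 (nc 1)) (rn (nc 0) - ra 1 (nv 10)) 3 ;; tableProg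

/-- The memory contains the results of `prepProg`. -/
structure Prepared (I : Instance (Fin nl) (Fin nf)) (σ : Store) : Prop where
  loaded : Loaded I σ
  pairs : PairsReady I σ
  sorting : IsSorting (fun i => -σ.real 1 i) (σ.nat 3) nf
  table : TableReady I σ

/-- A bound on the running time of `prepProg`. -/
def prepTime (nf u : ℕ) : ℕ := 18 * (nf * u) + 24 * u + 6 * nf + sortTime nf + 6

theorem PairsReady.congr {I : Instance (Fin nl) (Fin nf)} {σ τ : Store} (h : PairsReady I σ)
    (h0 : τ.nat 5 = σ.nat 5) (h1 : τ.nat 2 = σ.nat 2) (h2 : τ.real 2 = σ.real 2)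
    (h3 : τ.real 5 = σ.real 5) (h4 : τ.real 6 = σ.real 6) : PairsReady I τ := by
  obtain ⟨a, b, c, d, e⟩ := h
  constructor <;> simpa only [h0, h1, h2, h3, h4]

theorem TableReady.congr {I : Instance (Fin nl) (Fin nf)} {σ τ : Store} (h : TableReady I σ)
    (h0 : τ.nat 6 = σ.nat 6) (h1 : τ.nat 2 = σ.nat 2) (h2 : τ.real 2 = σ.real 2)
    (h3 : τ.nat 4 = σ.nat 4) (h4 : τ.real 7 = σ.real 7) : TableReady I τ := by
  obtain ⟨a, b⟩ := h
  unfold RowReady at b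
  constructor
  · simpa only [h0]
  · unfold RowReady
    simpa only [h1, h2, h3, h4]

/-- The real arrays `3` and `4`, the leader's solution and the output, are exempt because the
prepared data do not involve them. -/
theorem Prepared.congr {I : Instance (Fin nl) (Fin nf)} {σ τ : Store} (h : Prepared I σ)
    (hn : ∀ a, a < 7 → τ.nat a = σ.nat a)
    (hr : ∀ a, a < 8 → a ≠ 3 → a ≠ 4 → τ.real a = σ.real a) :
    Prepared I τ := by
  have r1 := hr 1 (by decide) (by decide) (by decide)
  have r2 := hr 2 (by decide) (by decide) (by decide)
  refine ⟨h.loaded.congr (hn 0 (by decide)) (hn 1 (by decide)) (hr 0 (by decide) (by decide)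
    (by decide)) r1 r2,
    h.pairs.congr (hn 5 (by decide)) (hn 2 (by decide)) r2 (hr 5 (by decide) (by decide)
    (by decide)) (hr 6 (by decide) (by decide) (by decide)), ?_,
    h.table.congr (hn 6 (by decide)) (hn 2 (by decide)) r2 (hn 4 (by decide))
    (hr 7 (by decide) (by decide) (by decide))⟩
  rw [r1, hn 3 (by decide)]
  exact h.sorting

theorem runs_prepProg {I : Instance (Fin nl) (Fin nf)} (σ : Store) (hl : Loaded I σ)
    (hfresh : ∀ q, σ.nat 4 q = 0) : Runs prepProg σ (prepTime nf I.numValues) (Prepared I) := by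
  refine Runs.mono (m := 10 * I.numValues + 6 * nf + 3 + (sortTime nf +
    (I.numValues * (18 * nf + 14) + 3))) ?_ ?_ fun _ => id
  swap
  · have : I.numValues * (18 * nf + 14) = 18 * (nf * I.numValues) + 14 * I.numValues := by ring
    rw [prepTime, this]; omega
  refine (runs_pairProg σ hl).seq fun τ u hp => ?_
  have hl' : Loaded I τ := hl.congr (u.nat _ rfl) (u.nat _ rfl) (u.real _ rfl) (u.real _ rfl)
    (u.real _ rfl)
  refine (runs_sortBy τ (N := nf) (K := fun i => -τ.real 1 i) (by decide)
    (by simp [hl'.hnf]) ?_).seq fun τ' u' hs => ?_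
  · intro j ρ _ _ hr hj
    simp [hj, hr 1 (by decide)]
  have hl'' : Loaded I τ' := hl'.congr (u'.nat _ rfl) (u'.nat _ rfl) (u'.real _ rfl)
    (u'.real _ rfl) (u'.real _ rfl)
  have hp' : PairsReady I τ' := hp.congr (u'.nat _ rfl) (u'.nat _ rfl) (u'.real _ rfl)
    (u'.real _ rfl) (u'.real _ rfl)
  have hs' : IsSorting (fun i => -τ'.real 1 i) (τ'.nat 3) nf := by
    rwa [u'.real 1 rfl]
  have h4 : τ'.nat 4 = σ.nat 4 := (u'.nat _ rfl).trans (u.nat _ rfl)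
  refine (runs_tableProg τ' hl'' hp' hs' (by rw [h4]; exact hfresh)).frame.mono le_rfl ?_
  rintro ρ ⟨v, ht⟩
  exact ⟨hl''.congr (v.nat _ rfl) (v.nat _ rfl) (v.real _ rfl) (v.real _ rfl) (v.real _ rfl),
    hp'.congr (v.nat _ rfl) (v.nat _ rfl) (v.real _ rfl) (v.real _ rfl) (v.real _ rfl),
    by rw [v.real 1 rfl, v.nat 3 rfl]; exact hs',
    ht.congr rfl rfl rfl rfl rfl⟩

/-! ### The adversary's program -/

/-- The guess of the pair with the number `p` is considered, `k` being in the variable `30`. -/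
def okTest (p : NatExpr) : Test :=
  .and (.natLe (nc 1) (na 4 (na 6 p + nv 30))) (.natLe (na 4 (na 6 p + nv 30)) (nc 1))

/-- Compare the guess with the number `10` with the best one so far. -/
def bestStep : Prog :=
  .branch (okTest (nv 10))
    (.letReal 33 (ra 7 (na 6 (nv 10) + nv 30) + ra 1 (na 2 (nv 10)) * rv 32) ;;
      .branch (.or (.natLe (nv 32) (nc 0)) (.realLt (rv 31) (rv 33)))
        (.letReal 31 (rv 33) ;; .letNat 31 (nv 10) ;; .letNat 32 (nc 1)) .skip)
    .skip

/-- Find a guess of maximum value. Its number is stored in the variable `31`. -/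
def bestProg : Prog :=
  .letNat 32 (nc 0) ;; .forLoop 10 (nv 5) bestStep

/-- Write the value of the item `11` that it has apart from the items around the reference
value. -/
def rebuildBefore : Prog :=
  .branch (.realLt (ra 6 (nv 11)) (rv 10))
    (.setReal 4 (nv 11) (ra 5 (nv 11)) ;; .letNat 14 (nv 14 + nc 1))
    (.setReal 4 (nv 11) (ra 6 (nv 11)))

/-- Add the next item in the order of non-increasing costs unless there are `k` items. -/
def rebuildAround : Prog :=
  .letNat 15 (na 3 (nv 11)) ;;
  .branch (.and aroundTest (.natLt (nv 14) (nv 30)))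
    (.setReal 4 (nv 15) (ra 5 (nv 15)) ;; .letNat 14 (nv 14 + nc 1)) .skip

/-- Write the scenario for the guess with the number `31`. -/
def rebuildProg : Prog :=
  (.letNat 13 (na 2 (nv 31)) ;; .letReal 10 (ra 2 (nv 31)) ;; .letNat 14 (nc 0)) ;;
  .forLoop 11 (na 0 (nc 1)) rebuildBefore ;;
  .forLoop 11 (na 0 (nc 1)) rebuildAround ;;
  .setReal 4 (nv 13) (rv 10)

/-- Compute the integral part `k` of the follower's capacity. -/
def floorProg : Prog :=
  .letNat 30 (nc 0) ;; .loop (.realLe (rn (nv 30 + nc 1)) (rv 30)) (.letNat 30 (nv 30 + nc 1))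

/-- Compute the follower's capacity. -/
def capacityProg : Prog :=
  .letReal 30 (rn (na 0 (nc 2))) ;;
  .forLoop 10 (na 0 (nc 0)) (.letReal 30 (rv 30 - ra 3 (nv 10)))

/-- The program for the adversary's problem. -/
def adversaryProg : Prog :=
  prepProg ;; capacityProg ;;
  .branch (.or (.realLe (rv 30) (rn (nc 0))) (.realLe (rn (na 0 (nc 1))) (rv 30)))
    (.forLoop 10 (na 0 (nc 1)) (.setReal 4 (nv 10) (ra 5 (nv 10))))
    (floorProg ;; .letReal 32 (rv 30 - rn (nv 30)) ;; bestProg ;; rebuildProg)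

theorem runs_capacityProg {I : Instance (Fin nl) (Fin nf)} (σ : Store) (hl : Loaded I σ)
    {x : Fin nl → ℝ} (hx : ∀ i : Fin nl, σ.real 3 i = x i) :
    Runs capacityProg σ (3 * nl + 3) fun τ => τ.real 30 0 = I.b - ∑ e, x e := by
  refine Runs.mono (m := 1 + (nl * (1 + 2) + 2)) ?_ (by omega) fun _ => id
  refine (Runs.of_wp (P := .letReal 30 (rn (na 0 (nc 2)))) (Q := fun τ => τ.real 30 0 = I.b)
    (by simp [Prog.wp, hl.hb]) le_rfl).seq fun τ u q => ?_
  refine (Runs.forLoop_const nl 1 (fun j τ => τ.real 30 0 =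
    I.b - ∑ i ∈ Finset.range j, σ.real 3 i) rfl ?_ (by simp [q]) ?_).mono le_rfl ?_
  · intro ρ hρ
    have h0 : ρ.nat 0 = σ.nat 0 := (hρ.nat _ rfl).trans (u.nat _ rfl)
    simp [h0, hl.hnl]
  · intro j ρ hj hρ hρj h
    have h3 : ρ.real 3 = σ.real 3 := (hρ.real _ rfl).trans (u.real _ rfl)
    refine Runs.of_wp ?_ le_rfl
    simp [Prog.wp, h, h3, hρj, Finset.sum_range_succ]
    ring
  · rintro ρ ⟨-, h⟩
    rw [h, Finset.sum_range]
    simp only [hx]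

/-- Conversion from real to natural numbers is not an operation of the machine, so the floor is
found by counting; the bound `β ≤ nf` limits the number of rounds. -/
theorem runs_floorProg (σ : Store) {β : ℝ} (hβ : σ.real 30 0 = β) (h0 : 0 ≤ β) (h1 : β ≤ nf) :
    Runs floorProg σ (2 * nf + 2) fun τ => τ.nat 30 0 = ⌊β⌋₊ := by
  refine Runs.mono (m := 1 + (2 * nf + 1)) ?_ (by omega) fun _ => id
  let Inv : ℕ → Store → Prop := fun m τ => m = 2 * (nf - τ.nat 30 0) ∧ τ.real 30 = σ.real 30 ∧
    (τ.nat 30 0 : ℝ) ≤ β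
  refine (Runs.of_wp (P := .letNat 30 (nc 0)) (Q := Inv (2 * nf)) (by simp [Prog.wp, Inv, h0])
    le_rfl).seq fun τ u q => ?_
  refine (Runs.loop Inv q ?_).mono le_rfl ?_
  · rintro m τ ⟨rfl, h2, h3⟩ ht
    simp only [Test.Holds, RealExpr.eval, NatExpr.eval, h2, hβ] at ht
    have h4 : τ.nat 30 0 + 1 ≤ nf := by exact_mod_cast ht.trans h1
    refine ⟨1, 2 * (nf - (τ.nat 30 0 + 1)), by omega, Runs.of_wp ?_ le_rfl⟩
    simpa [Prog.wp, Inv, h2] using ht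
  · rintro τ ⟨⟨m, -, h2, h3⟩, ht⟩
    simp only [Test.Holds, RealExpr.eval, NatExpr.eval, h2, hβ, not_le] at ht
    exact ((Nat.floor_eq_iff h0).2 ⟨h3, by simpa using ht⟩).symm

/-- The memory says that the guess with the number `p` is considered for `k`. -/
def okAt (σ : Store) (k p : ℕ) : Prop := σ.nat 4 (σ.nat 6 p + k) = 1

/-- The value of the guess with the number `p` for `k` and the fraction `r`. -/
def valueAt (σ : Store) (k : ℕ) (r : ℝ) (p : ℕ) : ℝ :=
  σ.real 7 (σ.nat 6 p + k) + σ.real 1 (σ.nat 2 p) * r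

theorem runs_bestProg (σ : Store) {u k : ℕ} {r : ℝ} (hu : σ.nat 5 0 = u) (hk : σ.nat 30 0 = k)
    (hr : σ.real 32 0 = r) (hex : ∃ p, p < u ∧ okAt σ k p) :
    Runs bestProg σ (11 * u + 3) fun τ => τ.nat 31 0 < u ∧ okAt σ k (τ.nat 31 0) ∧
      ∀ p, p < u → okAt σ k p → valueAt σ k r p ≤ valueAt σ k r (τ.nat 31 0) := by
  refine Runs.mono (m := 1 + (u * (9 + 2) + 2)) ?_ (by omega) fun _ => id
  refine (Runs.of_wp (P := .letNat 32 (nc 0)) (Q := fun τ => τ.nat 32 0 = 0)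
    (by simp [Prog.wp]) le_rfl).seq fun τ w q => ?_
  -- The variable `32` tells whether an admissible guess has been seen, so that no value below all
  -- others is needed at the start.
  refine (Runs.forLoop_const u 9 (fun j τ => (τ.nat 32 0 = 0 ∧ ∀ p, p < j → ¬ okAt σ k p) ∨
    (τ.nat 32 0 = 1 ∧ τ.nat 31 0 < j ∧ okAt σ k (τ.nat 31 0) ∧
      τ.real 31 0 = valueAt σ k r (τ.nat 31 0) ∧
      ∀ p, p < j → okAt σ k p → valueAt σ k r p ≤ τ.real 31 0)) rfl ?_ (by simp [q]) ?_).mono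
    le_rfl ?_
  · intro ρ hρ
    have h0 : ρ.nat 5 = σ.nat 5 := (hρ.nat _ rfl).trans (w.nat _ rfl)
    simp [h0, hu]
  · intro j ρ hj hρ hρj hinv
    have k4 : ρ.nat 4 = σ.nat 4 := (hρ.nat _ rfl).trans (w.nat _ rfl)
    have k6 : ρ.nat 6 = σ.nat 6 := (hρ.nat _ rfl).trans (w.nat _ rfl)
    have k2 : ρ.nat 2 = σ.nat 2 := (hρ.nat _ rfl).trans (w.nat _ rfl)
    have k30 : ρ.nat 30 0 = k := by rw [hρ.nat 30 rfl, w.nat 30 rfl, hk]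
    have k7 : ρ.real 7 = σ.real 7 := (hρ.real _ rfl).trans (w.real _ rfl)
    have k1 : ρ.real 1 = σ.real 1 := (hρ.real _ rfl).trans (w.real _ rfl)
    have k32 : ρ.real 32 0 = r := by rw [hρ.real 32 rfl, w.real 32 rfl, hr]
    have hok : (okTest (nv 10)).Holds ρ ↔ okAt σ k j := by
      simp [okTest, okAt, hρj, k4, k6, k30, le_antisymm_iff, and_comm]
    have hval : (ra 7 (na 6 (nv 10) + nv 30) + ra 1 (na 2 (nv 10)) * rv 32 : RealExpr).eval ρ
        = valueAt σ k r j := by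
      simp [valueAt, hρj, k6, k30, k2, k7, k1, k32]
    have hstep : ∀ p, p < j + 1 → p = j ∨ p < j := fun p hp => by omega
    refine Runs.of_wp ?_ (by decide)
    simp only [bestStep, Prog.wp]
    rw [hok, hval]
    refine ⟨fun h => ⟨fun h1 => ?_, fun h1 => ?_⟩, fun h => ?_⟩
    · right
      have h1' : ρ.nat 32 0 = 0 ∨ ρ.real 31 0 < valueAt σ k r j := by
        simpa [Classical.or_iff_not_imp_left] using h1
      simp only [NatExpr.eval, RealExpr.eval, Store.nat_setNat_self, ne_eq, Store.real_setNat,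
        Store.nat_setNat_of_ne, Function.update_self, Nat.reduceEqDiff, not_false_eq_true, hρj,
        Store.nat_setReal, Store.real_setReal_self, true_and]
      refine ⟨by omega, h, fun p hp hokp => ?_⟩
      rcases hstep p hp with rfl | hp
      · exact le_rfl
      · rcases hinv with ⟨-, h2⟩ | ⟨h2, -, -, -, h3⟩
        · exact absurd hokp (h2 p hp)
        · exact (h3 p hp hokp).trans (h1'.resolve_left (by omega)).le
    · have h1' : ρ.nat 32 0 ≠ 0 ∧ valueAt σ k r j ≤ ρ.real 31 0 := by
        simpa [Nat.pos_iff_ne_zero] using h1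
      rcases hinv with ⟨h2, -⟩ | ⟨h2, h3, h4, h5, h6⟩
      · exact absurd h2 h1'.1
      · right
        simp only [ne_eq, Store.real_setNat, Store.nat_setNat_of_ne, Nat.reduceEqDiff,
          not_false_eq_true, Store.nat_setReal, Store.real_setReal_of_ne]
        refine ⟨h2, by omega, h4, h5, fun p hp hokp => ?_⟩
        rcases hstep p hp with rfl | hp
        · exact h1'.2
        · exact h6 p hp hokp
    · simp only [ne_eq, Store.real_setNat, Store.nat_setNat_of_ne, Nat.reduceEqDiff,
        not_false_eq_true]
      rcases hinv with ⟨h2, h3⟩ | ⟨h2, h3, h4, h5, h6⟩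
      · refine Or.inl ⟨h2, fun p hp => ?_⟩
        rcases hstep p hp with rfl | hp
        · exact h
        · exact h3 p hp
      · refine Or.inr ⟨h2, by omega, h4, h5, fun p hp hokp => ?_⟩
        rcases hstep p hp with rfl | hp
        · exact absurd hokp h
        · exact h6 p hp hokp
  · rintro ρ ⟨-, ⟨-, h⟩ | ⟨-, h2, h3, h4, h5⟩⟩
    · obtain ⟨p, hp, hokp⟩ := hex
      exact absurd hokp (h p hp)
    · exact ⟨h2, h3, fun p hp hokp => h4 ▸ h5 p hp hokp⟩

namespace Prepared

variable {I : Instance (Fin nl) (Fin nf)} {σ : Store}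

theorem okAt_iff (h : Prepared I σ) {p k : ℕ} (hp : p < I.numValues) (hk : k < nf) {e : Fin nf}
    (he : σ.nat 2 p = e) : okAt σ k p ↔ I.IsGuess k e (σ.real 2 p) := by
  rw [okAt, h.table.start p hp]
  exact (h.table.row p hp e he k hk).1

theorem valueAt_eq (h : Prepared I σ) {p k : ℕ} (hp : p < I.numValues) (hk : k < nf) {e : Fin nf}
    (he : σ.nat 2 p = e) (hG : I.IsGuess k e (σ.real 2 p)) {Y : Finset (Fin nf)}
    (hY : I.IsGuessedSet k e (σ.real 2 p) Y) (r : ℝ) :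
    valueAt σ k r p = ∑ i ∈ Y, I.cf i + I.cf e * r := by
  obtain ⟨Y', hY', h1⟩ := (h.table.row p hp e he k hk).2 hG
  rw [valueAt, h.table.start p hp, h1, he, h.loaded.hcf, hY'.sum_eq hG hY]

/-- The values in the table are those of all guesses. -/
theorem guessValues_eq (h : Prepared I σ) {k : ℕ} (hk : k < nf) (β : ℝ) :
    I.guessValues k β = {w | ∃ p, p < I.numValues ∧ okAt σ k p ∧ w = valueAt σ k (β - k) p} := by
  ext w
  constructor
  · rintro ⟨e, δ, Y, hG, hY, rfl⟩
    obtain ⟨p, hp, he, rfl⟩ := h.pairs.hit e δ hG.1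
    exact ⟨p, hp, (h.okAt_iff hp hk he).2 hG, (h.valueAt_eq hp hk he hG hY _).symm⟩
  · rintro ⟨p, hp, hok, rfl⟩
    obtain ⟨e, he, -⟩ := h.pairs.own p hp
    have hG := (h.okAt_iff hp hk he).1 hok
    obtain ⟨Y, hY⟩ := hG.exists_isGuessedSet
    exact ⟨e, _, Y, hG, hY, h.valueAt_eq hp hk he hG hY _⟩

end Prepared

/-- The algorithm refers to a choice of guessed sets for all guesses, while the program builds only
one set. An arbitrary choice is overridden at the returned pair. -/
theorem Instance.adversaryAlg_of_isGreatest {I : Instance (Fin nl) (Fin nf)} {x : Fin nl → ℝ}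
    (hne : ¬ ((I.b : ℝ) - ∑ e, x e = 0 ∨ (I.b : ℝ) - ∑ e, x e = nf)) {k : ℕ}
    (hk : k = ⌊(I.b : ℝ) - ∑ e, x e⌋₊) {e : Fin nf} {δ : ℝ} {Y : Finset (Fin nf)}
    (hG : I.IsGuess k e δ) (hY : I.IsGuessedSet k e δ Y)
    (hg : IsGreatest (I.guessValues k (I.b - ∑ e, x e))
      (∑ i ∈ Y, I.cf i + I.cf e * ((I.b : ℝ) - ∑ e, x e - k))) :
    I.AdversaryAlg x (I.guessedScenario e δ Y) := by
  simp only [AdversaryAlg, Fintype.card_fin, if_neg hne, ← hk]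
  classical
  obtain ⟨Y₀, hY₀⟩ := I.exists_choice k
  have hY' : ∀ e' δ', I.IsGuess k e' δ' →
      I.IsGuessedSet k e' δ' (if e' = e ∧ δ' = δ then Y else Y₀ e' δ') := by
    intro e' δ' hG'
    split_ifs with h
    · rw [h.1, h.2]; exact hY
    · exact hY₀ e' δ' hG'
  refine ⟨fun e' δ' => if e' = e ∧ δ' = δ then Y else Y₀ e' δ', hY', e, δ, hG,
    fun e' δ' hG' => ?_, by simp⟩
  have := hg.2 ⟨e', δ', _, hG', hY' e' δ' hG', rfl⟩
  simpa using this

theorem runs_rebuildBefore {I : Instance (Fin nl) (Fin nf)} (σ : Store) (h : Prepared I σ)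
    (h14 : σ.nat 14 0 = 0) :
    Runs (.forLoop 11 (na 0 (nc 1)) rebuildBefore) σ (6 * nf + 2) fun τ =>
      τ.nat 14 0 = (I.itemsBefore (σ.real 10 0)).card ∧
      ∀ i : Fin nf, τ.real 4 i = if i ∈ I.itemsBefore (σ.real 10 0) then I.dmin i else I.dmax i := by
  refine (Runs.forLoop_const nf 4 (fun j τ =>
    τ.nat 14 0 = (firstOf id (I.itemsBefore (σ.real 10 0)) j).card ∧
    ∀ i : Fin nf, (i : ℕ) < j →
      τ.real 4 i = if i ∈ I.itemsBefore (σ.real 10 0) then I.dmin i else I.dmax i) rfl ?_ ?_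
    ?_).mono (by omega) ?_
  · intro τ hτ
    have h0 : τ.nat 0 = σ.nat 0 := hτ.nat _ rfl
    simp [h0, h.loaded.hnf]
  · simp [firstOf_zero, h14]
  · rintro j τ hj hτ hτj ⟨i1, i2⟩
    have k6 : τ.real 6 = σ.real 6 := hτ.real _ rfl
    have k5 : τ.real 5 = σ.real 5 := hτ.real _ rfl
    have k10 : τ.real 10 = σ.real 10 := hτ.real _ rfl
    have hmax := h.pairs.hmax ⟨j, hj⟩
    have hmin := h.pairs.hmin ⟨j, hj⟩
    dsimp only at hmax hmin
    have hout : ∀ v : ℝ, (v = if (⟨j, hj⟩ : Fin nf) ∈ I.itemsBefore (σ.real 10 0)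
        then I.dmin ⟨j, hj⟩ else I.dmax ⟨j, hj⟩) → ∀ i : Fin nf, (i : ℕ) < j + 1 →
        Function.update (τ.real 4) j v i =
          if i ∈ I.itemsBefore (σ.real 10 0) then I.dmin i else I.dmax i := by
      intro v hv i hi
      rcases Nat.lt_succ_iff_lt_or_eq.1 hi with h1 | h1
      · rw [Function.update_of_ne h1.ne]; exact i2 i h1
      · obtain rfl : i = ⟨j, hj⟩ := Fin.ext h1
        rw [Function.update_self, hv]
    refine Runs.of_wp ?_ (by decide)
    simp only [Prog.wp, rebuildBefore, Test.Holds, not_le, not_lt]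
    simp only [NatExpr.eval, RealExpr.eval, Store.nat_setNat_self, ne_eq, Store.real_setNat,
      Store.nat_setNat_of_ne, Function.update_self, Nat.reduceEqDiff, not_false_eq_true, hτj,
      Store.nat_setReal, Store.real_setReal_self, k6, k10, hmax, k5, hmin, i1]
    constructor
    · intro h
      have hm : (⟨j, hj⟩ : Fin nf) ∈ I.itemsBefore (σ.real 10 0) := Instance.mem_itemsBefore.2 h
      have hn : (⟨j, hj⟩ : Fin nf) ∉ firstOf id (I.itemsBefore (σ.real 10 0)) j :=
        notMem_firstOf (fun q hq => hq.ne) rfl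
      rw [firstOf_succ_of_mem (i := ⟨j, hj⟩) rfl hm, Finset.card_insert_of_notMem hn]
      exact ⟨rfl, hout _ (by rw [if_pos hm])⟩
    · intro h
      have hm : (⟨j, hj⟩ : Fin nf) ∉ I.itemsBefore (σ.real 10 0) := fun h' =>
        absurd (Instance.mem_itemsBefore.1 h') (not_lt.2 h)
      rw [firstOf_succ_of_notMem (i := ⟨j, hj⟩) rfl hm]
      exact ⟨rfl, hout _ (by rw [if_neg hm])⟩
  · rintro τ ⟨-, h1, h2⟩
    rw [firstOf_all (A := id) fun v hv => ⟨v, hv, rfl⟩] at h1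
    exact ⟨h1, fun i => h2 i i.2⟩

/-- The table holds only costs, so the scan is repeated for the best pair and stops adding items at
size `k`. In the invariant, `j'` is the point of the scan that the current set corresponds to; it
can lag behind `j` only once the set is full. -/
theorem runs_rebuildAround {I : Instance (Fin nl) (Fin nf)} (σ : Store) (h : Prepared I σ)
    {e : Fin nf} {δ : ℝ} {k : ℕ} (hG : I.IsGuess k e δ) (h13 : σ.nat 13 0 = e)
    (h10 : σ.real 10 0 = δ) (h30 : σ.nat 30 0 = k) (h14 : σ.nat 14 0 = (I.itemsBefore δ).card)
    (h4 : ∀ i : Fin nf, σ.real 4 i = if i ∈ I.itemsBefore δ then I.dmin i else I.dmax i) :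
    Runs (.forLoop 11 (na 0 (nc 1)) rebuildAround) σ (7 * nf + 2) fun τ =>
      ∃ Y, I.IsGuessedSet k e δ Y ∧
        ∀ i : Fin nf, τ.real 4 i = if i ∈ Y then I.dmin i else I.dmax i := by
  have hGi := (I.isGuess_iff e hG.1 k).1 hG
  have hz := I.chosen_zero (A := σ.nat 3) e δ
  refine (Runs.forLoop_const nf 5 (fun j τ => ∃ j', j' ≤ j ∧
    τ.nat 14 0 = (I.chosen (σ.nat 3) e δ j').card ∧ (I.chosen (σ.nat 3) e δ j').card ≤ k ∧
    ((I.chosen (σ.nat 3) e δ j').card < k → j' = j) ∧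
    ∀ i : Fin nf, τ.real 4 i =
      if i ∈ I.chosen (σ.nat 3) e δ j' then I.dmin i else I.dmax i) rfl ?_ ?_ ?_).mono (by omega) ?_
  · intro τ hτ
    have h0 : τ.nat 0 = σ.nat 0 := hτ.nat _ rfl
    simp [h0, h.loaded.hnf]
  · exact ⟨0, le_rfl, by simp [hz, h14], by simpa [hz] using hGi.1, fun _ => rfl,
      by simpa [hz] using h4⟩
  · rintro j τ hj hτ hτj ⟨j', i0, i1, i2, i3, i4⟩
    have k3 : τ.nat 3 = σ.nat 3 := hτ.nat _ rfl
    have k13 : τ.nat 13 0 = e := by rw [hτ.nat 13 rfl, h13]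
    have k30 : τ.nat 30 0 = k := by rw [hτ.nat 30 rfl, h30]
    have k10 : τ.real 10 0 = δ := by rw [hτ.real 10 rfl, h10]
    have k5 : τ.real 5 = σ.real 5 := hτ.real _ rfl
    have k6 : τ.real 6 = σ.real 6 := hτ.real _ rfl
    obtain ⟨i, hi⟩ : ∃ i : Fin nf, σ.nat 3 j = i := ⟨⟨_, h.sorting.lt hj⟩, rfl⟩
    have hmin := h.pairs.hmin i
    have hmax := h.pairs.hmax i
    have hiff : (Test.and aroundTest (.natLt (nv 14) (nv 30))).Holds (τ.setNat 15 0 i) ↔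
        i ∈ I.itemsAround e δ ∧ (I.chosen (σ.nat 3) e δ j').card < k := by
      rw [Instance.mem_itemsAround, ne_eq, ← Fin.val_inj]
      simp [aroundTest, k13, k10, k5, k6, hmin, hmax, le_antisymm_iff, i1, k30]
    refine Runs.of_wp ?_ (by decide)
    simp only [rebuildAround, Prog.wp]
    simp only [NatExpr.eval, hτj, k3, hi, hiff]
    constructor
    · rintro ⟨h1, h2⟩
      obtain rfl := i3 h2
      have hn := I.notMem_chosen h.sorting hj hi h1
      have hc : (I.chosen (σ.nat 3) e δ (j' + 1)).card = (I.chosen (σ.nat 3) e δ j').card + 1 := by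
        rw [Instance.chosen_succ_of_mem hi h1, Finset.card_insert_of_notMem hn]
      refine ⟨j' + 1, le_rfl, by simp [i1, hc], by omega, fun _ => rfl, fun i' => ?_⟩
      rw [Instance.chosen_succ_of_mem hi h1]
      by_cases h3 : i' = i
      · subst h3
        simp [k5, hmin]
      · have h3' : (i' : ℕ) ≠ i := fun h => h3 (Fin.ext h)
        simp [h3, h3', i4 i']
    · intro h1
      by_cases h2 : (I.chosen (σ.nat 3) e δ j').card < k
      · obtain rfl := i3 h2
        have h3 : i ∉ I.itemsAround e δ := fun h3 => h1 ⟨h3, h2⟩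
        have hc := I.chosen_succ_of_notMem hi h3
        exact ⟨j' + 1, le_rfl, by simp [i1, hc], by simpa [hc] using i2, fun _ => rfl,
          by simpa [hc] using i4⟩
      · exact ⟨j', by omega, by simp [i1], i2, fun h => absurd h h2, by simpa using i4⟩
  · rintro τ ⟨-, j', -, -, i2, i3, i4⟩
    have hset := I.isGuessedSet_chosen h.sorting (fun i => by rw [h.loaded.hcf]) e δ j'
    have hc : (I.chosen (σ.nat 3) e δ j').card = k := by
      by_contra hne
      have hlt : (I.chosen (σ.nat 3) e δ j').card < k := lt_of_le_of_ne i2 hne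
      obtain rfl := i3 hlt
      rw [I.chosen_all h.sorting] at hlt
      omega
    rw [hc] at hset
    exact ⟨_, hset, i4⟩

theorem runs_rebuildProg {I : Instance (Fin nl) (Fin nf)} (σ : Store) (h : Prepared I σ) {p k : ℕ}
    {e : Fin nf} (h31 : σ.nat 31 0 = p) (he : σ.nat 2 p = e) (h30 : σ.nat 30 0 = k)
    (hG : I.IsGuess k e (σ.real 2 p)) :
    Runs rebuildProg σ (13 * nf + 8) fun τ => ∃ Y, I.IsGuessedSet k e (σ.real 2 p) Y ∧
      τ.output nf = I.guessedScenario e (σ.real 2 p) Y := by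
  refine Runs.mono (m := 3 + (6 * nf + 2 + (7 * nf + 2 + 1))) ?_ (by omega) fun _ => id
  refine (Runs.of_wp (Q := fun τ => τ.nat 13 0 = e ∧ τ.real 10 0 = σ.real 2 p ∧ τ.nat 14 0 = 0)
    (by simp [Prog.wp, h31, he]) le_rfl).seq fun τ₁ u₁ q₁ => ?_
  have hp₁ : Prepared I τ₁ := h.congr
    (fun a ha => u₁.nat a (by simp [Prog.writesNat]; omega))
    (fun a ha _ _ => u₁.real a (by simp [Prog.writesReal]; omega))
  refine (runs_rebuildBefore τ₁ hp₁ q₁.2.2).seq fun τ₂ u₂ q₂ => ?_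
  have hp₂ : Prepared I τ₂ := hp₁.congr
    (fun a ha => u₂.nat a (by simp [Prog.forLoop, rebuildBefore, Prog.writesNat]; omega))
    (fun a ha _ _ => u₂.real a (by simp [Prog.forLoop, rebuildBefore, Prog.writesReal]; omega))
  have h13 : τ₂.nat 13 0 = e := by rw [u₂.nat 13 rfl, q₁.1]
  have h10 : τ₂.real 10 0 = σ.real 2 p := by rw [u₂.real 10 rfl, q₁.2.1]
  rw [q₁.2.1] at q₂
  refine (runs_rebuildAround τ₂ hp₂ hG h13 h10
    (by rw [u₂.nat 30 rfl, u₁.nat 30 rfl, h30]) q₂.1 q₂.2).seq fun τ₃ u₃ q₃ => ?_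
  obtain ⟨Y, hY, q₃⟩ := q₃
  have h13' : τ₃.nat 13 0 = e := by rw [u₃.nat 13 rfl, h13]
  have h10' : τ₃.real 10 0 = σ.real 2 p := by rw [u₃.real 10 rfl, h10]
  refine Runs.of_wp ⟨Y, hY, ?_⟩ le_rfl
  funext i
  simp only [Store.output, NatExpr.eval, RealExpr.eval, h13', h10', Store.real_setReal_self,
    Instance.guessedScenario]
  by_cases hi : i = e
  · subst hi; simp
  · have hi' : (i : ℕ) ≠ e := fun h => hi (Fin.ext h)
    rw [Function.update_of_ne hi', q₃ i, if_neg hi]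

/-- A bound on the running time of `adversaryProg`. -/
def adversaryTime (nl nf u : ℕ) : ℕ := prepTime nf u + 3 * nl + 15 * nf + 11 * u + 20

theorem runs_adversaryProg {I : Instance (Fin nl) (Fin nf)} (σ : Store) (hl : Loaded I σ)
    (hfresh : ∀ q, σ.nat 4 q = 0) {x : Fin nl → ℝ} (hx : ∀ i : Fin nl, σ.real 3 i = x i)
    (hfeas : I.IsLeaderFeasible x) :
    Runs adversaryProg σ (adversaryTime nl nf I.numValues) fun τ =>
      I.AdversaryAlg x (τ.output nf) := by
  refine Runs.mono (m := prepTime nf I.numValues + (3 * nl + 3 +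
    (2 * nf + 2 + (1 + (11 * I.numValues + 3 + (13 * nf + 8))) + 1))) ?_
    (by rw [adversaryTime]; omega) fun _ => id
  refine (runs_prepProg σ hl hfresh).seq fun τ₁ u₁ hp₁ => ?_
  refine (runs_capacityProg τ₁ hp₁.loaded (x := x) (by rw [u₁.real 3 rfl]; exact hx)).seq
    fun τ₂ u₂ q₂ => ?_
  have hp₂ : Prepared I τ₂ := hp₁.congr
    (fun a ha => u₂.nat a (by simp [Prog.forLoop, capacityProg, Prog.writesNat]; omega))
    (fun a ha _ _ => u₂.real a (by simp [Prog.forLoop, capacityProg, Prog.writesReal]; omega))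
  have hcap := hfeas.capacity_mem
  rw [Fintype.card_fin] at hcap
  set β := (I.b : ℝ) - ∑ e, x e with hβ
  -- On `[0, nf]` the two inequalities that the program tests are equivalent to equalities.
  have htest : (Test.or (.realLe (rv 30) (rn (nc 0))) (.realLe (rn (na 0 (nc 1))) (rv 30))).Holds
      τ₂ ↔ (β = 0 ∨ β = nf) := by
    have h1 : β ≤ 0 ↔ β = 0 := ⟨fun h => le_antisymm h hcap.1, fun h => h.le⟩
    have h2 : (nf : ℝ) ≤ β ↔ β = nf := ⟨fun h => le_antisymm hcap.2 h, fun h => h.ge⟩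
    rw [← h1, ← h2]
    simp only [Test.Holds, NatExpr.eval, RealExpr.eval, q₂, hp₂.loaded.hnf, Nat.cast_zero]
    tauto
  refine Runs.branch (fun ht => ?_) fun ht => ?_ <;> rw [htest] at ht
  · refine (Runs.forLoop_const nf 1 (fun j τ => ∀ i : Fin nf, (i : ℕ) < j → τ.real 4 i = I.dmin i)
      rfl ?_ (by simp) ?_).mono (by omega) ?_
    · intro τ hτ
      have h0 : τ.nat 0 = τ₂.nat 0 := hτ.nat _ rfl
      simp [h0, hp₂.loaded.hnf]
    · intro j τ hj hτ hτj hinv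
      have k5 : τ.real 5 = τ₂.real 5 := hτ.real _ rfl
      have hmin := hp₂.pairs.hmin ⟨j, hj⟩
      refine Runs.of_wp ?_ le_rfl
      intro i hi
      simp only [NatExpr.eval, RealExpr.eval, hτj, Store.real_setNat, Store.real_setReal_self, k5]
      rcases Nat.lt_succ_iff_lt_or_eq.1 hi with h1 | h1
      · rw [Function.update_of_ne h1.ne]; exact hinv i h1
      · obtain rfl : i = ⟨j, hj⟩ := Fin.ext h1
        rw [Function.update_self]; exact hmin
    · rintro τ ⟨-, h⟩
      rw [← Fintype.card_fin nf] at ht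
      simp only [Instance.AdversaryAlg, ← hβ, if_pos ht]
      intro i
      rw [Store.output, h i i.2]
      exact Instance.dmin_mem i
  · have hne : β ≠ nf := fun h => ht (Or.inr h)
    obtain ⟨hk, hk1, hk2⟩ := Instance.floor_spec hcap.1 hcap.2 hne
    refine (runs_floorProg (nf := nf) τ₂ q₂ hcap.1 hcap.2).seq fun τ₃ u₃ q₃ => ?_
    have hb₃ : τ₃.real 30 0 = β := by rw [u₃.real 30 rfl, q₂]
    refine (Runs.of_wp (P := .letReal 32 (rv 30 - rn (nv 30)))
      (Q := fun τ => τ.real 32 0 = β - (⌊β⌋₊ : ℕ)) (by simp [Prog.wp, hb₃, q₃]) le_rfl).seq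
      fun τ₄ u₄ q₄ => ?_
    have h30 : τ₄.nat 30 0 = ⌊β⌋₊ := by rw [u₄.nat 30 rfl, q₃]
    have hp₄ : Prepared I τ₄ := hp₂.congr
      (fun a ha => (u₄.nat a rfl).trans
        (u₃.nat a (by simp [floorProg, Prog.writesNat]; omega)))
      (fun a ha _ _ => (u₄.real a (by simp [Prog.writesReal]; omega)).trans (u₃.real a rfl))
    have hvals := hp₄.guessValues_eq hk β
    have hex : ∃ p, p < I.numValues ∧ okAt τ₄ ⌊β⌋₊ p := by
      obtain ⟨w, hw⟩ := I.nonempty_guessValues (by simpa using hk) β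
      rw [hvals] at hw
      obtain ⟨p, hp, hok, -⟩ := hw
      exact ⟨p, hp, hok⟩
    refine (runs_bestProg τ₄ hp₄.pairs.hu h30 q₄ hex).seq fun τ₅ u₅ q₅ => ?_
    obtain ⟨b1, b2, b3⟩ := q₅
    have hp₅ : Prepared I τ₅ := hp₄.congr
      (fun a ha => u₅.nat a
        (by simp [bestProg, bestStep, Prog.forLoop, Prog.writesNat]; omega))
      (fun a ha _ _ => u₅.real a
        (by simp [bestProg, bestStep, Prog.forLoop, Prog.writesReal]; omega))
    have c2 : τ₅.nat 2 = τ₄.nat 2 := u₅.nat _ rfl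
    have d2 : τ₅.real 2 = τ₄.real 2 := u₅.real _ rfl
    obtain ⟨e, he, -⟩ := hp₄.pairs.own _ b1
    have hG := (hp₄.okAt_iff b1 hk he).1 b2
    refine (runs_rebuildProg τ₅ hp₅ rfl (by rw [c2, he]) (by rw [u₅.nat 30 rfl, h30])
      (by rw [d2]; exact hG)).mono le_rfl ?_
    rintro τ ⟨Y, hY, hout⟩
    rw [d2] at hY hout
    rw [hout]
    refine Instance.adversaryAlg_of_isGreatest ht rfl hG hY ?_
    rw [← hβ, hvals, ← hp₄.valueAt_eq b1 hk he hG hY]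
    exact ⟨⟨_, b1, b2, rfl⟩, by rintro w ⟨p, hp, hok, rfl⟩; exact b3 p hp hok⟩

/-! ## Upper envelopes of lines

A line is given by its value at `0` and its slope. The upper envelope on `[0, 1]` of a set of lines
is represented by a stack of lines with the points where they begin to be maximal. -/

/-- The value of the line `l` at `s`. -/
def lineAt (l : ℝ × ℝ) (s : ℝ) : ℝ := l.1 + l.2 * s

/-- The difference of the lines is non-decreasing. -/
theorem lineAt_le_of_slope_le {l l' : ℝ × ℝ} (h : l.2 ≤ l'.2) {s t : ℝ} (hst : s ≤ t)
    (hs : lineAt l s ≤ lineAt l' s) : lineAt l t ≤ lineAt l' t := by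
  unfold lineAt at *
  nlinarith [mul_nonneg (sub_nonneg.2 h) (sub_nonneg.2 hst)]

/-- An affine function that is nonnegative at both ends of an interval is nonnegative inside. -/
theorem lineAt_le_of_between {l l' : ℝ × ℝ} {r s t : ℝ} (hrs : r ≤ s) (hst : s ≤ t)
    (hr : lineAt l r ≤ lineAt l' r) (ht : lineAt l t ≤ lineAt l' t) :
    lineAt l s ≤ lineAt l' s := by
  rcases le_total l.2 l'.2 with h | h
  · exact lineAt_le_of_slope_le h hrs hr
  · unfold lineAt at *
    nlinarith [mul_nonneg (sub_nonneg.2 h) (sub_nonneg.2 hst)]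

/-- The lines `(A i, C i)` with the starting points `S i`, for `i < m`, belong to `P` and are
maximal in their starting points, and each line meets its predecessor in its starting point. -/
structure EnvInv (P : Set (ℝ × ℝ)) (m : ℕ) (A C S : ℕ → ℝ) : Prop where
  first : 0 < m → S 0 = 0
  mono : ∀ i, i + 1 < m → S i ≤ S (i + 1)
  le_one : ∀ i, i < m → S i ≤ 1
  link : ∀ i, i + 1 < m → lineAt (A i, C i) (S (i + 1)) = lineAt (A (i + 1), C (i + 1)) (S (i + 1))
  mem : ∀ i, i < m → (A i, C i) ∈ P
  dom : ∀ l ∈ P, ∀ i, i < m → lineAt l (S i) ≤ lineAt (A i, C i) (S i)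

/-- The last line of the stack is maximal in `1`. -/
def EnvFresh (P : Set (ℝ × ℝ)) (m : ℕ) (A C : ℕ → ℝ) : Prop :=
  (m = 0 → P = ∅) ∧ ∀ i, i + 1 = m → ∀ l ∈ P, lineAt l 1 ≤ lineAt (A i, C i) 1

/-- Lines have been removed from the stack in favour of the line `l₀`. -/
def EnvPopped (P : Set (ℝ × ℝ)) (m : ℕ) (A C S : ℕ → ℝ) (l₀ : ℝ × ℝ) : Prop :=
  ∃ R, R ≤ 1 ∧ (m = 0 → R = 0) ∧ (∀ l ∈ P, lineAt l R ≤ lineAt l₀ R) ∧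
    ∀ i, i + 1 = m → S i ≤ R ∧ lineAt (A i, C i) R ≤ lineAt l₀ R ∧
      ∀ l ∈ P, lineAt l R ≤ lineAt (A i, C i) R

namespace EnvInv

variable {P : Set (ℝ × ℝ)} {m : ℕ} {A C S : ℕ → ℝ} {l₀ : ℝ × ℝ}

theorem nonneg (h : EnvInv P m A C S) : ∀ i, i < m → 0 ≤ S i := by
  intro i
  induction i with
  | zero => intro hi; exact (h.first hi).ge
  | succ i ih => intro hi; exact (ih (by omega)).trans (h.mono i hi)

/-- The witness `R` is the starting point of the removed line: that line was maximal there and is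
not above `l₀` there. The line below it on the stack meets it in `R`, hence is maximal in `R` as
well. -/
theorem pop (h : EnvInv P (m + 1) A C S) (hl : lineAt (A m, C m) (S m) ≤ lineAt l₀ (S m)) :
    EnvInv P m A C S ∧ EnvPopped P m A C S l₀ := by
  refine ⟨⟨fun hm => h.first (by omega), fun i hi => h.mono i (by omega),
    fun i hi => h.le_one i (by omega), fun i hi => h.link i (by omega),
    fun i hi => h.mem i (by omega), fun l hl i hi => h.dom l hl i (by omega)⟩,
    S m, h.le_one m (by omega), ?_, fun l hlP => (h.dom l hlP m (by omega)).trans hl, ?_⟩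
  · rintro rfl; exact h.first (by omega)
  · rintro i rfl
    rw [h.link i (by omega)]
    exact ⟨h.mono i (by omega), hl, fun l hlP => h.dom l hlP _ (by omega)⟩

/-- The new line is below the stack in all starting points if it is so in the last one. -/
theorem new_le (h : EnvInv P (m + 1) A C S) (hslope : ∀ l ∈ P, l.2 ≤ l₀.2)
    (hl : lineAt l₀ (S m) ≤ lineAt (A m, C m) (S m)) :
    ∀ i, i < m + 1 → lineAt l₀ (S i) ≤ lineAt (A i, C i) (S i) := by
  have key : ∀ n i, i + n = m → lineAt l₀ (S i) ≤ lineAt (A i, C i) (S i) := by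
    intro n
    induction n with
    | zero => rintro i rfl; exact hl
    | succ n ih =>
      intro i hi
      have h1 := ih (i + 1) (by omega)
      rw [← h.link i (by omega)] at h1
      -- If the steeper line `l₀` were above line `i` at its start, it would still be above it at
      -- the next starting point.
      by_contra h2
      have h3 := hslope _ (h.mem i (by omega))
      have h4 := h.mono i (by omega)
      unfold lineAt at *
      dsimp only at *
      nlinarith [mul_nonneg (sub_nonneg.2 h3) (sub_nonneg.2 h4)]
  exact fun i hi => key (m - i) i (by omega)

/-- The new line is nowhere needed on `[0, 1]`. After removals, the top line is still maximal at 1: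
there `l₀`, being steepest, is above all old lines, and the top line is above `l₀`. -/
theorem skip (h : EnvInv P (m + 1) A C S) (hslope : ∀ l ∈ P, l.2 ≤ l₀.2)
    (hst : EnvFresh P (m + 1) A C ∨ EnvPopped P (m + 1) A C S l₀)
    (hl : lineAt l₀ (S m) ≤ lineAt (A m, C m) (S m)) (h1 : lineAt l₀ 1 ≤ lineAt (A m, C m) 1) :
    EnvInv (insert l₀ P) (m + 1) A C S ∧ EnvFresh (insert l₀ P) (m + 1) A C := by
  have hone : ∀ l ∈ P, lineAt l 1 ≤ lineAt (A m, C m) 1 := by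
    intro l hlP
    rcases hst with hst | ⟨R, hR1, -, hR, -⟩
    · exact hst.2 m rfl l hlP
    · exact (lineAt_le_of_slope_le (hslope l hlP) hR1 (hR l hlP)).trans h1
  refine ⟨⟨h.first, h.mono, h.le_one, h.link, fun i hi => Or.inr (h.mem i hi), ?_⟩,
    fun h0 => by omega, ?_⟩
  · rintro l (rfl | hlP)
    · exact h.new_le hslope hl
    · exact h.dom l hlP
  · rintro i hi l hlP
    obtain rfl : i = m := by omega
    rcases hlP with rfl | hlP
    · exact h1
    · exact hone l hlP

/-- An empty stack means that there were no lines at all or that all were removed. In the latter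
case the last removal happened at 0, so `l₀` is maximal on the whole interval. -/
theorem push_zero (hslope : ∀ l ∈ P, l.2 ≤ l₀.2)
    (hst : EnvFresh P 0 A C ∨ EnvPopped P 0 A C S l₀) :
    EnvInv (insert l₀ P) 1 (Function.update A 0 l₀.1) (Function.update C 0 l₀.2)
      (Function.update S 0 0) ∧
    EnvFresh (insert l₀ P) 1 (Function.update A 0 l₀.1) (Function.update C 0 l₀.2) := by
  have hle : ∀ l ∈ P, lineAt l 0 ≤ lineAt l₀ 0 := by
    intro l hlP
    rcases hst with hst | ⟨R, -, hR0, hR, -⟩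
    · rw [hst.1 rfl] at hlP; exact hlP.elim
    · rw [hR0 rfl] at hR; exact hR l hlP
  constructor
  · refine ⟨fun _ => by simp, fun i hi => by omega, fun i hi => ?_, fun i hi => by omega,
      fun i hi => ?_, fun l hlP i hi => ?_⟩
    all_goals obtain rfl : i = 0 := by omega
    · simp
    · simp
    · simp only [Function.update_self]
      rcases hlP with rfl | hlP
      · exact le_rfl
      · exact hle l hlP
  · refine ⟨fun h0 => by omega, fun i hi l hlP => ?_⟩
    obtain rfl : i = 0 := by omega
    simp only [Function.update_self]
    rcases hlP with rfl | hlP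
    · exact le_rfl
    · exact lineAt_le_of_slope_le (hslope l hlP) zero_le_one (hle l hlP)

/-- The new line is strictly below the top line at its start and strictly above it at 1, so it is
strictly steeper and they cross in between; the crossing is the new starting point. -/
theorem push (h : EnvInv P (m + 1) A C S) (hslope : ∀ l ∈ P, l.2 ≤ l₀.2)
    (hst : EnvFresh P (m + 1) A C ∨ EnvPopped P (m + 1) A C S l₀)
    (hl : lineAt l₀ (S m) < lineAt (A m, C m) (S m)) (h1 : lineAt (A m, C m) 1 < lineAt l₀ 1) :
    EnvInv (insert l₀ P) (m + 2) (Function.update A (m + 1) l₀.1)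
      (Function.update C (m + 1) l₀.2)
      (Function.update S (m + 1) ((A m - l₀.1) / (l₀.2 - C m))) ∧
    EnvFresh (insert l₀ P) (m + 2) (Function.update A (m + 1) l₀.1)
      (Function.update C (m + 1) l₀.2) := by
  have hS1 := h.le_one m (by omega)
  have hc : 0 < l₀.2 - C m := by
    by_contra hc
    have := lineAt_le_of_slope_le (l := l₀) (l' := (A m, C m)) (by dsimp only; linarith) hS1 hl.le
    linarith
  obtain ⟨T, hT⟩ : ∃ T, T = (A m - l₀.1) / (l₀.2 - C m) := ⟨_, rfl⟩
  rw [← hT]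
  have hTeq : lineAt (A m, C m) T = lineAt l₀ T := by
    have : T * (l₀.2 - C m) = A m - l₀.1 := by rw [hT, div_mul_cancel₀ _ hc.ne']
    unfold lineAt
    dsimp only
    linarith
  have hdiff : ∀ s, lineAt l₀ s - lineAt (A m, C m) s = (l₀.2 - C m) * (s - T) := by
    intro s
    have : lineAt l₀ s - lineAt (A m, C m) s
      = lineAt l₀ T - lineAt (A m, C m) T + (l₀.2 - C m) * (s - T) := by
      unfold lineAt; ring
    rw [this, hTeq]; ring
  have hge : ∀ s, lineAt (A m, C m) s ≤ lineAt l₀ s → T ≤ s := by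
    intro s hs
    by_contra hlt
    have := mul_neg_of_pos_of_neg hc (sub_neg.2 (not_le.1 hlt))
    rw [← hdiff] at this
    linarith
  have hST : S m ≤ T := by
    by_contra hlt
    have := mul_pos hc (sub_pos.2 (not_le.1 hlt))
    rw [← hdiff] at this
    linarith
  have hT1 : T ≤ 1 := hge 1 h1.le
  -- The top line is maximal at `S m` and at a point not before `T`, namely 1 on a fresh stack and
  -- `R` after removals. Hence it is maximal at `T`, where it meets `l₀`.
  have hdomT : ∀ l ∈ P, lineAt l T ≤ lineAt l₀ T := by
    intro l hlP
    rw [← hTeq]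
    rcases hst with hst | ⟨R, hR1, -, hR, hR'⟩
    · exact lineAt_le_of_between hST hT1 (h.dom l hlP m (by omega)) (hst.2 m rfl l hlP)
    · obtain ⟨h2, h3, h4⟩ := hR' m rfl
      exact lineAt_le_of_between hST (hge R h3) (h.dom l hlP m (by omega)) (h4 l hlP)
  have hne : ∀ (f : ℕ → ℝ) v i, i < m + 1 → Function.update f (m + 1) v i = f i :=
    fun f v i hi => Function.update_of_ne hi.ne _ _
  constructor
  · refine ⟨fun _ => ?_, fun i hi => ?_, fun i hi => ?_, fun i hi => ?_, fun i hi => ?_,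
      fun l hlP i hi => ?_⟩
    · rw [hne _ _ _ (by omega)]; exact h.first (by omega)
    · rw [hne _ _ i (by omega)]
      by_cases h2 : i = m
      · subst h2; rw [Function.update_self]; exact hST
      · rw [hne _ _ _ (by omega)]; exact h.mono i (by omega)
    · by_cases h2 : i = m + 1
      · subst h2; rw [Function.update_self]; exact hT1
      · rw [hne _ _ _ (by omega)]; exact h.le_one i (by omega)
    · rw [hne _ _ i (by omega), hne _ _ i (by omega)]
      by_cases h2 : i = m
      · subst h2; simp only [Function.update_self]; exact hTeq
      · rw [hne _ _ _ (by omega), hne _ _ _ (by omega), hne _ _ _ (by omega)]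
        exact h.link i (by omega)
    · by_cases h2 : i = m + 1
      · subst h2; simp only [Function.update_self]; exact Or.inl rfl
      · rw [hne _ _ _ (by omega), hne _ _ _ (by omega)]; exact Or.inr (h.mem i (by omega))
    · by_cases h2 : i = m + 1
      · subst h2
        simp only [Function.update_self]
        rcases hlP with rfl | hlP
        · exact le_rfl
        · exact hdomT l hlP
      · rw [hne _ _ _ (by omega), hne _ _ _ (by omega), hne _ _ _ (by omega)]
        rcases hlP with rfl | hlP
        · exact h.new_le hslope hl.le i (by omega)
        · exact h.dom l hlP i (by omega)
  · refine ⟨fun h0 => by omega, fun i hi l hlP => ?_⟩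
    obtain rfl : i = m + 1 := by omega
    simp only [Function.update_self]
    rcases hlP with rfl | hlP
    · exact le_rfl
    · exact lineAt_le_of_slope_le (hslope l hlP) hT1 (hdomT l hlP)

/-- Add `1` as the last starting point. -/
theorem close (h : EnvInv P (m + 1) A C S) (hf : EnvFresh P (m + 1) A C) :
    EnvInv P (m + 2) (Function.update A (m + 1) (A m)) (Function.update C (m + 1) (C m))
      (Function.update S (m + 1) 1) := by
  have hne : ∀ (f : ℕ → ℝ) v i, i < m + 1 → Function.update f (m + 1) v i = f i :=
    fun f v i hi => Function.update_of_ne hi.ne _ _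
  refine ⟨fun _ => ?_, fun i hi => ?_, fun i hi => ?_, fun i hi => ?_, fun i hi => ?_,
    fun l hlP i hi => ?_⟩
  · rw [hne _ _ _ (by omega)]; exact h.first (by omega)
  · rw [hne _ _ i (by omega)]
    by_cases h2 : i = m
    · subst h2; rw [Function.update_self]; exact h.le_one i (by omega)
    · rw [hne _ _ _ (by omega)]; exact h.mono i (by omega)
  · by_cases h2 : i = m + 1
    · subst h2; rw [Function.update_self]
    · rw [hne _ _ _ (by omega)]; exact h.le_one i (by omega)
  · rw [hne _ _ i (by omega), hne _ _ i (by omega)]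
    by_cases h2 : i = m
    · subst h2; simp only [Function.update_self]
    · rw [hne _ _ _ (by omega), hne _ _ _ (by omega), hne _ _ _ (by omega)]
      exact h.link i (by omega)
  · by_cases h2 : i = m + 1
    · subst h2; simp only [Function.update_self]; exact h.mem m (by omega)
    · rw [hne _ _ _ (by omega), hne _ _ _ (by omega)]; exact h.mem i (by omega)
  · by_cases h2 : i = m + 1
    · subst h2
      simp only [Function.update_self]
      exact hf.2 m rfl l hlP
    · rw [hne _ _ _ (by omega), hne _ _ _ (by omega), hne _ _ _ (by omega)]
      exact h.dom l hlP i (by omega)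

/-- The sum of the upper envelope and a linear function is minimal in one of the starting points. -/
theorem exists_candidate (h : EnvInv P m A C S) (hm : 0 < m) {s f ν : ℝ} (h0 : 0 ≤ s)
    (h1 : s ≤ S (m - 1)) (hf : ∀ l ∈ P, lineAt l s ≤ f) :
    ∃ i, i < m ∧ lineAt (A i, C i) (S i) + ν * S i ≤ f + ν * s := by
  have key : ∀ n, n + 1 ≤ m → s ≤ S n →
      ∃ i, i < m ∧ lineAt (A i, C i) (S i) + ν * S i ≤ f + ν * s := by
    intro n
    induction n with
    | zero =>
      intro hn hs
      have hS := h.first hm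
      obtain rfl : s = 0 := le_antisymm (hS ▸ hs) h0
      refine ⟨0, hm, ?_⟩
      rw [hS]
      linarith [hf _ (h.mem 0 hm)]
    | succ n ih =>
      intro hn hs
      rcases le_total s (S n) with h2 | h2
      · exact ih (by omega) h2
      -- Between two starting points, `f` is bounded below by line `n`. Adding `ν s` keeps the bound
      -- linear, so one of the ends is at least as good as `s`; the sign of `C n + ν` decides which.
      -- At the right end, `link` passes to the next line.
      · have h3 := hf _ (h.mem n (by omega))
        rcases le_total 0 (C n + ν) with h4 | h4
        · refine ⟨n, by omega, ?_⟩
          unfold lineAt at *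
          dsimp only at *
          nlinarith [mul_nonneg h4 (sub_nonneg.2 h2)]
        · refine ⟨n + 1, by omega, ?_⟩
          rw [← h.link n (by omega)]
          unfold lineAt at *
          dsimp only at *
          nlinarith [mul_nonneg (neg_nonneg.2 h4) (sub_nonneg.2 hs)]
  exact key (m - 1) (by omega) h1

end EnvInv

variable {nl nf : ℕ}

/-! ### The leader's program -/

/-- Put the line `(44, 45)` with the starting point `s` on the stack. -/
def envPush (s : RealExpr) : Prog :=
  .setReal 50 (nv 39) (rv 44) ;; .setReal 51 (nv 39) (rv 45) ;; .setReal 52 (nv 39) s ;;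
  .letNat 39 (nv 39 + nc 1) ;; .letNat 38 (nv 38 + nc 1)

/-- Consider the next pair in the order of non-decreasing slopes. If its line is above the last line
of the stack in the starting point of the latter, remove this line. Otherwise put the new line on
the stack if it is maximal in `1`. -/
def envStep : Prog :=
  .letNat 40 (na 8 (nv 38)) ;;
  .branch (okTest (nv 40))
    (.letReal 44 (ra 7 (na 6 (nv 40) + nv 30)) ;; .letReal 45 (ra 1 (na 2 (nv 40))) ;;
      .letNat 41 (nv 39 - nc 1) ;;
      .branch (.natLe (nv 39) (nc 0)) (envPush (rn (nc 0)))
        (.branch (.realLe (ra 50 (nv 41) + ra 51 (nv 41) * ra 52 (nv 41))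
            (rv 44 + rv 45 * ra 52 (nv 41)))
          (.letNat 39 (nv 41))
          (.branch (.realLe (rv 44 + rv 45 * rn (nc 1)) (ra 50 (nv 41) + ra 51 (nv 41) * rn (nc 1)))
            (.letNat 38 (nv 38 + nc 1))
            (envPush ((ra 50 (nv 41) - rv 44) / (rv 45 - ra 51 (nv 41)))))))
    (.letNat 38 (nv 38 + nc 1))

/-- Compute the upper envelope of the lines for `k`. -/
def envProg : Prog :=
  (.letNat 38 (nc 0) ;; .letNat 39 (nc 0)) ;; .loop (.natLt (nv 38) (nv 5)) envStep

/-- The line for the pair with the number `p`. -/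
def lineOf (σ : Store) (k p : ℕ) : ℝ × ℝ := (σ.real 7 (σ.nat 6 p + k), σ.real 1 (σ.nat 2 p))

/-- The lines for the first `q` pairs in the order of non-decreasing slopes. -/
def lineSet (σ : Store) (k q : ℕ) : Set (ℝ × ℝ) :=
  {l | ∃ r, r < q ∧ okAt σ k (σ.nat 8 r) ∧ l = lineOf σ k (σ.nat 8 r)}

theorem lineSet_zero (σ : Store) (k : ℕ) : lineSet σ k 0 = ∅ := by
  ext; simp [lineSet]

theorem lineSet_succ_of_ok {σ : Store} {k q : ℕ} (h : okAt σ k (σ.nat 8 q)) :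
    lineSet σ k (q + 1) = insert (lineOf σ k (σ.nat 8 q)) (lineSet σ k q) := by
  ext l
  constructor
  · rintro ⟨r, h1, h2, rfl⟩
    rcases Nat.lt_succ_iff_lt_or_eq.1 h1 with h3 | rfl
    · exact Or.inr ⟨r, h3, h2, rfl⟩
    · exact Or.inl rfl
  · rintro (rfl | ⟨r, h1, h2, rfl⟩)
    · exact ⟨q, by omega, h, rfl⟩
    · exact ⟨r, by omega, h2, rfl⟩

theorem lineSet_succ_of_not_ok {σ : Store} {k q : ℕ} (h : ¬ okAt σ k (σ.nat 8 q)) :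
    lineSet σ k (q + 1) = lineSet σ k q := by
  ext l
  constructor
  · rintro ⟨r, h1, h2, rfl⟩
    rcases Nat.lt_succ_iff_lt_or_eq.1 h1 with h3 | rfl
    · exact ⟨r, h3, h2, rfl⟩
    · exact absurd h2 h
  · rintro ⟨r, h1, h2, rfl⟩
    exact ⟨r, by omega, h2, rfl⟩

/-- Because the pairs come by non-decreasing slope, each new line is at least as steep as all
earlier ones. A removal does not advance the counter: the same line is compared again with the new
top of the stack. -/
theorem runs_envProg (σ : Store) {u k : ℕ} (hu : σ.nat 5 0 = u) (hk : σ.nat 30 0 = k)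
    (hord : IsSorting (fun p => σ.real 1 (σ.nat 2 p)) (σ.nat 8) u) :
    Runs envProg σ (54 * u + 3) fun τ => τ.nat 39 0 ≤ u ∧
      EnvInv (lineSet σ k u) (τ.nat 39 0) (τ.real 50) (τ.real 51) (τ.real 52) ∧
      EnvFresh (lineSet σ k u) (τ.nat 39 0) (τ.real 50) (τ.real 51) := by
  -- Amortization: `2 * (u - q)` plus the height of the stack drops in every round, by 1 for a
  -- removal or an insertion and by 2 for a skipped pair. A round costs at most 26 steps and one
  -- test, whence the factor 27.
  let Inv : ℕ → Store → Prop := fun m τ =>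
    27 * (2 * (u - τ.nat 38 0) + τ.nat 39 0) ≤ m ∧ Unchanged envStep σ τ ∧
    τ.nat 38 0 ≤ u ∧ τ.nat 39 0 ≤ τ.nat 38 0 ∧
    EnvInv (lineSet σ k (τ.nat 38 0)) (τ.nat 39 0) (τ.real 50) (τ.real 51) (τ.real 52) ∧
    (EnvFresh (lineSet σ k (τ.nat 38 0)) (τ.nat 39 0) (τ.real 50) (τ.real 51) ∨
      (τ.nat 38 0 < u ∧ okAt σ k (σ.nat 8 (τ.nat 38 0)) ∧
        EnvPopped (lineSet σ k (τ.nat 38 0)) (τ.nat 39 0) (τ.real 50) (τ.real 51) (τ.real 52)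
          (lineOf σ k (σ.nat 8 (τ.nat 38 0)))))
  refine Runs.mono (m := 2 + (54 * u + 1)) ?_ (by omega) fun _ => id
  refine (Runs.of_wp (Q := Inv (54 * u)) ?_ le_rfl).seq fun τ _ hτ => ?_
  · refine ⟨by simp; omega, ⟨fun a ha => ?_, fun _ _ => rfl⟩, by simp, by simp, ?_, Or.inl ?_⟩
    · have h1 : a ≠ 38 := by rintro rfl; exact absurd ha (by decide)
      have h2 : a ≠ 39 := by rintro rfl; exact absurd ha (by decide)
      simp [h1, h2]
    · constructor <;> simp [lineSet_zero]
    · constructor <;> simp [lineSet_zero]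
  refine (Runs.loop Inv hτ ?_).mono le_rfl ?_
  · rintro m τ ⟨hm, hun, hq, htop, henv, hst⟩ ht
    have k5 : τ.nat 5 = σ.nat 5 := hun.nat _ rfl
    have k4 : τ.nat 4 = σ.nat 4 := hun.nat _ rfl
    have k6 : τ.nat 6 = σ.nat 6 := hun.nat _ rfl
    have k2 : τ.nat 2 = σ.nat 2 := hun.nat _ rfl
    have k8 : τ.nat 8 = σ.nat 8 := hun.nat _ rfl
    have k30 : τ.nat 30 0 = k := by rw [hun.nat 30 rfl, hk]
    have k7 : τ.real 7 = σ.real 7 := hun.real _ rfl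
    have k1 : τ.real 1 = σ.real 1 := hun.real _ rfl
    simp only [Test.Holds, NatExpr.eval, k5, hu, not_le] at ht
    set q := τ.nat 38 0 with hqdef
    set l₀ := lineOf σ k (σ.nat 8 q) with hl₀
    have hslope : ∀ l ∈ lineSet σ k q, l.2 ≤ l₀.2 := by
      rintro l ⟨r, h1, -, rfl⟩
      exact hord.sorted r q (Nat.zero_le _) h1.le ht
    have hok : (okTest (nv 40)).Holds (τ.setNat 40 0 (σ.nat 8 q)) ↔ okAt σ k (σ.nat 8 q) := by
      simp [okTest, okAt, k4, k6, k30, le_antisymm_iff, and_comm]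
    refine ⟨26, m - 27, by omega, ?_⟩
    suffices h : Runs envStep τ 26 fun τ' =>
        27 * (2 * (u - τ'.nat 38 0) + τ'.nat 39 0) ≤ m - 27 ∧
        τ'.nat 38 0 ≤ u ∧ τ'.nat 39 0 ≤ τ'.nat 38 0 ∧
        EnvInv (lineSet σ k (τ'.nat 38 0)) (τ'.nat 39 0) (τ'.real 50) (τ'.real 51) (τ'.real 52) ∧
        (EnvFresh (lineSet σ k (τ'.nat 38 0)) (τ'.nat 39 0) (τ'.real 50) (τ'.real 51) ∨
          (τ'.nat 38 0 < u ∧ okAt σ k (σ.nat 8 (τ'.nat 38 0)) ∧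
            EnvPopped (lineSet σ k (τ'.nat 38 0)) (τ'.nat 39 0) (τ'.real 50) (τ'.real 51)
              (τ'.real 52) (lineOf σ k (σ.nat 8 (τ'.nat 38 0))))) by
      refine h.frame.mono le_rfl fun τ' hτ' => ⟨hτ'.2.1, ⟨fun a ha => ?_, fun a ha => ?_⟩, hτ'.2.2⟩
      · rw [hτ'.1.nat a ha, hun.nat a ha]
      · rw [hτ'.1.real a ha, hun.real a ha]
    refine Runs.of_wp ?_ (by decide)
    simp only [envStep, Prog.wp]
    simp only [NatExpr.eval, ← hqdef, k8, hok]
    refine ⟨fun hokq => ?_, fun hokq => ?_⟩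
    · have hv1 : σ.real 7 (σ.nat 6 (σ.nat 8 q) + k) = l₀.1 := rfl
      have hv2 : σ.real 1 (σ.nat 2 (σ.nat 8 q)) = l₀.2 := rfl
      have hst' : EnvFresh (lineSet σ k q) (τ.nat 39 0) (τ.real 50) (τ.real 51) ∨
          EnvPopped (lineSet σ k q) (τ.nat 39 0) (τ.real 50) (τ.real 51) (τ.real 52) l₀ :=
        hst.imp id fun h => h.2.2
      have hins := lineSet_succ_of_ok hokq
      simp only [envPush, Prog.wp, Test.Holds]
      simp only [NatExpr.eval, RealExpr.eval, Store.nat_setNat_self, ne_eq, Store.real_setNat,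
        Store.nat_setNat_of_ne, Function.update_self, Nat.reduceEqDiff, not_false_eq_true,
        Store.nat_setReal, Store.real_setReal_self, Store.real_setReal_of_ne, k6, k30, k7, k2, k1,
        hv1, hv2, ← hqdef, NatExpr.eval_sub, RealExpr.eval_sub, RealExpr.eval_div, Nat.cast_one,
        Nat.cast_zero]
      rcases Nat.eq_zero_or_pos (τ.nat 39 0) with h0 | h0
      · refine ⟨fun _ => ?_, fun h => absurd h0.le h⟩
        rw [h0] at hm hst' ⊢
        have := EnvInv.push_zero hslope hst'
        refine ⟨by omega, by omega, by omega, ?_, Or.inl ?_⟩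
        · rw [hins]; exact this.1
        · rw [hins]; exact this.2
      · refine ⟨fun h => by omega, fun _ => ?_⟩
        obtain ⟨n, hn⟩ : ∃ n, τ.nat 39 0 = n + 1 := ⟨τ.nat 39 0 - 1, by omega⟩
        rw [hn] at hm henv hst' ⊢
        rw [Nat.add_sub_cancel]
        refine ⟨fun h1 => ?_, fun h1 => ⟨fun h2 => ?_, fun h2 => ?_⟩⟩
        · have := henv.pop (l₀ := l₀) h1
          exact ⟨by omega, by omega, by omega, this.1, Or.inr ⟨ht, hokq, this.2⟩⟩
        · have := henv.skip hslope hst' (not_le.1 h1).le h2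
          refine ⟨by omega, by omega, by omega, ?_, Or.inl ?_⟩
          · rw [hins]; exact this.1
          · rw [hins]; exact this.2
        · have := henv.push hslope hst' (not_le.1 h1) (not_le.1 h2)
          rw [Function.update_of_ne (by omega : n ≠ n + 1), Function.update_of_ne (by omega : n ≠ n + 1)]
          refine ⟨by omega, by omega, by omega, ?_, Or.inl ?_⟩
          · rw [hins]; exact this.1
          · rw [hins]; exact this.2
    · have hst' := hst.resolve_right fun h => hokq h.2.1
      simp only [ne_eq, Store.real_setNat, Store.nat_setNat_of_ne, Nat.reduceEqDiff,
        not_false_eq_true, Store.nat_setNat_self, Function.update_self, ← hqdef]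
      rw [lineSet_succ_of_not_ok hokq]
      exact ⟨by omega, by omega, by omega, henv, Or.inl hst'⟩
  · rintro τ ⟨⟨m, -, hun, hq, htop, henv, hst⟩, ht⟩
    have k5 : τ.nat 5 = σ.nat 5 := hun.nat _ rfl
    simp only [Test.Holds, NatExpr.eval, k5, hu, not_le, not_lt] at ht
    obtain h : τ.nat 38 0 = u := le_antisymm hq ht
    rw [h] at henv hst htop
    exact ⟨htop, henv, hst.resolve_right fun h' => lt_irrefl _ h'.1⟩

/-- Compare the starting point with the number `11` with the best solution so far. -/
def tryStep : Prog :=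
  .letReal 46 (ra 52 (nv 11)) ;;
  .letReal 48 (ra 50 (nv 11) + ra 51 (nv 11) * rv 46 + (rv 42 + rv 43 * (rn (nc 1) - rv 46))) ;;
  .branch (.or (.natLe (nv 35) (nc 0)) (.realLt (rv 48) (rv 41)))
    (.letReal 41 (rv 48) ;; .letReal 40 (rn (na 0 (nc 2)) - rn (nv 30) - rv 46) ;;
      .letNat 35 (nc 1)) .skip

/-- Find the best leader's capacity on the linear piece with the number `36`. -/
def pieceProg : Prog :=
  (.letNat 30 (na 0 (nc 2) - nv 34 + nv 36) ;; .letNat 37 (na 0 (nc 2) - nv 30 - nc 1) ;;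
    .letReal 42 (ra 8 (nv 37)) ;; .letReal 43 (ra 0 (na 7 (nv 37)))) ;;
  envProg ;;
  (.letNat 41 (nv 39 - nc 1) ;; .setReal 50 (nv 39) (ra 50 (nv 41)) ;;
    .setReal 51 (nv 39) (ra 51 (nv 41)) ;; .setReal 52 (nv 39) (rn (nc 1))) ;;
  .forLoop 11 (nv 39 + nc 1) tryStep

/-- Compute the smallest and the largest leader's capacity. -/
def boundsProg : Prog :=
  .letNat 33 (na 0 (nc 2) - na 0 (nc 1)) ;; .letNat 34 (na 0 (nc 2)) ;;
  .branch (.natLt (na 0 (nc 0)) (nv 34)) (.letNat 34 (na 0 (nc 0))) .skip ;;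
  .letReal 40 (rn (nv 33)) ;; .letNat 35 (nc 0) ;; .setReal 8 (nc 0) (rn (nc 0))

/-- Compute the costs of the prefixes of the sorted leader's items. -/
def sumsProg : Prog :=
  .forLoop 10 (na 0 (nc 0))
    (.setReal 8 (nv 10 + nc 1) (ra 8 (nv 10) + ra 0 (na 7 (nv 10))))

/-- Write the fractional prefix of the sorted leader's items. -/
def prefixProg : Prog :=
  .forLoop 10 (na 0 (nc 0))
    (.branch (.realLe (rv 40) (rn (nv 10))) (.setReal 4 (na 7 (nv 10)) (rn (nc 0)))
      (.branch (.realLe (rn (nv 10) + rn (nc 1)) (rv 40)) (.setReal 4 (na 7 (nv 10)) (rn (nc 1)))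
        (.setReal 4 (na 7 (nv 10)) (rv 40 - rn (nv 10)))))

/-- The program for the leader's problem. -/
def leaderProg : Prog :=
  prepProg ;; sortBy (na 0 (nc 0)) (ra 0 (nv 10)) 7 ;;
  sortBy (nv 5) (ra 1 (na 2 (nv 10))) 8 ;;
  boundsProg ;; sumsProg ;; .forLoop 36 (nv 34 - nv 33) pieceProg ;; prefixProg

/-- The memory contains everything that is needed for the pieces. -/
structure LeaderReady (I : Instance (Fin nl) (Fin nf)) (σ : Store) : Prop where
  prep : Prepared I σ
  perm : IsSorting (σ.real 0) (σ.nat 7) nl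
  order : IsSorting (fun p => σ.real 1 (σ.nat 2 p)) (σ.nat 8) I.numValues
  sums : ∀ j, j ≤ nl → σ.real 8 j = ∑ i ∈ Finset.range j, σ.real 0 (σ.nat 7 i)
  hmin : σ.nat 33 0 = I.blMin
  hmax : σ.nat 34 0 = I.blMax

theorem LeaderReady.congr {I : Instance (Fin nl) (Fin nf)} {σ τ : Store} (h : LeaderReady I σ)
    (hn : ∀ a, (a < 9 ∨ a = 33 ∨ a = 34) → τ.nat a = σ.nat a)
    (hr : ∀ a, a < 9 → a ≠ 3 → a ≠ 4 → τ.real a = σ.real a) : LeaderReady I τ := by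
  have r0 := hr 0 (by decide) (by decide) (by decide)
  have r1 := hr 1 (by decide) (by decide) (by decide)
  have r8 := hr 8 (by decide) (by decide) (by decide)
  have n2 := hn 2 (by decide)
  have n7 := hn 7 (by decide)
  have n8 := hn 8 (by decide)
  refine ⟨h.prep.congr (fun a ha => hn a (by omega)) (fun a ha h3 h4 => hr a (by omega) h3 h4),
    ?_, ?_, ?_, ?_, ?_⟩
  · rw [r0, n7]; exact h.perm
  · rw [r1, n2, n8]; exact h.order
  · rw [r0, r8, n7]; exact h.sums
  · rw [hn 33 (by decide)]; exact h.hmin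
  · rw [hn 34 (by decide)]; exact h.hmax

/-- A sorting permutation as an equivalence. -/
noncomputable def IsSorting.equiv {key : ℕ → ℝ} {A : ℕ → ℕ} {N : ℕ} (h : IsSorting key A N) :
    Fin N ≃ Fin N :=
  Equiv.ofBijective (fun i => ⟨A i, h.lt i.2⟩)
    ⟨fun i j hij => Fin.ext (h.inj i.2 j.2 (Fin.val_eq_of_eq hij)), fun v => by
      obtain ⟨a, ha, hav⟩ := h.hit v v.2
      exact ⟨⟨a, ha⟩, Fin.ext hav⟩⟩

theorem IsSorting.equiv_val {key : ℕ → ℝ} {A : ℕ → ℕ} {N : ℕ} (h : IsSorting key A N)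
    (i : Fin N) : (h.equiv i : ℕ) = A i := rfl

theorem IsSorting.monotone_equiv {key : ℕ → ℝ} {A : ℕ → ℕ} {N : ℕ} (h : IsSorting key A N)
    {c : Fin N → ℝ} (hc : ∀ i : Fin N, key i = c i) : Monotone (c ∘ h.equiv) := by
  intro i j hij
  have := h.sorted i j (Nat.zero_le _) hij j.2
  simpa only [Function.comp_apply, ← hc, h.equiv_val] using this

namespace LeaderReady

variable {I : Instance (Fin nl) (Fin nf)} {σ : Store}

theorem plf_eq (h : LeaderReady I σ) {j : ℕ} (hj : j < nl) {t : ℝ} (h1 : (j : ℝ) ≤ t)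
    (h2 : t ≤ j + 1) : plf I.cl t = σ.real 8 j + σ.real 0 (σ.nat 7 j) * (t - j) := by
  rw [plf_eq_sum I.cl h.perm.equiv (h.perm.monotone_equiv h.prep.loaded.hcl),
    h.sums j hj.le, ← sum_range_mul_clamp (fun i => σ.real 0 (σ.nat 7 i)) hj h1 h2,
    Finset.sum_range]
  refine Finset.sum_congr rfl fun i _ => ?_
  rw [← h.prep.loaded.hcl, h.perm.equiv_val]

theorem isGreatest_iff (h : LeaderReady I σ) {k : ℕ} (hk : k < nf) {β s g : ℝ} (hs : β - k = s) :
    IsGreatest (I.guessValues k β) g ↔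
      (∃ l ∈ lineSet σ k I.numValues, lineAt l s = g) ∧
      ∀ l ∈ lineSet σ k I.numValues, lineAt l s ≤ g := by
  have hset : I.guessValues k β = {w | ∃ l ∈ lineSet σ k I.numValues, lineAt l s = w} := by
    rw [h.prep.guessValues_eq hk, hs]
    ext w
    constructor
    · rintro ⟨p, hp, hok, rfl⟩
      obtain ⟨r, hr, rfl⟩ := h.order.hit p hp
      exact ⟨_, ⟨r, hr, hok, rfl⟩, rfl⟩
    · rintro ⟨l, ⟨r, hr, hok, rfl⟩, rfl⟩
      exact ⟨_, h.order.lt hr, hok, rfl⟩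
  rw [hset]
  constructor
  · rintro ⟨h1, h2⟩
    exact ⟨h1, fun l hl => h2 ⟨l, hl, rfl⟩⟩
  · rintro ⟨h1, h2⟩
    exact ⟨h1, by rintro w ⟨l, hl, rfl⟩; exact h2 l hl⟩

end LeaderReady

/-- The variables `35`, `40` and `41` describe an optimal one among the candidates in `T`. -/
def BestOf (H : ℝ → ℝ) (t₀ : ℝ) (T : Set ℝ) (σ : Store) : Prop :=
  (σ.nat 35 0 = 0 ∧ σ.real 40 0 = t₀ ∧ T = ∅) ∨
  (σ.nat 35 0 = 1 ∧ σ.real 40 0 ∈ T ∧ σ.real 41 0 = H (σ.real 40 0) ∧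
    ∀ t ∈ T, σ.real 41 0 ≤ H t)

theorem BestOf.congr {H : ℝ → ℝ} {t₀ : ℝ} {T : Set ℝ} {σ τ : Store} (h : BestOf H t₀ T σ)
    (h1 : τ.nat 35 = σ.nat 35) (h2 : τ.real 40 = σ.real 40) (h3 : τ.real 41 = σ.real 41) :
    BestOf H t₀ T τ := by
  unfold BestOf at *
  rwa [h1, h2, h3]

/-- The condition `hH` is required only at the starting points, where the line on the stack gives
the true value of the objective. -/
theorem runs_tryLoop (σ : Store) {H : ℝ → ℝ} {t₀ : ℝ} {T : Set ℝ} {b k n : ℕ}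
    (hb : σ.nat 0 2 = b) (hk : σ.nat 30 0 = k) (hn : σ.nat 39 0 = n) (hbest : BestOf H t₀ T σ)
    (hH : ∀ i, i < n + 1 → H ((b : ℝ) - k - σ.real 52 i) =
      lineAt (σ.real 50 i, σ.real 51 i) (σ.real 52 i) +
        (σ.real 42 0 + σ.real 43 0 * (1 - σ.real 52 i))) :
    Runs (.forLoop 11 (nv 39 + nc 1) tryStep) σ (9 * n + 11) fun τ =>
      BestOf H t₀ (T ∪ {t | ∃ i, i < n + 1 ∧ t = (b : ℝ) - k - σ.real 52 i}) τ := by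
  refine (Runs.forLoop_const (n + 1) 7 (fun j τ =>
    BestOf H t₀ (T ∪ {t | ∃ i, i < j ∧ t = (b : ℝ) - k - σ.real 52 i}) τ) rfl ?_ ?_ ?_).mono
    (by omega) fun τ h => h.2
  · intro τ hτ
    have h39 : τ.nat 39 = σ.nat 39 := hτ.nat _ rfl
    simp [h39, hn]
  · simpa [BestOf] using hbest
  · intro j τ hj hτ hτj hinv
    have hT : T ∪ {t | ∃ i, i < j + 1 ∧ t = (b : ℝ) - k - σ.real 52 i} =
        insert ((b : ℝ) - k - σ.real 52 j)
          (T ∪ {t | ∃ i, i < j ∧ t = (b : ℝ) - k - σ.real 52 i}) := by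
      ext t
      constructor
      · rintro (h | ⟨i, h1, rfl⟩)
        · exact Or.inr (Or.inl h)
        · rcases Nat.lt_succ_iff_lt_or_eq.1 h1 with h3 | rfl
          · exact Or.inr (Or.inr ⟨i, h3, rfl⟩)
          · exact Or.inl rfl
      · rintro (rfl | h | ⟨i, h1, rfl⟩)
        · exact Or.inr ⟨j, by omega, rfl⟩
        · exact Or.inl h
        · exact Or.inr ⟨i, by omega, rfl⟩
    rw [hT]
    set T' := T ∪ {t | ∃ i, i < j ∧ t = (b : ℝ) - k - σ.real 52 i}
    set t := (b : ℝ) - k - σ.real 52 j with ht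
    have k0 : τ.nat 0 = σ.nat 0 := hτ.nat _ rfl
    have k30 : τ.nat 30 = σ.nat 30 := hτ.nat _ rfl
    have k50 : τ.real 50 = σ.real 50 := hτ.real _ rfl
    have k51 : τ.real 51 = σ.real 51 := hτ.real _ rfl
    have k52 : τ.real 52 = σ.real 52 := hτ.real _ rfl
    have k42 : τ.real 42 = σ.real 42 := hτ.real _ rfl
    have k43 : τ.real 43 = σ.real 43 := hτ.real _ rfl
    have hval : σ.real 50 j + σ.real 51 j * σ.real 52 j +
        (σ.real 42 0 + σ.real 43 0 * (1 - σ.real 52 j)) = H t := (hH j hj).symm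
    refine Runs.of_wp ?_ (by decide)
    simp only [tryStep, Prog.wp, Test.Holds]
    simp only [NatExpr.eval, RealExpr.eval, Store.nat_setNat_self, ne_eq, Store.real_setNat,
      Store.nat_setNat_of_ne, Function.update_self, Nat.reduceEqDiff, not_false_eq_true,
      Store.nat_setReal, Store.real_setReal_self, Store.real_setReal_of_ne,
      RealExpr.eval_sub, hτj, k0, k30, k50, k51, k52, k42, k43, hb, hk,
      Nat.cast_one, hval, ← ht, BestOf]
    constructor
    · intro h
      refine Or.inr ⟨trivial, Or.inl rfl, trivial, ?_⟩
      rintro t' (rfl | ht')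
      · exact le_rfl
      · rcases hinv with ⟨-, -, h2⟩ | ⟨h1, -, -, h2⟩
        · rw [h2] at ht'; exact ht'.elim
        · have h3 : ¬ τ.real 41 0 ≤ H t := fun h3 => h ⟨by omega, fun h4 => h4 h3⟩
          exact (not_le.1 h3).le.trans (h2 t' ht')
    · intro h
      have h4 : ¬ τ.nat 35 0 ≤ 0 ∧ τ.real 41 0 ≤ H t := by
        simpa using h
      rcases hinv with ⟨h1, -⟩ | ⟨h1, h2, h3, h5⟩
      · exact absurd h1.le h4.1
      · refine Or.inr ⟨h1, Or.inr h2, h3, ?_⟩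
        rintro t' (rfl | ht')
        · exact h4.2
        · exact h5 t' ht'

/-- The coordinate s = b - k - t is the fraction of the follower's fractional item. In it the piece
is `[0, 1]`, the follower's part is the envelope of the lines, and the leader's part is linear. -/
theorem runs_pieceProg {I : Instance (Fin nl) (Fin nf)} (σ : Store) (h : LeaderReady I σ)
    {gf : ℝ → ℝ} (hgf : I.IsFollowerPLF gf) {t₀ : ℝ} {T : Set ℝ} {j k : ℕ} (hj : σ.nat 36 0 = j)
    (hk : I.b - I.blMax + j = k) (hkj : k < I.b - I.blMin)
    (hbest : BestOf (fun t => plf I.cl t + gf t) t₀ T σ) :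
    Runs pieceProg σ (63 * I.numValues + 22) fun τ => ∃ T' : Set ℝ,
      BestOf (fun t => plf I.cl t + gf t) t₀ (T ∪ T') τ ∧
      (∀ t ∈ T', (I.b : ℝ) - k - 1 ≤ t ∧ t ≤ (I.b : ℝ) - k) ∧
      ∀ t, (I.b : ℝ) - k - 1 ≤ t → t ≤ (I.b : ℝ) - k →
        ∃ t' ∈ T', plf I.cl t' + gf t' ≤ plf I.cl t + gf t := by
  have hbmax : I.blMax ≤ I.b := min_le_left _ _
  have hbmax' : I.blMax ≤ nl := (min_le_right _ _).trans (Fintype.card_fin nl).le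
  have hknf : k < nf := by simpa using I.lt_card_of_piece hkj
  -- On this piece the leader's capacity runs from `i₀` to `i₀ + 1`, so only the item in position
  -- `i₀` of the sorted order is fractional.
  obtain ⟨i₀, hi₀⟩ : ∃ i, i = I.b - k - 1 := ⟨_, rfl⟩
  have hi₀' : i₀ < nl := by omega
  have hcast : (i₀ : ℝ) = (I.b : ℝ) - k - 1 := by
    have : ((i₀ + k + 1 : ℕ) : ℝ) = I.b := by congr 1; omega
    push_cast at this
    linarith
  refine Runs.mono (m := 4 + (54 * I.numValues + 3 + (4 + (9 * I.numValues + 11)))) ?_ (by omega)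
    fun _ => id
  refine (Runs.of_wp (Q := fun τ => τ.nat 30 0 = k ∧ τ.real 42 0 = σ.real 8 i₀ ∧
    τ.real 43 0 = σ.real 0 (σ.nat 7 i₀)) ?_ le_rfl).seq fun τ₁ u₁ q₁ => ?_
  · simp [Prog.wp, h.prep.loaded.hb, h.hmax, hj, hk, ← hi₀]
  obtain ⟨q30, q42, q43⟩ := q₁
  have hset : lineSet τ₁ k I.numValues = lineSet σ k I.numValues := by
    unfold lineSet okAt lineOf
    rw [u₁.nat 8 rfl, u₁.nat 4 rfl, u₁.nat 6 rfl, u₁.nat 2 rfl, u₁.real 7 rfl, u₁.real 1 rfl]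
  refine (runs_envProg τ₁ (u := I.numValues) (by rw [u₁.nat 5 rfl, h.prep.pairs.hu]) q30
    (by rw [u₁.real 1 rfl, u₁.nat 2 rfl, u₁.nat 8 rfl]; exact h.order)).seq fun τ₂ u₂ q₂ => ?_
  obtain ⟨htop, henv, hfresh⟩ := q₂
  rw [hset] at henv hfresh
  -- There is a guess for every `k < nf`, so the stack is not empty.
  obtain ⟨m, hm⟩ : ∃ m, τ₂.nat 39 0 = m + 1 := by
    rcases Nat.eq_zero_or_pos (τ₂.nat 39 0) with h0 | h0
    · obtain ⟨g, hg⟩ := I.exists_isGreatest_guessValues (k := k) (by simpa using hknf) k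
      obtain ⟨⟨l, hl, -⟩, -⟩ := (h.isGreatest_iff hknf (s := 0) (by ring)).1 hg
      rw [hfresh.1 h0] at hl
      exact hl.elim
    · exact ⟨τ₂.nat 39 0 - 1, by omega⟩
  rw [hm] at henv hfresh htop
  have hclose := henv.close hfresh
  refine (Runs.of_wp (Q := fun τ => τ.nat 39 0 = m + 1 ∧
    τ.real 50 = Function.update (τ₂.real 50) (m + 1) (τ₂.real 50 m) ∧
    τ.real 51 = Function.update (τ₂.real 51) (m + 1) (τ₂.real 51 m) ∧
    τ.real 52 = Function.update (τ₂.real 52) (m + 1) 1) (by simp [Prog.wp, hm]) le_rfl).seq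
    fun τ₃ u₃ q₃ => ?_
  obtain ⟨q39, q50, q51, q52⟩ := q₃
  rw [← q50, ← q51, ← q52] at hclose
  have hlast : τ₃.real 52 (m + 1) = 1 := by rw [q52, Function.update_self]
  have h42 : τ₃.real 42 0 = σ.real 8 i₀ := by rw [u₃.real 42 rfl, u₂.real 42 rfl, q42]
  have h43 : τ₃.real 43 0 = σ.real 0 (σ.nat 7 i₀) := by
    rw [u₃.real 43 rfl, u₂.real 43 rfl, q43]
  have h30 : τ₃.nat 30 0 = k := by rw [u₃.nat 30 rfl, u₂.nat 30 rfl, q30]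
  have hb : τ₃.nat 0 2 = I.b := by
    rw [u₃.nat 0 rfl, u₂.nat 0 rfl, u₁.nat 0 rfl, h.prep.loaded.hb]
  have hbest₃ : BestOf (fun t => plf I.cl t + gf t) t₀ T τ₃ :=
    ((hbest.congr (u₁.nat _ rfl) (u₁.real _ rfl) (u₁.real _ rfl)).congr (u₂.nat _ rfl)
      (u₂.real _ rfl) (u₂.real _ rfl)).congr (u₃.nat _ rfl) (u₃.real _ rfl) (u₃.real _ rfl)
  have hplf : ∀ s, 0 ≤ s → s ≤ 1 →
      plf I.cl ((I.b : ℝ) - k - s) = τ₃.real 42 0 + τ₃.real 43 0 * (1 - s) := by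
    intro s h0 h1
    rw [h.plf_eq hi₀' (by linarith) (by linarith), h42, h43, hcast]
    ring
  have hgfs : ∀ s, 0 ≤ s → s ≤ 1 →
      (∃ l ∈ lineSet σ k I.numValues, lineAt l s = gf ((I.b : ℝ) - k - s)) ∧
      ∀ l ∈ lineSet σ k I.numValues, lineAt l s ≤ gf ((I.b : ℝ) - k - s) := by
    intro s h0 h1
    exact (h.isGreatest_iff hknf (by ring)).1 (Instance.isFollowerPLF_iff.1 hgf k (by omega) hkj
      ((I.b : ℝ) - k - s) (by linarith) (by linarith))
  -- In a starting point the line on the stack dominates all lines and is one of them, so its value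
  -- is that of `gf`.
  have hcand : ∀ i, i < m + 1 + 1 → gf ((I.b : ℝ) - k - τ₃.real 52 i) =
      lineAt (τ₃.real 50 i, τ₃.real 51 i) (τ₃.real 52 i) := by
    intro i hi
    obtain ⟨⟨l, hl, h1⟩, h2⟩ := hgfs _ (hclose.nonneg i hi) (hclose.le_one i hi)
    refine le_antisymm ?_ (h2 _ (hclose.mem i hi))
    rw [← h1]
    exact hclose.dom l hl i hi
  refine (runs_tryLoop τ₃ hb h30 q39 hbest₃ ?_).mono (by omega) fun τ₄ q₄ => ⟨_, q₄, ?_, ?_⟩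
  · intro i hi
    rw [hcand i hi, hplf _ (hclose.nonneg i hi) (hclose.le_one i hi), add_comm]
  · rintro t ⟨i, hi, rfl⟩
    have h1 := hclose.nonneg i hi
    have h2 := hclose.le_one i hi
    constructor <;> linarith
  · intro t ht1 ht2
    obtain ⟨s, hs⟩ : ∃ s, s = (I.b : ℝ) - k - t := ⟨_, rfl⟩
    obtain rfl : t = (I.b : ℝ) - k - s := by linarith
    have h0 : 0 ≤ s := by linarith
    have h1 : s ≤ 1 := by linarith
    -- As s grows, the leader's capacity falls, so his part of the cost has slope minus the cost of
    -- the item `i₀`.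
    obtain ⟨i, hi, hle⟩ := hclose.exists_candidate (ν := -τ₃.real 43 0) (by omega) h0
      (by rw [show m + 2 - 1 = m + 1 from rfl, hlast]; exact h1) (hgfs s h0 h1).2
    refine ⟨_, ⟨i, hi, rfl⟩, ?_⟩
    rw [hcand i hi, hplf _ (hclose.nonneg i hi) (hclose.le_one i hi), hplf s h0 h1]
    linarith

theorem runs_prefixProg {I : Instance (Fin nl) (Fin nf)} (σ : Store) (h : LeaderReady I σ)
    {bl : ℝ} (hbl : σ.real 40 0 = bl) (h0 : 0 ≤ bl) (h1 : bl ≤ nl) :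
    Runs prefixProg σ (7 * nl + 2) fun τ => IsContSelection bl I.cl (τ.output nl) := by
  refine (Runs.forLoop_const nl 5 (fun j τ => ∀ i, i < j → τ.real 4 (σ.nat 7 i) = clamp bl i) rfl
    ?_ ?_ ?_).mono (by omega) ?_
  · intro τ hτ
    have k0 : τ.nat 0 = σ.nat 0 := hτ.nat _ rfl
    simp [k0, h.prep.loaded.hnl]
  · intro i hi; omega
  · intro j τ hj hτ hτj hinv
    have k7 : τ.nat 7 = σ.nat 7 := hτ.nat _ rfl
    have k40 : τ.real 40 0 = bl := by rw [hτ.real 40 rfl, hbl]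
    have hout : ∀ v : ℝ, v = clamp bl j → ∀ i, i < j + 1 →
        Function.update (τ.real 4) (σ.nat 7 j) v (σ.nat 7 i) = clamp bl i := by
      intro v hv i hi
      rcases Nat.lt_succ_iff_lt_or_eq.1 hi with h2 | rfl
      · rw [Function.update_of_ne fun he => h2.ne (h.perm.inj (by omega) hj he)]
        exact hinv i h2
      · rw [Function.update_self, hv]
    refine Runs.of_wp ?_ (by decide)
    simp only [Prog.wp, Test.Holds, not_le]
    simp only [NatExpr.eval, RealExpr.eval, Store.real_setNat,
      RealExpr.eval_sub, Store.real_setReal_self, hτj, k7, k40, Nat.cast_one, Nat.cast_zero]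
    refine ⟨fun h2 => hout _ (clamp_of_le h2).symm, fun h2 => ⟨fun h3 =>
      hout _ (clamp_of_ge h3).symm, fun h3 => hout _ (clamp_of_mem h2.le h3.le).symm⟩⟩
  · rintro τ ⟨-, hτ⟩
    convert isContSelection_clamp I.cl h.perm.equiv (h.perm.monotone_equiv h.prep.loaded.hcl) h0 h1
      using 1
    funext a
    obtain ⟨i, rfl⟩ := h.perm.equiv.surjective a
    rw [Equiv.symm_apply_apply, ← hτ i i.2]
    rfl

/-- A bound on the running time of `leaderProg`. -/
def leaderTime (nl nf u : ℕ) : ℕ :=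
  prepTime nf u + sortTime nl + sortTime u + nf * (63 * u + 24) + 10 * nl + 15

theorem runs_leaderProg {I : Instance (Fin nl) (Fin nf)} (σ : Store) (hl : Loaded I σ)
    (hfresh : ∀ q, σ.nat 4 q = 0) :
    Runs leaderProg σ (leaderTime nl nf I.numValues) fun τ => I.LeaderAlg (τ.output nl) := by
  refine Runs.mono (m := prepTime nf I.numValues + (sortTime nl + (sortTime I.numValues +
    (9 + (nl * (1 + 2) + 2 + (nf * (63 * I.numValues + 24) + 2 + (7 * nl + 2))))))) ?_
    (by rw [leaderTime]; omega) fun _ => id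
  refine (runs_prepProg σ hl hfresh).seq fun τ₁ u₁ hp₁ => ?_
  refine (runs_sortBy τ₁ (N := nl) (K := τ₁.real 0) (by decide) (by simp [hp₁.loaded.hnl])
    ?_).seq fun τ₂ u₂ hs₂ => ?_
  · intro j ρ _ _ hr hj
    simp [hj, hr 0 (by decide)]
  have hp₂ : Prepared I τ₂ := by
    refine hp₁.congr (fun a ha => ?_) (fun a ha _ _ => ?_)
    · interval_cases a <;> exact u₂.nat _ rfl
    · interval_cases a <;> exact u₂.real _ rfl
  refine (runs_sortBy τ₂ (N := I.numValues) (K := fun p => τ₂.real 1 (τ₂.nat 2 p)) (by decide)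
    (by simp [hp₂.pairs.hu]) ?_).seq fun τ₃ u₃ hs₃ => ?_
  · intro j ρ _ hn hr hj
    simp [hj, hr 1 (by decide), hn 2 (by decide)]
  have hp₃ : Prepared I τ₃ := by
    refine hp₂.congr (fun a ha => ?_) (fun a ha _ _ => ?_)
    · interval_cases a <;> exact u₃.nat _ rfl
    · interval_cases a <;> exact u₃.real _ rfl
  have hperm₃ : IsSorting (τ₃.real 0) (τ₃.nat 7) nl := by
    rw [u₃.real 0 rfl, u₃.nat 7 rfl, u₂.real 0 rfl]; exact hs₂
  have hord₃ : IsSorting (fun p => τ₃.real 1 (τ₃.nat 2 p)) (τ₃.nat 8) I.numValues := by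
    rw [u₃.real 1 rfl, u₃.nat 2 rfl]; exact hs₃
  refine (Runs.of_wp (P := boundsProg) (Q := fun τ => τ.nat 33 0 = I.blMin ∧
    τ.nat 34 0 = I.blMax ∧ τ.nat 35 0 = 0 ∧ τ.real 40 0 = I.blMin ∧ τ.real 8 0 = 0) ?_
    (by decide)).seq fun τ₄ u₄ q₄ => ?_
  · have hb := hp₃.loaded.hb
    have hnl := hp₃.loaded.hnl
    have hnf := hp₃.loaded.hnf
    simp only [boundsProg, Prog.wp, Test.Holds]
    simp only [NatExpr.eval, RealExpr.eval, Store.nat_setNat_self, ne_eq, Store.real_setNat,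
      Store.nat_setNat_of_ne, Function.update_self, Nat.reduceEqDiff, not_false_eq_true,
      Store.nat_setReal, Store.real_setReal_self, Store.real_setReal_of_ne,
      NatExpr.eval_sub, hb, hnl, hnf, Instance.blMin, Instance.blMax, Fintype.card_fin,
      Nat.cast_zero, and_true, true_and]
    constructor <;> intro h <;> omega
  obtain ⟨q33, q34, q35, q40, q8⟩ := q₄
  have hn₄ : ∀ a, a < 9 → τ₄.nat a = τ₃.nat a := fun a ha =>
    u₄.nat a (by simp [boundsProg, Prog.writesNat]; omega)
  have hr₄ : ∀ a, a < 8 → τ₄.real a = τ₃.real a := fun a ha =>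
    u₄.real a (by simp [boundsProg, Prog.writesReal]; omega)
  refine (Runs.forLoop_const (i := 10) (e := na 0 (nc 0)) nl 1 (fun j τ => ∀ i, i ≤ j →
    τ.real 8 i = ∑ i' ∈ Finset.range i, τ₃.real 0 (τ₃.nat 7 i')) (P := .setReal 8 (nv 10 + nc 1)
    (ra 8 (nv 10) + ra 0 (na 7 (nv 10)))) rfl ?_ ?_ ?_).seq fun τ₅ u₅ q₅ => ?_
  · intro τ hτ
    have k0 : τ.nat 0 = τ₃.nat 0 := (hτ.nat _ rfl).trans (hn₄ 0 (by decide))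
    simp [k0, hp₃.loaded.hnl]
  · intro i hi
    obtain rfl : i = 0 := by omega
    simpa using q8
  · intro j τ hj hτ hτj hinv
    have k7 : τ.nat 7 = τ₃.nat 7 := (hτ.nat _ rfl).trans (hn₄ 7 (by decide))
    have k0 : τ.real 0 = τ₃.real 0 := (hτ.real _ rfl).trans (hr₄ 0 (by decide))
    refine Runs.of_wp ?_ le_rfl
    intro i hi
    simp only [NatExpr.eval, RealExpr.eval, Store.real_setNat,
      Store.real_setReal_self, hτj, k7, k0]
    by_cases h1 : i = j + 1
    · rw [h1, Function.update_self, hinv j le_rfl, Finset.sum_range_succ]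
    · rw [Function.update_of_ne h1, hinv i (by omega)]
  have hready : LeaderReady I τ₅ := by
    have hn₅ : ∀ a, a < 9 → τ₅.nat a = τ₃.nat a := fun a ha =>
      (u₅.nat a (by simp [Prog.forLoop, Prog.writesNat]; omega)).trans (hn₄ a ha)
    have hr₅ : ∀ a, a < 8 → τ₅.real a = τ₃.real a := fun a ha =>
      (u₅.real a (by simp [Prog.forLoop, Prog.writesReal]; omega)).trans (hr₄ a ha)
    refine ⟨hp₃.congr (fun a ha => hn₅ a (by omega)) (fun a ha _ _ => hr₅ a ha), ?_, ?_, ?_, ?_, ?_⟩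
    · rw [hr₅ 0 (by decide), hn₅ 7 (by decide)]; exact hperm₃
    · rw [hr₅ 1 (by decide), hn₅ 2 (by decide), hn₅ 8 (by decide)]; exact hord₃
    · rw [hr₅ 0 (by decide), hn₅ 7 (by decide)]; exact q₅.2
    · rw [u₅.nat 33 rfl, q33]
    · rw [u₅.nat 34 rfl, q34]
  -- The function `gf` occurs only in the analysis; the program evaluates lines at breakpoints.
  obtain ⟨gf, hgf⟩ := I.exists_isFollowerPLF
  have hN : I.blMax - I.blMin ≤ nf := by
    rw [Instance.blMax, Instance.blMin, Fintype.card_fin, Fintype.card_fin]; omega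
  have hbmax : I.blMax ≤ I.b := min_le_left _ _
  have hbminmax := I.blMin_le_blMax
  have hready' : ∀ τ, Unchanged (.forLoop 36 (nv 34 - nv 33) pieceProg) τ₅ τ → LeaderReady I τ := by
    intro τ hτ
    refine hready.congr (fun a ha => hτ.nat a ?_) (fun a ha _ _ => hτ.real a ?_)
    · simp [Prog.forLoop, pieceProg, envProg, envStep, envPush, tryStep, Prog.writesNat]
      omega
    · simp [Prog.forLoop, pieceProg, envProg, envStep, envPush, tryStep, Prog.writesReal]
      omega
  have hbest₅ : BestOf (fun t => plf I.cl t + gf t) I.blMin ∅ τ₅ :=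
    Or.inl ⟨by rw [u₅.nat 35 rfl, q35], by rw [u₅.real 40 rfl, q40], rfl⟩
  -- After `j` rounds the candidates `T` contain, for every point of the first `j` pieces, one that
  -- is at least as good. If there is no piece, the initial value `blMin` remains.
  have hloop := Runs.forLoop_const (σ := τ₅) (i := 36) (e := nv 34 - nv 33) (P := pieceProg)
    (I.blMax - I.blMin) (63 * I.numValues + 22) (fun j τ => ∃ T : Set ℝ,
      BestOf (fun t => plf I.cl t + gf t) I.blMin T τ ∧
      (∀ t ∈ T, t ∈ Set.Icc (I.blMin : ℝ) I.blMax) ∧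
      ∀ k, I.b - I.blMax ≤ k → k < I.b - I.blMax + j → ∀ t, (I.b : ℝ) - k - 1 ≤ t →
        t ≤ (I.b : ℝ) - k → ∃ t' ∈ T, plf I.cl t' + gf t' ≤ plf I.cl t + gf t) rfl ?_ ?_ ?_
  · refine (hloop.mono (m' := nf * (63 * I.numValues + 24) + 2)
      (Nat.add_le_add_right (Nat.mul_le_mul_right _ hN) 2) fun _ => id).seq fun τ₆ _ q₆ => ?_
    obtain ⟨u₆, T, hbest, hT, hopt⟩ := q₆
    have hready₆ := hready' τ₆ u₆
    have hmem : τ₆.real 40 0 ∈ Set.Icc (I.blMin : ℝ) I.blMax := by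
      rcases hbest with ⟨-, h1, -⟩ | ⟨-, h1, -⟩
      · rw [h1]
        exact ⟨le_rfl, by exact_mod_cast hbminmax⟩
      · exact hT _ h1
    have hmem' := (Instance.mem_Icc_iff.1 hmem).1
    rw [Fintype.card_fin] at hmem'
    refine (runs_prefixProg τ₆ hready₆ rfl hmem'.1 hmem'.2).mono le_rfl fun τ₇ hx =>
      ⟨_, ?_, hx⟩
    by_cases hne : I.blMin = I.blMax
    · rw [if_pos hne]
      rw [← hne] at hmem
      exact le_antisymm hmem.2 hmem.1
    · rw [if_neg hne]
      refine ⟨gf, hgf, hmem, fun t ht => ?_⟩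
      obtain ⟨k, hk1, hk2, ht1, ht2⟩ := Instance.exists_piece hne ht
      obtain ⟨t', ht', hle⟩ := hopt k hk1 (by omega) t ht1 ht2
      rcases hbest with ⟨-, -, h1⟩ | ⟨-, -, h1, h2⟩
      · rw [h1] at ht'; exact ht'.elim
      · exact (h1.symm.le.trans (h2 t' ht')).trans hle
  · intro τ hτ
    have hr := hready' τ hτ
    simp [hr.hmin, hr.hmax]
  · refine ⟨∅, hbest₅.congr ?_ rfl rfl, by simp, fun k h1 h2 => by omega⟩
    simp
  · rintro j τ hj hτ hτj ⟨T, hbest, hT, hopt⟩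
    have hr := hready' τ hτ
    refine (runs_pieceProg τ hr hgf hτj rfl (by omega) hbest).mono le_rfl ?_
    rintro τ' ⟨T', hbest', hT', hopt'⟩
    refine ⟨T ∪ T', hbest'.congr (by simp) rfl rfl, ?_, ?_⟩
    · rintro t (ht | ht)
      · exact hT t ht
      · have h1 := hT' t ht
        have h2 : ((I.b - I.blMax + j : ℕ) : ℝ) = I.b - I.blMax + j := by
          push_cast [hbmax]; ring
        have h3 : ((I.blMin + j + 1 : ℕ) : ℝ) ≤ I.blMax := by
          exact_mod_cast (by omega : I.blMin + j + 1 ≤ I.blMax)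
        push_cast at h3
        rw [h2] at h1
        have h4 : (0 : ℝ) ≤ j := Nat.cast_nonneg j
        exact ⟨by linarith, by linarith⟩
    · intro k hk1 hk2 t ht1 ht2
      by_cases h1 : k = I.b - I.blMax + j
      · subst h1
        obtain ⟨t', h2, h3⟩ := hopt' t ht1 ht2
        exact ⟨t', Or.inr h2, h3⟩
      · obtain ⟨t', h2, h3⟩ := hopt k hk1 (by omega) t ht1 ht2
        exact ⟨t', Or.inl h2, h3⟩

/-! ### Asymptotic running times -/

variable {nl nf : ℕ}

theorem Instance.card_le_numValues (I : Instance (Fin nl) (Fin nf)) : nf ≤ I.numValues := by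
  calc nf = ∑ _e : Fin nf, 1 := by simp
    _ ≤ ∑ e, (I.U e).card := Finset.sum_le_sum fun e _ => (I.U_nonempty e).card_pos

theorem sortTime_le {m N : ℕ} (h : m ≤ N) (hN : 1 ≤ N) :
    sortTime m ≤ Nat.clog 2 N * (32 * N) + 18 * N := by
  have h1 : Nat.clog 2 m ≤ Nat.clog 2 N := Nat.clog_mono_right 2 h
  have h2 : Nat.clog 2 m * (26 * m + 6) ≤ Nat.clog 2 N * (32 * N) :=
    Nat.mul_le_mul h1 (by omega)
  rw [sortTime]
  omega

/-- The crude bound `Nat.clog 2 m ≤ m` suffices for the adversary, where a quadratic term in the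
number of follower's items is affordable. -/
theorem sortTime_le_mul_self (m : ℕ) : sortTime m ≤ 41 * (m * m) + 9 := by
  have h1 : Nat.clog 2 m ≤ m := Nat.clog_le_of_le_pow Nat.lt_two_pow_self.le
  have h2 : Nat.clog 2 m * (26 * m + 6) ≤ m * (26 * m + 6) := Nat.mul_le_mul_right _ h1
  have h3 : m ≤ m * m := Nat.le_mul_self m
  rw [sortTime]
  nlinarith

/-- The quadratic term from sorting is absorbed through `nf ≤ u`, which holds because no set of
costs is empty. -/
theorem adversaryTime_le {u : ℕ} (hu : nf ≤ u) (hN : 1 ≤ (nl + nf) * u) :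
    adversaryTime nl nf u ≤ 200 * ((nl + nf) * u) := by
  have hpos' : 0 < nl + nf := Nat.pos_of_ne_zero fun h => by simp [h] at hN
  have h1 : nl + nf ≤ (nl + nf) * u := Nat.le_mul_of_pos_right _ (by nlinarith)
  have h2 : u ≤ (nl + nf) * u := Nat.le_mul_of_pos_left _ hpos'
  have h3 : nf * u ≤ (nl + nf) * u := Nat.mul_le_mul_right _ (by omega)
  have h4 : nf * nf ≤ nf * u := Nat.mul_le_mul_left _ hu
  have h5 := sortTime_le_mul_self nf
  rw [adversaryTime, prepTime]
  omega

/-- None of the three sorted arrays is longer than nu, so sorting contributes 3 · 32 = 96 times the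
logarithmic term. At most `nf` pieces take linear time in `u` each. -/
theorem leaderTime_le {u : ℕ} (hN : 1 ≤ (nl + nf) * u) :
    leaderTime nl nf u ≤
      96 * (Nat.clog 2 ((nl + nf) * u) * ((nl + nf) * u)) + 240 * ((nl + nf) * u) := by
  have hpos' : 0 < nl + nf := Nat.pos_of_ne_zero fun h => by simp [h] at hN
  have hu : 0 < u := Nat.pos_of_ne_zero fun h => by simp [h] at hN
  have h1 : nl + nf ≤ (nl + nf) * u := Nat.le_mul_of_pos_right _ hu
  have h2 : u ≤ (nl + nf) * u := Nat.le_mul_of_pos_left _ hpos'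
  have h3 : nf * u ≤ (nl + nf) * u := Nat.mul_le_mul_right _ (by omega)
  have h4 := sortTime_le (m := nf) (by omega) hN
  have h5 := sortTime_le (m := nl) (by omega) hN
  have h6 := sortTime_le h2 hN
  have h7 : nf * (63 * u + 24) = 63 * (nf * u) + 24 * nf := by ring
  rw [leaderTime, prepTime, h7]
  rw [Nat.mul_left_comm] at h4 h5 h6
  omega

/-- From N ≥ 2 one has log N ≥ log 2 > 1/2, so additive constants and the rounding in `Nat.clog` are
absorbed by multiples of log N. -/
theorem natClog_two_le {N : ℕ} (hN : 2 ≤ N) :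
    (1 : ℝ) ≤ 2 * Real.log N ∧ (Nat.clog 2 N : ℝ) ≤ 4 * Real.log N := by
  have h2 := Real.log_two_gt_d9
  have hlog : Real.log 2 ≤ Real.log N :=
    Real.log_le_log (by norm_num) (by exact_mod_cast hN)
  have h3 : ((2 ^ Nat.log 2 N : ℕ) : ℝ) ≤ N := by
    exact_mod_cast Nat.pow_log_le_self 2 (by omega)
  have h4 : (Nat.log 2 N : ℝ) * Real.log 2 ≤ Real.log N := by
    rw [← Real.log_pow]
    exact Real.log_le_log (by positivity) (by exact_mod_cast h3)
  have h5 : Nat.clog 2 N ≤ Nat.log 2 N + 1 :=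
    Nat.clog_le_of_le_pow (Nat.lt_pow_succ_log_self (by norm_num) N).le
  have h6 : (Nat.clog 2 N : ℝ) ≤ Nat.log 2 N + 1 := by exact_mod_cast h5
  have h7 : (0 : ℝ) ≤ Nat.log 2 N := Nat.cast_nonneg _
  constructor <;> nlinarith

theorem leaderTime_le_log {u : ℕ} (hN : 2 ≤ (nl + nf) * u) :
    (leaderTime nl nf u : ℝ) ≤
      1000 * (((nl + nf) * u : ℕ) : ℝ) * Real.log (((nl + nf) * u : ℕ) : ℝ) := by
  have h1 := leaderTime_le (nl := nl) (nf := nf) (u := u) (by omega)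
  generalize (nl + nf) * u = N at *
  obtain ⟨h2, h3⟩ := natClog_two_le hN
  have h4 : (leaderTime nl nf u : ℝ) ≤ 96 * (Nat.clog 2 N * N) + 240 * N := by exact_mod_cast h1
  have h5 : (0 : ℝ) ≤ N := Nat.cast_nonneg _
  have h6 := mul_le_mul_of_nonneg_right h2 h5
  have h7 := mul_le_mul_of_nonneg_right h3 h5
  -- The constants give 96 · 4 + 240 · 2 = 864 ≤ 1000.
  nlinarith [mul_nonneg h5 (by linarith : (0 : ℝ) ≤ Real.log N)]

end BilevelSelection

/-! ### Correctness and running times combined. -/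

theorem mainTheorem6 :
    -- the adversary's algorithm is correct
    (∀ (L F : Type*) [Fintype L] [Fintype F] [DecidableEq F]
        (I : BilevelSelection.Instance L F) (s : BilevelSelection.Setting),
      s = .pessimistic ∨ (∀ e e' : F, e ≠ e' → Disjoint (I.U e) (I.U e')) →
      ∀ x : L → ℝ, I.IsLeaderFeasible x →
        (∃ d, I.AdversaryAlg x d) ∧ ∀ d, I.AdversaryAlg x d → I.IsAdversaryOptimal s x d) ∧
    -- the leader's algorithm is correct
    (∀ (L F : Type*) [Fintype L] [Fintype F] [DecidableEq F]
        (I : BilevelSelection.Instance L F) (s : BilevelSelection.Setting),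
      s = .pessimistic ∨ (∀ e e' : F, e ≠ e' → Disjoint (I.U e) (I.U e')) →
        (∃ x, I.LeaderAlg x) ∧ ∀ x, I.LeaderAlg x → I.IsLeaderOptimal s x) ∧
    -- the adversary's algorithm can be run in time `O(n u)`
    (∃ (P : BilevelSelection.Prog) (C : ℕ), ∀ (nl nf : ℕ)
        (I : BilevelSelection.Instance (Fin nl) (Fin nf)) (V : Fin nf → List ℝ) (x : Fin nl → ℝ),
      I.IsListing V → I.IsLeaderFeasible x →
        ∃ (k : ℕ) (τ : BilevelSelection.Store),
          BilevelSelection.Exec P (I.adversaryInput V x) k τ ∧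
          I.AdversaryAlg x (τ.output nf) ∧
          (1 ≤ I.numItems * I.numValues → k ≤ C * (I.numItems * I.numValues))) ∧
    -- the leader's algorithm can be run in time `O(n u log (n u))`
    (∃ (P : BilevelSelection.Prog) (C : ℝ), ∀ (nl nf : ℕ)
        (I : BilevelSelection.Instance (Fin nl) (Fin nf)) (V : Fin nf → List ℝ),
      I.IsListing V →
        ∃ (k : ℕ) (τ : BilevelSelection.Store),
          BilevelSelection.Exec P (I.leaderInput V) k τ ∧
          I.LeaderAlg (τ.output nl) ∧
          (2 ≤ I.numItems * I.numValues →
            (k : ℝ) ≤ C * ((I.numItems * I.numValues : ℕ) : ℝ) *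
              Real.log ((I.numItems * I.numValues : ℕ) : ℝ))) := by
  refine ⟨fun L F _ _ _ I s hs x hx => ⟨BilevelSelection.Instance.exists_adversaryAlg hx,
      fun d hd => hd.isAdversaryOptimal hs hx⟩,
    fun L F _ _ _ I s hs => ⟨I.exists_leaderAlg, fun x hx => hx.isLeaderOptimal hs⟩,
    ⟨BilevelSelection.adversaryProg, 200, fun nl nf I V x hV hx => ?_⟩,
    ⟨BilevelSelection.leaderProg, 1000, fun nl nf I V hV => ?_⟩⟩
  -- The argument proved by `rfl` is the freshness of the table's admissibility flags: the input
  -- leaves array `4` of natural numbers at zero.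
  · obtain ⟨k, τ, hexec, hk, hτ⟩ := BilevelSelection.runs_adversaryProg (I.adversaryInput V x)
      (BilevelSelection.loaded_adversaryInput hV x) (fun _ => rfl) (x := x)
      (fun i => by simp [BilevelSelection.Instance.adversaryInput]) hx
    refine ⟨k, τ, hexec, hτ, fun hN => hk.trans ?_⟩
    rw [BilevelSelection.Instance.numItems, Fintype.card_fin, Fintype.card_fin] at hN ⊢
    exact BilevelSelection.adversaryTime_le I.card_le_numValues hN
  · obtain ⟨k, τ, hexec, hk, hτ⟩ := BilevelSelection.runs_leaderProg (I.leaderInput V)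
      (BilevelSelection.loaded_leaderInput hV) (fun _ => rfl)
    refine ⟨k, τ, hexec, hτ, fun hN => (Nat.cast_le.2 hk).trans ?_⟩
    rw [BilevelSelection.Instance.numItems, Fintype.card_fin, Fintype.card_fin] at hN ⊢
    exact BilevelSelection.leaderTime_le_log hN
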